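/- Conventions. $V$ is a vertex operator algebra over $\mathbb{C}$ in the usual sense ($V=\bigoplus_{n\in\mathbb{Z}}V_{(n)}$, $\dim V_{(n)}<\infty$, $V_{(n)}=0$ for $n\ll 0$), with vertex operators $Y(a,x)=\sum_{n\in\mathbb{Z}}a_nx^{-n-1}$, vacuum $\mathbf 1$, conformal vector $\omega$, $L(n)=\omega_{n+1}$. A *weak $V$-module* is a vector space $M$ with a linear map $Y:V\to(\mathrm{End}\,M)[[x,x^{-1}]]$ satisfying $Y(\mathbf 1,x)=1$, $Y(L(-1)a,x)=\frac{d}{dx}Y(a,x)$, $Y(a,x)w\in M((x))$ and the Jacobi identity; a submodule is a subspace stable under all $a_n$, and an irreducible weak module is a nonzero one with no proper nonzero submodule. $M$ is *$\mathbb{N}$-gradable* if $M=\bigoplus_{k\in\mathbb{N}}M(k)$ with $a_nM(k)\subseteq M(m-n-1+k)$ for $a\in V_{(m)}$ (where $M(k)=0$ for $k<0$), and $V$ is *rational* if every $\mathbb{N}$-gradable weak $V$-module is a direct sum of irreducible $\mathbb{N}$-gradable weak $V$-modules. $\mathcal{C}_0$ is the category of weak $V$-modules $M$ that are the direct sum of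 their $L(0)$-eigenspaces $M_{(h)}$, $h\in\mathbb{C}$ (of arbitrary dimension), such that for each $h$ one has $M_{(h+n)}=0$ for all sufficiently small $n\in\mathbb{Z}$. An *intertwining operator* of type $\binom{W_3}{W_1\,W_2}$ is a linear map $I(\cdot,x):W_1\to \mathrm{Hom}(W_2,W_3)\{x\}$, $I(u,x)=\sum_{\alpha\in\mathbb{C}}u_\alpha x^{-\alpha-1}$, such that $u_{\alpha+n}v=0$ for $n\in\mathbb{Z}$ large (for fixed $u,v,\alpha$), $I(L(-1)u,x)v=\frac{d}{dx}I(u,x)v$, and the Jacobi identity $$x_0^{-1}\delta\left(\tfrac{x_1-x_2}{x_0}\right)Y(a,x_1)I(u,x_2)v-x_0^{-1}\delta\left(\tfrac{-x_2+x_1}{x_0}\right)I(u,x_2)Y(a,x_1)v=x_2^{-1}\delta\left(\tfrac{x_1-x_0}{x_2}\right)I(Y(a,x_0)u,x_2)v$$ holds. A *tensor product in $\mathcal{C}_0$* for an ordered pair $(W_1,W_2)$ of objects of $\mathcal{C}_0$ is an object $M$ of $\mathcal{C}_0$ with an intertwining operator $F$ of type $\binom{M}{W_1\,W_2}$ such that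 for every object $W$ of $\mathcal{C}_0$ and every intertwining operator $I$ of type $\binom{W}{W_1\,W_2}$ there is a unique $V$-homomorphism $\psi:M\to W$ with $I(\cdot,x)=\psi\circ F(\cdot,x)$. Construction. Let $W_1,W_2$ be irreducible weak $V$-modules in $\mathcal{C}_0$. Let $h_i$ be the lowest weight of $W_i$, so $W_i=\bigoplus_{n\in\mathbb{N}}W_i(n)$ with $W_i(n)=(W_i)_{(n+h_i)}$ and $W_i(0)\neq0$. On $F_0=\mathbb{C}[t,t^{-1}]\otimes W_1\otimes W_2$ let, for $a\in V$ and $m\in\mathbb{Z}$, $$a(m)(t^n\otimes u\otimes v)=t^n\otimes u\otimes a_mv+\sum_{i\ge0}\binom mi\,t^{m+n-i}\otimes a_iu\otimes v ,$$ and put $\deg(t^k\otimes u\otimes v)=m+n-k-1$ for $u\in W_1(m)$, $v\in W_2(n)$. Let $J_0$ be the smallest subspace that is stable under all $a(k)$ and contains $t^{m+n+i}\otimes W_1(m)\otimes W_2(n)$ for all $m,n,i\in\mathbb{N}$; let $F_1=F_0/J_0$, with quotient map $\pi_1$. With $Y_t(u,x)=\sum_n(t^n\otimes u)x^{-n-1}$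 for $u\in W_1$ and $Y_t(a,x)=\sum_m a(m)x^{-m-1}$ for $a\in V$, let $J_1\subseteq F_1$ be the linear span of all coefficients of $$x_0^{-1}\delta\left(\tfrac{x_1-x_2}{x_0}\right)Y_t(a,x_1)\pi_1(Y_t(u,x_2)\otimes v)-x_0^{-1}\delta\left(\tfrac{-x_2+x_1}{x_0}\right)\pi_1(Y_t(u,x_2)\otimes Y(a,x_1)v)-x_2^{-1}\delta\left(\tfrac{x_1-x_0}{x_2}\right)\pi_1(Y_t(Y(a,x_0)u,x_2)\otimes v)$$ for $a\in V,u\in W_1,v\in W_2$, and let $F_2=F_1/J_1$, with the induced gradation. Let $R$ be the largest graded submodule of $F_2$ with $R\cap F_2(0)=0$, put $T(W_1,W_2)=F_2/R$, and let $\pi:F_0\to T(W_1,W_2)$ be the quotient map. **Theorem.** Let $V$ be rational and let $W_1,W_2$ be irreducible weak $V$-modules in $\mathcal{C}_0$. Then the operators $a(k)$ induce on $T=T(W_1,W_2)$ the structure of a weak $V$-module, and $T=\bigoplus_{\lambda\in\mathbb{C}}T^{(\lambda)}$, where $T^{(\lambda)}$ is the sum of all irreducible submodules of $T$ of lowest weight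 $\lambda$ and $T^{(\lambda)}\ne0$ for only finitely many $\lambda$. Let $P_\lambda:T\to T^{(\lambda)}$ be the projections and $$F(u_1,x)u_2=\sum_{\lambda}x^{\lambda-h_1-h_2}\,P_\lambda\,\pi(Y_t(u_1,x)\otimes u_2)\qquad(u_1\in W_1,\ u_2\in W_2).$$ Then $(T(W_1,W_2),F(\cdot,x))$ is a tensor product for the ordered pair $(W_1,W_2)$ in the category $\mathcal{C}_0$. -/

import Mathlib

open scoped TensorProduct LaurentPolynomial

universe u

namespace VOA

noncomputable section

/-- The coefficient of `x₀^(-l-1) x₁^(-m-1) x₂^(-n-1)` in the difference (left minus right) of the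
two sides of a Jacobi identity
`x₀⁻¹ δ((x₁ - x₂)/x₀) P(x₁, x₂) - x₀⁻¹ δ((-x₂ + x₁)/x₀) Q(x₁, x₂) - x₂⁻¹ δ((x₁ - x₀)/x₂) R(x₀, x₂)`,
each binomial being expanded in nonnegative powers of its second variable.
With `P = ∑ P_{r,s} x₁^(-r-1) x₂^(-s-1)` etc., the arguments are
`p i = P_{m+l-i, n+i}`, `q i = Q_{m+i, n+l-i}` and `r i = R_{l+i, m+n-i}`, where `R` is indexed by
the powers of `x₀` and `x₂`. All sums are finite wherever this is used. -/
def jacobiCoeff {M : Type*} [AddCommGroup M] [Module ℂ M] (l m : ℤ) (p q r : ℕ → M) : M :=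
  (∑ᶠ i : ℕ, (((-1) ^ i * Ring.choose l i : ℤ) : ℂ) • p i)
    - (∑ᶠ i : ℕ, ((((l - i).negOnePow : ℤ) * Ring.choose l i : ℤ) : ℂ) • q i)
    - ∑ᶠ i : ℕ, ((Ring.choose m i : ℤ) : ℂ) • r i

/-- Vertex operator algebras over `ℂ`. `Y a n` is the mode `a_n` in
`Y(a, x) = ∑ a_n x^(-n-1)`; `L(n) = ω_{n+1}`. -/
structure VertexOperatorAlgebra (V : Type u) [AddCommGroup V] [Module ℂ V] where
  Y : V →ₗ[ℂ] (ℤ → Module.End ℂ V)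
  vacuum : V
  conformal : V
  rank : ℂ
  grade : ℤ → Submodule ℂ V
  grade_indep : iSupIndep grade
  grade_iSup : ⨆ n, grade n = ⊤
  grade_finite : ∀ n, FiniteDimensional ℂ (grade n)
  grade_bdd : ∃ N : ℤ, ∀ n < N, grade n = ⊥
  vacuum_act : ∀ (n : ℤ) (b : V), Y vacuum n b = if n = -1 then b else 0
  creation : ∀ (a : V) (n : ℤ), 0 ≤ n → Y a n vacuum = 0
  creation_neg_one : ∀ a : V, Y a (-1) vacuum = a
  truncation : ∀ a b : V, ∃ N : ℤ, ∀ n ≥ N, Y a n b = 0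
  jacobi : ∀ (a b c : V) (l m n : ℤ),
    jacobiCoeff l m (fun i => Y a (m + l - i) (Y b (n + i) c))
      (fun i => Y b (n + l - i) (Y a (m + i) c))
      (fun i => Y (Y a (l + i) b) (m + n - i) c) = 0
  virasoro : ∀ (m n : ℤ) (b : V),
    Y conformal (m + 1) (Y conformal (n + 1) b) - Y conformal (n + 1) (Y conformal (m + 1) b)
      = ((m : ℂ) - n) • Y conformal (m + n + 1) b
        + (if m + n = 0 then ((m : ℂ) ^ 3 - m) / 12 * rank else 0) • b
  derivative : ∀ (a : V) (n : ℤ), Y (Y conformal 0 a) n = (-n : ℂ) • Y a (n - 1)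
  weight : ∀ (n : ℤ), ∀ b ∈ grade n, Y conformal 1 b = (n : ℂ) • b

variable {V : Type u} [AddCommGroup V] [Module ℂ V]

/-- Weak modules: the vacuum axiom, the `L(-1)`-derivative axiom, truncation and the Jacobi
identity. `Y a n` is the mode `a_n` acting on the module. -/
structure WeakModule (A : VertexOperatorAlgebra V) (M : Type u) [AddCommGroup M] [Module ℂ M] where
  Y : V →ₗ[ℂ] (ℤ → Module.End ℂ M)
  vacuum_act : ∀ (n : ℤ) (w : M), Y A.vacuum n w = if n = -1 then w else 0
  derivative : ∀ (a : V) (n : ℤ), Y (A.Y A.conformal 0 a) n = (-n : ℂ) • Y a (n - 1)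
  truncation : ∀ (a : V) (w : M), ∃ N : ℤ, ∀ n ≥ N, Y a n w = 0
  jacobi : ∀ (a b : V) (w : M) (l m n : ℤ),
    jacobiCoeff l m (fun i => Y a (m + l - i) (Y b (n + i) w))
      (fun i => Y b (n + l - i) (Y a (m + i) w))
      (fun i => Y (A.Y a (l + i) b) (m + n - i) w) = 0

namespace WeakModule

variable {A : VertexOperatorAlgebra V} {M : Type u} [AddCommGroup M] [Module ℂ M]

/-- The operator `L(n) = ω_{n+1}` on a weak module. -/
def L (X : WeakModule A M) (n : ℤ) : Module.End ℂ M := X.Y A.conformal (n + 1)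

/-- The homogeneous subspace `M_(h)`: the `h`-eigenspace of `L(0)`. -/
def wt (X : WeakModule A M) (h : ℂ) : Submodule ℂ M := Module.End.eigenspace (X.L 0) h

/-- A weak module is in the category `𝒞₀` if it is the (automatically direct) sum of its `L(0)`-
eigenspaces, of any dimension, and for every `h` one has `M_(h+n) = 0` for all sufficiently
small integers `n`. -/
def InC0 (X : WeakModule A M) : Prop :=
  (⨆ h : ℂ, X.wt h = ⊤) ∧ ∀ h : ℂ, ∃ N : ℤ, ∀ n < N, X.wt (h + n) = ⊥

/-- A subspace is a submodule if it is stable under all modes. -/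
def IsSub (X : WeakModule A M) (S : Submodule ℂ M) : Prop :=
  ∀ (a : V) (n : ℤ), ∀ w ∈ S, X.Y a n w ∈ S

/-- `S` is an irreducible submodule of `M`. -/
def IsIrredSub (X : WeakModule A M) (S : Submodule ℂ M) : Prop :=
  X.IsSub S ∧ S ≠ ⊥ ∧ ∀ N ≤ S, X.IsSub N → N = ⊥ ∨ N = S

/-- `M` is an irreducible weak module. -/
def IsIrreducible (X : WeakModule A M) : Prop := X.IsIrredSub ⊤

/-- The submodule `S`, as a weak module in its own right, is `ℕ`-gradable: `S = ⨁_{n ∈ ℕ} G n`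
(with `G n = 0` for `n < 0`) and `a_n G(k) ⊆ G(m - n - 1 + k)` for `a` of weight `m`. -/
def IsNGradableSub (X : WeakModule A M) (S : Submodule ℂ M) : Prop :=
  ∃ G : ℤ → Submodule ℂ M, iSupIndep G ∧ ⨆ n, G n = S ∧ (∀ n < 0, G n = ⊥) ∧
    ∀ (m n k : ℤ), ∀ a ∈ A.grade m, ∀ w ∈ G k, X.Y a n w ∈ G (m - n - 1 + k)

/-- `M` is an `ℕ`-gradable weak module. -/
def IsNGradable (X : WeakModule A M) : Prop := X.IsNGradableSub ⊤

/-- `h` is the lowest weight of the submodule `S`: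
`S = ⨁_{n ∈ ℕ} S_(h+n)` and `S_(h) ≠ 0`. -/
def IsLowestWeight (X : WeakModule A M) (S : Submodule ℂ M) (h : ℂ) : Prop :=
  S ⊓ X.wt h ≠ ⊥ ∧ ⨆ n : ℕ, S ⊓ X.wt (h + n) = S

open Classical in
/-- The lowest weight of `M` (meaningful if `M` has one, in particular for every irreducible
weak module in `𝒞₀`). -/
def lowestWeight (X : WeakModule A M) : ℂ :=
  if e : ∃ h, X.IsLowestWeight ⊤ h then e.choose else 0

/-- The gradation `M(n) = M_(n+h)`, `n ∈ ℕ`, with `h` the lowest weight of `M`. -/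
def deg (X : WeakModule A M) (n : ℕ) : Submodule ℂ M := X.wt (X.lowestWeight + n)

/-- `M^(c)`: the sum of all irreducible submodules of lowest weight `c`. -/
def isotypic (X : WeakModule A M) (c : ℂ) : Submodule ℂ M :=
  sSup {S | X.IsIrredSub S ∧ X.IsLowestWeight S c}

open Classical in
/-- The projection of `M` onto the summand `M^(c)`, when `M = ⨁_c M^(c)` (zero otherwise). -/
def isotypicProj (X : WeakModule A M) (c : ℂ) : M →ₗ[ℂ] M :=
  if e : Function.Bijective (DirectSum.coeLinearMap X.isotypic) then
    (X.isotypic c).subtype ∘ₗ DirectSum.component ℂ ℂ (fun d => X.isotypic d) c ∘ₗ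
      (LinearEquiv.ofBijective (DirectSum.coeLinearMap X.isotypic) e).symm.toLinearMap
  else 0

end WeakModule

/-- A vertex operator algebra is rational if every `ℕ`-gradable weak module is a direct sum of
irreducible `ℕ`-gradable weak modules. -/
def VertexOperatorAlgebra.IsRational (A : VertexOperatorAlgebra V) : Prop :=
  ∀ (M : Type u) [AddCommGroup M] [Module ℂ M] (X : WeakModule A M), X.IsNGradable →
    ∃ (ι : Type u) (S : ι → Submodule ℂ M),
      (∀ i, X.IsIrredSub (S i) ∧ X.IsNGradableSub (S i)) ∧ iSupIndep S ∧ ⨆ i, S i = ⊤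

section Intertwining

variable {A : VertexOperatorAlgebra V}
  {W₁ W₂ W₃ : Type u} [AddCommGroup W₁] [Module ℂ W₁] [AddCommGroup W₂] [Module ℂ W₂]
  [AddCommGroup W₃] [Module ℂ W₃]

/-- `V`-homomorphisms. -/
def IsHom (X : WeakModule A W₁) (Z : WeakModule A W₂) (f : W₁ →ₗ[ℂ] W₂) : Prop :=
  ∀ (a : V) (n : ℤ) (w : W₁), f (X.Y a n w) = Z.Y a n (f w)

/-- Intertwining operators `I(·, x) : W₁ → Hom(W₂, W₃){x}` of type `(W₃; W₁ W₂)`.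
`I u α` is the mode `u_α` in `I(u, x) = ∑_{α ∈ ℂ} u_α x^(-α-1)`. The three conditions are
truncation, the `L(-1)`-derivative property, and the Jacobi identity. -/
structure IsIntertwining (X₁ : WeakModule A W₁) (X₂ : WeakModule A W₂) (X₃ : WeakModule A W₃)
    (I : W₁ →ₗ[ℂ] (ℂ → (W₂ →ₗ[ℂ] W₃))) : Prop where
  truncation : ∀ (u : W₁) (v : W₂) (α : ℂ), ∃ N : ℤ, ∀ n ≥ N, I u (α + n) v = 0
  derivative : ∀ (u : W₁) (v : W₂) (α : ℂ), I (X₁.L (-1) u) α v = (-α) • I u (α - 1) v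
  jacobi : ∀ (a : V) (u : W₁) (v : W₂) (l m : ℤ) (α : ℂ),
    jacobiCoeff l m (fun i => X₃.Y a (m + l - i) (I u (α + i) v))
      (fun i => I u (α + l - i) (X₂.Y a (m + i) v))
      (fun i => I (X₁.Y a (l + i) u) (m + α - i) v) = 0

/-- `(X₃, F)` is a tensor product of the ordered pair `(X₁, X₂)` in the category `𝒞₀`. -/
structure IsTensorProductC0 (X₁ : WeakModule A W₁) (X₂ : WeakModule A W₂) (X₃ : WeakModule A W₃)
    (F : W₁ →ₗ[ℂ] (ℂ → (W₂ →ₗ[ℂ] W₃))) : Prop where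
  left_mem : X₁.InC0
  right_mem : X₂.InC0
  mem : X₃.InC0
  intertwining : IsIntertwining X₁ X₂ X₃ F
  universal : ∀ (W : Type u) [AddCommGroup W] [Module ℂ W] (X : WeakModule A W), X.InC0 →
    ∀ I : W₁ →ₗ[ℂ] (ℂ → (W₂ →ₗ[ℂ] W)), IsIntertwining X₁ X₂ X I →
      ∃! g : W₃ →ₗ[ℂ] W, IsHom X₃ X g ∧ ∀ u α v, I u α v = g (F u α v)

end Intertwining

section Construction

variable {A : VertexOperatorAlgebra V}
  {W₁ W₂ : Type u} [AddCommGroup W₁] [Module ℂ W₁] [AddCommGroup W₂] [Module ℂ W₂]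

theorem finite_loop_support (X : WeakModule A W₁) (a : V) (m : ℤ) (p : ℂ[T;T⁻¹]) (w : W₁) :
    (Function.support fun i : ℕ => ((Ring.choose m i : ℤ) : ℂ) •
      ((LaurentPolynomial.T (m - i) * p : ℂ[T;T⁻¹]) ⊗ₜ[ℂ] X.Y a i w)).Finite := by
  obtain ⟨N, hN⟩ := X.truncation a w
  refine (Set.finite_lt_nat N.toNat).subset fun i hi => ?_
  by_contra h
  simp only [Set.mem_ofPred_eq, not_lt, Int.toNat_le] at h
  exact hi (by simp [hN i h])

/-- The action of `a(m)` on `ℂ[t,t⁻¹] ⊗ W₁`: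
`a(m) (p ⊗ u) = ∑_{i ≥ 0} binom(m, i) t^(m-i) p ⊗ a_i u`. -/
def loopAct (X : WeakModule A W₁) (a : V) (m : ℤ) : Module.End ℂ (ℂ[T;T⁻¹] ⊗[ℂ] W₁) :=
  TensorProduct.lift <| LinearMap.mk₂ ℂ
    (fun p u => ∑ᶠ i : ℕ, ((Ring.choose m i : ℤ) : ℂ) •
      ((LaurentPolynomial.T (m - i) * p : ℂ[T;T⁻¹]) ⊗ₜ[ℂ] X.Y a i u))
    (fun p q u => by
      rw [← finsum_add_distrib (finite_loop_support X a m p u) (finite_loop_support X a m q u)]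
      simp only [mul_add, TensorProduct.add_tmul, smul_add])
    (fun c p u => by
      rw [smul_finsum' c (finite_loop_support X a m p u)]
      simp only [mul_smul_comm, ← TensorProduct.smul_tmul', smul_comm c])
    (fun p u v => by
      rw [← finsum_add_distrib (finite_loop_support X a m p u) (finite_loop_support X a m p v)]
      simp only [map_add, TensorProduct.tmul_add, smul_add])
    (fun c p u => by
      rw [smul_finsum' c (finite_loop_support X a m p u)]
      simp only [map_smul, TensorProduct.tmul_smul, smul_comm c])

variable (W₁ W₂) in
/-- `F₀(W₁, W₂) = ℂ[t,t⁻¹] ⊗ W₁ ⊗ W₂`. -/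
abbrev F0 : Type u := ℂ[T;T⁻¹] ⊗[ℂ] (W₁ ⊗[ℂ] W₂)

/-- The element `tⁿ ⊗ u ⊗ v` of `F₀`. -/
def gen (n : ℤ) (u : W₁) (v : W₂) : F0 W₁ W₂ :=
  (LaurentPolynomial.T n : ℂ[T;T⁻¹]) ⊗ₜ[ℂ] (u ⊗ₜ[ℂ] v)

/-- The action of `a(m) = t^m ⊗ a` on `F₀`: `a(m) (tⁿ ⊗ u ⊗ v)
= tⁿ ⊗ u ⊗ a_m v + ∑_{i ≥ 0} binom(m, i) t^(m+n-i) ⊗ a_i u ⊗ v`. -/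
def act0 (X₁ : WeakModule A W₁) (X₂ : WeakModule A W₂) (a : V) (m : ℤ) :
    Module.End ℂ (F0 W₁ W₂) :=
  LinearMap.lTensor ℂ[T;T⁻¹] (LinearMap.lTensor W₁ (X₂.Y a m))
    + (TensorProduct.assoc ℂ ℂ[T;T⁻¹] W₁ W₂).conj (LinearMap.rTensor W₂ (loopAct X₁ a m))

/-- The `ℤ`-grading of `F₀`: `deg (t^k ⊗ u ⊗ v) = m + n - k - 1` for `u ∈ W₁(m)`,
`v ∈ W₂(n)`. -/
def grade0 (X₁ : WeakModule A W₁) (X₂ : WeakModule A W₂) (d : ℤ) : Submodule ℂ (F0 W₁ W₂) :=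
  Submodule.span ℂ {x | ∃ (k : ℤ) (m n : ℕ), ∃ u ∈ X₁.deg m, ∃ v ∈ X₂.deg n,
    (m : ℤ) + n - k - 1 = d ∧ x = gen k u v}

/-- `J₀`: the smallest subspace of `F₀` that is stable under all `a(k)` and contains all
`t^(m+n+i) ⊗ W₁(m) ⊗ W₂(n)`, `m, n, i ∈ ℕ`. -/
def J0 (X₁ : WeakModule A W₁) (X₂ : WeakModule A W₂) : Submodule ℂ (F0 W₁ W₂) :=
  sInf {N | (∀ (a : V) (k : ℤ), ∀ x ∈ N, act0 X₁ X₂ a k x ∈ N) ∧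
    ∀ (m n i : ℕ), ∀ u ∈ X₁.deg m, ∀ v ∈ X₂.deg n, gen ((m : ℤ) + n + i) u v ∈ N}

theorem act0_mem_J0 (X₁ : WeakModule A W₁) (X₂ : WeakModule A W₂) (a : V) (k : ℤ) :
    J0 X₁ X₂ ≤ (J0 X₁ X₂).comap (act0 X₁ X₂ a k) := by
  intro x hx
  simp only [J0, Submodule.mem_comap, Submodule.mem_sInf] at hx ⊢
  exact fun N hN => hN.1 a k x (hx N hN)

/-- `F₁(W₁, W₂) = F₀(W₁, W₂) / J₀`. -/
abbrev F1 (X₁ : WeakModule A W₁) (X₂ : WeakModule A W₂) : Type u := F0 W₁ W₂ ⧸ J0 X₁ X₂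

/-- The action of `a(k)` on `F₁`. -/
def act1 (X₁ : WeakModule A W₁) (X₂ : WeakModule A W₂) (a : V) (k : ℤ) :
    Module.End ℂ (F1 X₁ X₂) :=
  (J0 X₁ X₂).mapQ (J0 X₁ X₂) (act0 X₁ X₂ a k) (act0_mem_J0 X₁ X₂ a k)

/-- The image `π₁ (tⁿ ⊗ u ⊗ v)` in `F₁`. -/
def gen1 (X₁ : WeakModule A W₁) (X₂ : WeakModule A W₂) (n : ℤ) (u : W₁) (v : W₂) : F1 X₁ X₂ :=
  (J0 X₁ X₂).mkQ (gen n u v)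

/-- `J₁`: the span in `F₁` of all coefficients of the Jacobi expressions
`x₀⁻¹ δ((x₁ - x₂)/x₀) Y_t(a, x₁) π₁(Y_t(u, x₂) ⊗ v)
- x₀⁻¹ δ((-x₂ + x₁)/x₀) π₁(Y_t(u, x₂) ⊗ Y(a, x₁) v)
- x₂⁻¹ δ((x₁ - x₀)/x₂) π₁(Y_t(Y(a, x₀) u, x₂) ⊗ v)`. -/
def J1 (X₁ : WeakModule A W₁) (X₂ : WeakModule A W₂) : Submodule ℂ (F1 X₁ X₂) :=
  Submodule.span ℂ {x | ∃ (a : V) (u : W₁) (v : W₂) (l m n : ℤ),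
    x = jacobiCoeff l m (fun i => act1 X₁ X₂ a (m + l - i) (gen1 X₁ X₂ (n + i) u v))
      (fun i => gen1 X₁ X₂ (n + l - i) u (X₂.Y a (m + i) v))
      (fun i => gen1 X₁ X₂ (m + n - i) (X₁.Y a (l + i) u) v)}

/-- `F₂(W₁, W₂) = F₁(W₁, W₂) / J₁`. -/
abbrev F2 (X₁ : WeakModule A W₁) (X₂ : WeakModule A W₂) : Type u := F1 X₁ X₂ ⧸ J1 X₁ X₂

/-- The quotient map `F₀ → F₂`. -/
def π₂ (X₁ : WeakModule A W₁) (X₂ : WeakModule A W₂) : F0 W₁ W₂ →ₗ[ℂ] F2 X₁ X₂ :=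
  (J1 X₁ X₂).mkQ ∘ₗ (J0 X₁ X₂).mkQ

/-- The induced gradation of `F₂`. -/
def grade2 (X₁ : WeakModule A W₁) (X₂ : WeakModule A W₂) (d : ℤ) : Submodule ℂ (F2 X₁ X₂) :=
  (grade0 X₁ X₂ d).map (π₂ X₁ X₂)

/-- `N` is a graded submodule of `F₂`. The action of `a(k)` on the quotient `F₂` of `F₀` is the
induced one, `a(k) π₂(x) = π₂(a(k) x)`. -/
def IsGradedSub2 (X₁ : WeakModule A W₁) (X₂ : WeakModule A W₂) (N : Submodule ℂ (F2 X₁ X₂)) :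
    Prop :=
  (∀ (a : V) (k : ℤ) (x : F0 W₁ W₂), π₂ X₁ X₂ x ∈ N → π₂ X₁ X₂ (act0 X₁ X₂ a k x) ∈ N) ∧
    ⨆ d : ℤ, N ⊓ grade2 X₁ X₂ d = N

/-- The radical of `F₂`: the largest graded submodule that meets `F₂(0)` trivially. -/
def radical (X₁ : WeakModule A W₁) (X₂ : WeakModule A W₂) : Submodule ℂ (F2 X₁ X₂) :=
  sSup {N | IsGradedSub2 X₁ X₂ N ∧ N ⊓ grade2 X₁ X₂ 0 = ⊥}

/-- The space `T(W₁, W₂) = F₂(W₁, W₂) / radical`. -/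
abbrev TP (X₁ : WeakModule A W₁) (X₂ : WeakModule A W₂) : Type u :=
  F2 X₁ X₂ ⧸ radical X₁ X₂

/-- The quotient map `π : F₀ → T(W₁, W₂)`. -/
def proj (X₁ : WeakModule A W₁) (X₂ : WeakModule A W₂) : F0 W₁ W₂ →ₗ[ℂ] TP X₁ X₂ :=
  (radical X₁ X₂).mkQ ∘ₗ π₂ X₁ X₂

/-- The bilinear map `(u, v) ↦ P_c π (tⁿ ⊗ u ⊗ v)`, where `P_c` is the projection of
`T(W₁, W₂)` (with a given structure of weak module) onto `T(W₁, W₂)^(c)`. -/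
def projGen (X₁ : WeakModule A W₁) (X₂ : WeakModule A W₂) (Z : WeakModule A (TP X₁ X₂))
    (c : ℂ) (n : ℤ) : W₁ →ₗ[ℂ] W₂ →ₗ[ℂ] TP X₁ X₂ :=
  (TensorProduct.mk ℂ W₁ W₂).compr₂ (Z.isotypicProj c ∘ₗ proj X₁ X₂ ∘ₗ
    TensorProduct.mk ℂ ℂ[T;T⁻¹] (W₁ ⊗[ℂ] W₂) (LaurentPolynomial.T n))

open Classical in
/-- The operator `u, v ↦ x^(c - h₁ - h₂) P_c π (Y_t(u, x) ⊗ v)`, with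
`Y_t(u, x) = ∑_{n ∈ ℤ} (tⁿ ⊗ u) x^(-n-1)` and `h₁, h₂` the lowest weights of `W₁, W₂`; its mode of
index `α`, the coefficient of `x^(-α-1)`, comes from the integer `n = α + c - h₁ - h₂`
if this is an integer, and is zero otherwise. -/
def canonicalPart (X₁ : WeakModule A W₁) (X₂ : WeakModule A W₂) (Z : WeakModule A (TP X₁ X₂))
    (c : ℂ) : W₁ →ₗ[ℂ] (ℂ → (W₂ →ₗ[ℂ] TP X₁ X₂)) :=
  LinearMap.pi fun α =>
    if e : ∃ n : ℤ, (n : ℂ) = α + c - X₁.lowestWeight - X₂.lowestWeight then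
      projGen X₁ X₂ Z c e.choose
    else 0

/-- The canonical operator `F(u, x) v = ∑_c x^(c - h₁ - h₂) P_c π (Y_t(u, x) ⊗ v)`. Only
the finitely many `c` with `T(W₁, W₂)^(c) ≠ 0` contribute. -/
def canonicalF (X₁ : WeakModule A W₁) (X₂ : WeakModule A W₂) (Z : WeakModule A (TP X₁ X₂)) :
    W₁ →ₗ[ℂ] (ℂ → (W₂ →ₗ[ℂ] TP X₁ X₂)) :=
  ∑ᶠ c : ℂ, canonicalPart X₁ X₂ Z c

end Construction

end

end VOA

/-! The argument has a formal half, which makes T a graded weak module, and a half in which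
rationality is used.

Formal half. Series are arrays of coefficients, and multiplication by `x₁ - x₂` is a difference of
two shifts (`shiftSub`). A power of it is injective on arrays truncated along the relevant direction
(`eq_zero_of_shiftSub_pow`). The formula for `a(m)` on F₀ is the commutator formula between `Y_t(a,
x₁)` and `Y_t(u, x₂)`, so these operators are mutually local, and J₀ makes `Y_t(u, x) ⊗ v`
truncated. Multiplying the defect of the Jacobi identity by `(x₁ - z)^N (x₂ - z)^N` therefore kills
it, and cancelling this factor shows that the identity passes from W₂ to F₁ (`jacobi_transfer`). The
same cancellation shows that J₁ is stable under V (`J1_isSub`), so F₂ and T are weak modules.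
Gradations are carried by degree operators: a graded subspace is one stable under the operator, and
dividing by the radical means that every nonzero graded submodule of T meets degree 0
(`eq_bot_of_inf_degreeT`).

Rational half. Irreducible modules have countable dimension, so Schur's lemma holds by Dixmier's
argument. Hence on an ℕ-gradable irreducible module `L(0)` minus the degree is a scalar, and a
lowest weight exists. Complete reducibility then yields an endomorphism `θ` acting on each
irreducible submodule by its lowest weight, with `L(0) - θ` a second degree operator
(`exists_lowestWeightOp`). Finiteness of the set of lowest weights follows by applying rationality
to the module of sequences of bounded degree (`finite_isotypic`).

On T the two degree operators coincide (`IsDegreeOp.eq`), so `L(0)` minus the degree is the scalar c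
on T^(c). This fixes the exponent c - h₁ - h₂ in F and is exactly the `L(-1)`-derivative property;
the Jacobi identity for F is the vanishing of J₁. For universality, objects of 𝒞₀ are ℕ-gradable, so
a target W also splits into isotypic components. The component `P_c I`, with its power of x removed,
defines a map on F₀ compatible with action and degree. It kills J₀ because negative degrees do not
occur in W, J₁ by the Jacobi identity, and the radical because a submodule of W without degree-0
part is zero (`exists_componentHom`). Summing over c gives the homomorphism; it is unique because
the components of F recover all `P_c π(tⁿ ⊗ u ⊗ v)`. -/

namespace VOA

set_option linter.unusedSectionVars false

noncomputable section

/-! ### Finite support and linearity of Jacobi coefficients. -/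

section Sequences

variable {M M' : Type*} [AddCommGroup M] [Module ℂ M] [AddCommGroup M'] [Module ℂ M']

/-- A sequence that vanishes from some index on. -/
def EventuallyZero (f : ℕ → M) : Prop := ∃ N : ℕ, ∀ i ≥ N, f i = 0

namespace EventuallyZero

variable {f g : ℕ → M}

theorem zero : EventuallyZero (fun _ : ℕ => (0 : M)) := ⟨0, fun _ _ => rfl⟩

theorem add (hf : EventuallyZero f) (hg : EventuallyZero g) :
    EventuallyZero (fun i => f i + g i) := by
  obtain ⟨N, hN⟩ := hf
  obtain ⟨K, hK⟩ := hg
  exact ⟨max N K, fun i hi => by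
    simp only [hN i (le_of_max_le_left hi), hK i (le_of_max_le_right hi), add_zero]⟩

theorem map (hf : EventuallyZero f) (T : M →ₗ[ℂ] M') : EventuallyZero (fun i => T (f i)) := by
  obtain ⟨N, hN⟩ := hf
  exact ⟨N, fun i hi => by simp only [hN i hi, map_zero]⟩

theorem smul (hf : EventuallyZero f) (c : ℕ → ℂ) : EventuallyZero (fun i => c i • f i) := by
  obtain ⟨N, hN⟩ := hf
  exact ⟨N, fun i hi => by simp only [hN i hi, smul_zero]⟩

theorem finite (hf : EventuallyZero f) : (Function.support f).Finite := by
  obtain ⟨N, hN⟩ := hf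
  exact (Set.finite_lt_nat N).subset fun i hi => by
    by_contra h
    exact hi (hN i (not_lt.1 h))

end EventuallyZero

theorem finsum_eq_sum_range {f : ℕ → M} {N : ℕ} (h : ∀ i ≥ N, f i = 0) :
    ∑ᶠ i, f i = ∑ i ∈ Finset.range N, f i := by
  refine finsum_eq_finsetSum_of_support_subset f fun i hi => ?_
  by_contra h'
  exact hi (h i (by simpa using h'))

theorem map_finsum_of_eventuallyZero (T : M →ₗ[ℂ] M') {f : ℕ → M} (hf : EventuallyZero f) :
    T (∑ᶠ i, f i) = ∑ᶠ i, T (f i) :=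
  map_finsum T hf.finite

section Jacobi

variable {l m : ℤ} {p q r p' q' r' : ℕ → M}

theorem jacobiCoeff_add (hp : EventuallyZero p) (hq : EventuallyZero q) (hr : EventuallyZero r)
    (hp' : EventuallyZero p') (hq' : EventuallyZero q') (hr' : EventuallyZero r') :
    jacobiCoeff l m (fun i => p i + p' i) (fun i => q i + q' i) (fun i => r i + r' i)
      = jacobiCoeff l m p q r + jacobiCoeff l m p' q' r' := by
  simp only [jacobiCoeff, smul_add]
  rw [finsum_add_distrib (hp.smul _).finite (hp'.smul _).finite,
    finsum_add_distrib (hq.smul _).finite (hq'.smul _).finite,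
    finsum_add_distrib (hr.smul _).finite (hr'.smul _).finite]
  abel

theorem map_jacobiCoeff (T : M →ₗ[ℂ] M') (hp : EventuallyZero p) (hq : EventuallyZero q)
    (hr : EventuallyZero r) :
    T (jacobiCoeff l m p q r)
      = jacobiCoeff l m (fun i => T (p i)) (fun i => T (q i)) (fun i => T (r i)) := by
  simp only [jacobiCoeff, map_sub]
  rw [map_finsum_of_eventuallyZero T (hp.smul _), map_finsum_of_eventuallyZero T (hq.smul _),
    map_finsum_of_eventuallyZero T (hr.smul _)]
  simp only [map_smul]

theorem jacobiCoeff_smul (c : ℂ) (hp : EventuallyZero p) (hq : EventuallyZero q)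
    (hr : EventuallyZero r) :
    jacobiCoeff l m (fun i => c • p i) (fun i => c • q i) (fun i => c • r i)
      = c • jacobiCoeff l m p q r :=
  (map_jacobiCoeff (LinearMap.lsmul ℂ M c) hp hq hr).symm

theorem jacobiCoeff_sub (hp : EventuallyZero p) (hq : EventuallyZero q) (hr : EventuallyZero r)
    (hp' : EventuallyZero p') (hq' : EventuallyZero q') (hr' : EventuallyZero r') :
    jacobiCoeff l m (fun i => p i - p' i) (fun i => q i - q' i) (fun i => r i - r' i)
      = jacobiCoeff l m p q r - jacobiCoeff l m p' q' r' := by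
  have h := jacobiCoeff_smul (l := l) (m := m) (-1) hp' hq' hr'
  have h' := jacobiCoeff_add (l := l) (m := m) hp hq hr (hp'.smul fun _ => -1)
    (hq'.smul fun _ => -1) (hr'.smul fun _ => -1)
  rw [h] at h'
  simpa only [neg_smul, one_smul, ← sub_eq_add_neg] using h'

theorem jacobiCoeff_zero (m : ℤ) (p q r : ℕ → M) :
    jacobiCoeff 0 m p q r = p 0 - q 0 - ∑ᶠ i : ℕ, ((Ring.choose m i : ℤ) : ℂ) • r i := by
  have h : ∀ i : ℕ, i ≠ 0 → Ring.choose (0 : ℤ) i = 0 := fun i hi =>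
    Ring.choose_zero_pos ℤ (Nat.pos_of_ne_zero hi)
  rw [jacobiCoeff, finsum_eq_single _ 0 fun i hi => by simp [h i hi],
    finsum_eq_single _ 0 fun i hi => by simp [h i hi]]
  simp

theorem jacobiCoeff_eq_zero (hp : ∀ i, p i = 0) (hq : ∀ i, q i = 0) (hr : ∀ i, r i = 0) :
    jacobiCoeff l m p q r = 0 := by
  simp [jacobiCoeff, hp, hq, hr]

end Jacobi

end Sequences

/-! ### Formal series as arrays, and cancellation of powers of `x₁ - x₂`. -/

section Arrays

variable {G H : Type*} [AddCommGroup G] [AddCommGroup H]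
  {M M' : Type*} [AddCommGroup M] [Module ℂ M] [AddCommGroup M'] [Module ℂ M']

variable (M) in
/-- The shift by `e` of arrays indexed by an abelian group. -/
def shift (e : G) : Module.End ℂ (G → M) := LinearMap.funLeft ℂ M (· + e)

@[simp] theorem shift_apply (e : G) (φ : G → M) (x : G) : shift M e φ x = φ (x + e) := rfl

variable (M) in
/-- The difference of two shifts. -/
def shiftSub (e f : G) : Module.End ℂ (G → M) := shift M e - shift M f

@[simp] theorem shiftSub_apply (e f : G) (φ : G → M) (x : G) :
    shiftSub M e f φ x = φ (x + e) - φ (x + f) := rfl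

theorem commute_shiftSub (e f e' f' : G) : Commute (shiftSub M e f) (shiftSub M e' f') := by
  refine LinearMap.ext fun φ => funext fun x => ?_
  simp only [Module.End.mul_apply, shiftSub_apply, add_right_comm x]
  abel

theorem shiftSub_pow_comp (T : M →ₗ[ℂ] M') (e f : G) (N : ℕ) (φ : G → M) :
    (shiftSub M' e f ^ N) (fun x => T (φ x)) = fun x => T ((shiftSub M e f ^ N) φ x) := by
  induction N generalizing φ with
  | zero => rfl
  | succ N ih =>
    simp only [pow_succ, Module.End.mul_apply, ← ih]
    congr 1
    ext x
    simp

theorem shiftSub_pow_pullback (h : H → G) {e f : H} {e' f' : G} (he : ∀ x, h (x + e) = h x + e')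
    (hf : ∀ x, h (x + f) = h x + f') (N : ℕ) (φ : G → M) :
    (shiftSub M e f ^ N) (fun x => φ (h x)) = fun x => (shiftSub M e' f' ^ N) φ (h x) := by
  induction N generalizing φ with
  | zero => rfl
  | succ N ih =>
    simp only [pow_succ, Module.End.mul_apply, ← ih]
    congr 1
    ext x
    simp [he, hf]

theorem shiftSub_pow_eq_zero_mono {e f : G} {N K : ℕ} {φ : G → M} (hNK : N ≤ K)
    (h : (shiftSub M e f ^ N) φ = 0) : (shiftSub M e f ^ K) φ = 0 := by
  obtain ⟨j, rfl⟩ := Nat.exists_eq_add_of_le' hNK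
  rw [pow_add, Module.End.mul_apply, h, map_zero]

variable (M) in
/-- The arrays that are truncated along the direction `g`. -/
def truncated (g : G) : Submodule ℂ (G → M) where
  carrier := {φ | ∀ x, EventuallyZero fun j : ℕ => φ (x + j • g)}
  add_mem' hφ hψ x := (hφ x).add (hψ x)
  zero_mem' _ := .zero
  smul_mem' c _ hφ x := (hφ x).smul fun _ => c

theorem shiftSub_mem_truncated {g : G} {φ : G → M} (hφ : φ ∈ truncated M g) (e f : G) :
    shiftSub M e f φ ∈ truncated M g := by
  have h : ∀ e : G, shift M e φ ∈ truncated M g := fun e x => by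
    have := hφ (x + e)
    simpa only [shift_apply, add_right_comm x] using this
  exact Submodule.sub_mem _ (h e) (h f)

theorem shiftSub_pow_mem_truncated {g : G} {φ : G → M} (hφ : φ ∈ truncated M g) (e f : G)
    (N : ℕ) : (shiftSub M e f ^ N) φ ∈ truncated M g := by
  induction N with
  | zero => exact hφ
  | succ N ih => rw [pow_succ', Module.End.mul_apply]; exact shiftSub_mem_truncated ih e f

/-- An array killed by a single difference is constant along `f - e`, so truncation in that
direction forces it to vanish; powers follow by induction. This replaces division by `(x₁ - x₂)^N`,
which is not legitimate for general two-sided series. -/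
theorem eq_zero_of_shiftSub_pow {e f : G} {φ : G → M} {N : ℕ} (hφ : φ ∈ truncated M (f - e))
    (h : (shiftSub M e f ^ N) φ = 0) : φ = 0 := by
  induction N generalizing φ with
  | zero => exact h
  | succ N ih =>
    rw [pow_succ, Module.End.mul_apply] at h
    have h1 := ih (shiftSub_mem_truncated hφ e f) h
    have h2 : ∀ x, φ x = φ (x + (f - e)) := fun x => by
      have := congrFun h1 (x - e)
      rw [shiftSub_apply, Pi.zero_apply, sub_eq_zero] at this
      convert this using 2 <;> abel
    have h3 : ∀ (j : ℕ) (x : G), φ x = φ (x + j • (f - e)) := fun j => by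
      induction j with
      | zero => simp
      | succ j ihj => intro x; rw [ihj, h2, add_assoc, succ_nsmul]
    funext x
    obtain ⟨K, hK⟩ := hφ x
    rw [h3 K x]
    exact hK K le_rfl

theorem eq_zero_of_shiftSub_pow' {e f : G} {φ : G → M} {N : ℕ} (hφ : φ ∈ truncated M (e - f))
    (h : (shiftSub M e f ^ N) φ = 0) : φ = 0 := by
  refine eq_zero_of_shiftSub_pow (e := f) (f := e) (N := N) hφ ?_
  rw [show shiftSub M f e = -shiftSub M e f from (neg_sub _ _).symm, neg_pow (shiftSub M e f),
    Module.End.mul_apply, h, map_zero]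

/-- The formal sum `∑ c_i φ(x + i g)`, for arrays truncated along `g`. -/
def dirSum (c : ℕ → ℂ) (g : G) (φ : G → M) : G → M := fun x => ∑ᶠ i : ℕ, c i • φ (x + i • g)

/-- Sums along a diagonal with coefficients independent of the position are products with a
one-sided series, so they commute with multiplication by polynomials. Truncation makes every sum
finite. -/
theorem shiftSub_pow_dirSum (c : ℕ → ℂ) {g : G} {φ : G → M} (hφ : φ ∈ truncated M g) (e f : G)
    (N : ℕ) : (shiftSub M e f ^ N) (dirSum c g φ) = dirSum c g ((shiftSub M e f ^ N) φ) := by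
  induction N generalizing φ with
  | zero => rfl
  | succ N ih =>
    rw [pow_succ, Module.End.mul_apply, Module.End.mul_apply,
      ← ih (shiftSub_mem_truncated hφ e f)]
    congr 1
    funext x
    simp only [dirSum, shiftSub_apply, smul_sub]
    rw [← finsum_sub_distrib]
    · simp only [add_right_comm x]
    · have := ((hφ (x + e)).smul c).finite
      exact Set.Finite.subset this fun i hi => by simpa only [add_right_comm x] using hi
    · have := ((hφ (x + f)).smul c).finite
      exact Set.Finite.subset this fun i hi => by simpa only [add_right_comm x] using hi

end Arrays

/-! ### Locality in two and three variables. -/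

section Locality

variable {M : Type*} [AddCommGroup M] [Module ℂ M]

/-- An array of the form `∑_{i < N} binom(m, i) f_i(m + n - i)` is killed by
`(x₁ - x₂)^N`. -/
theorem shiftSub_pow_sum_choose (N : ℕ) (f : ℕ → ℤ → M) :
    (shiftSub M ((1, 0) : ℤ × ℤ) (0, 1) ^ N) (fun x => ∑ i ∈ Finset.range N,
      ((Ring.choose x.1 i : ℤ) : ℂ) • f i (x.1 + x.2 - i)) = 0 := by
  induction N generalizing f with
  | zero => simp; rfl
  | succ N ih =>
    rw [pow_succ, Module.End.mul_apply]
    convert ih fun i => f (i + 1) using 2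
    funext x
    simp only [shiftSub_apply, Prod.fst_add, Prod.snd_add, add_zero]
    rw [← Finset.sum_sub_distrib, Finset.sum_range_succ']
    -- Pascal's rule lowers each binomial coefficient by one step. The term `i = 0` cancels, since
    -- its coefficient is 1 and its array depends only on the sum of the two indices.
    simp only [Ring.choose_succ_succ, Ring.choose_zero_right]
    rw [show x.1 + 1 + x.2 = x.1 + (x.2 + 1) by ring, sub_self, add_zero]
    refine Finset.sum_congr rfl fun i _ => ?_
    rw [← sub_smul]
    congr 2
    · push_cast; ring
    · push_cast; ring

/-- This and its left counterpart move a two-variable locality relation into three variables, one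
index being a parameter. In later use the third index belongs to the operator being commuted past
the Jacobi expression. -/
theorem shiftSub_pow_slice_right {N : ℕ} {D : ℤ → ℤ → ℤ → M}
    (h : ∀ m, (shiftSub M ((1, 0) : ℤ × ℤ) (0, 1) ^ N) (fun x => D m x.1 x.2) = 0) :
    (shiftSub M (0, 1, 0) (0, 0, 1) ^ N) (fun x : ℤ × ℤ × ℤ => D x.1 x.2.1 x.2.2) = 0 := by
  funext x
  have h1 := shiftSub_pow_pullback (M := M) (fun y : ℤ × ℤ => ((x.1, y) : ℤ × ℤ × ℤ))
    (e := (1, 0)) (f := (0, 1)) (e' := (0, 1, 0)) (f' := (0, 0, 1)) (by simp) (by simp) N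
    (fun x => D x.1 x.2.1 x.2.2)
  exact (congrFun h1 x.2).symm.trans (congrFun (h x.1) x.2)

theorem shiftSub_pow_slice_left {N : ℕ} {D : ℤ → ℤ → ℤ → M}
    (h : ∀ n, (shiftSub M ((1, 0) : ℤ × ℤ) (0, 1) ^ N) (fun x => D n x.1 x.2) = 0) :
    (shiftSub M (1, 0, 0) (0, 0, 1) ^ N) (fun x : ℤ × ℤ × ℤ => D x.2.1 x.1 x.2.2) = 0 := by
  funext x
  have h1 := shiftSub_pow_pullback (M := M) (fun y : ℤ × ℤ => ((y.1, x.2.1, y.2) : ℤ × ℤ × ℤ))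
    (e := (1, 0)) (f := (0, 1)) (e' := (1, 0, 0)) (f' := (0, 0, 1)) (by simp) (by simp) N
    (fun x => D x.2.1 x.1 x.2.2)
  exact (congrFun h1 (x.1, x.2.2)).symm.trans (congrFun (h x.2.1) (x.1, x.2.2))

/-- If one summand is killed by `(x₁ - x₃)^N` and the other by `(x₂ - x₃)^N`, the sum is killed
by the product. -/
theorem shiftSub_pow_mul_add {N : ℕ} {φ ψ : ℤ × ℤ × ℤ → M}
    (hφ : (shiftSub M (1, 0, 0) (0, 0, 1) ^ N) φ = 0)
    (hψ : (shiftSub M (0, 1, 0) (0, 0, 1) ^ N) ψ = 0) :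
    (shiftSub M (1, 0, 0) (0, 0, 1) ^ N) ((shiftSub M (0, 1, 0) (0, 0, 1) ^ N) (φ + ψ)) = 0 := by
  have hc : Commute (shiftSub M ((1, 0, 0) : ℤ × ℤ × ℤ) (0, 0, 1) ^ N)
      (shiftSub M ((0, 1, 0) : ℤ × ℤ × ℤ) (0, 0, 1) ^ N) := (commute_shiftSub _ _ _ _).pow_pow N N
  rw [map_add, hψ, add_zero, ← Module.End.mul_apply, hc.eq, Module.End.mul_apply, hφ, map_zero]

/-- The array of Jacobi coefficients built from arrays `P`, `Q` and a sequence of arrays `R`. -/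
def jacobiArray (l : ℤ) (P Q : ℤ × ℤ × ℤ → M) (R : ℕ → ℤ → ℤ → M) : ℤ × ℤ × ℤ → M := fun x =>
  jacobiCoeff l x.1 (fun i => P (x.1 + l - i, x.2.1 + i, x.2.2))
    (fun i => Q (x.1 + i, x.2.1 + l - i, x.2.2)) (fun i => R i (x.1 + x.2.1 - i) x.2.2)

/-- The first two terms of a Jacobi expression are diagonal sums in the first two indices, so
annihilation of `P` and `Q` by `(x₁ - z)^N (x₂ - z)^N` is inherited. The third has coefficients
depending on the first index, so there only the factor `(x₂ - z)^N` is used. -/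
theorem shiftSub_pow_jacobiArray {l : ℤ} {P Q : ℤ × ℤ × ℤ → M} {R : ℕ → ℤ → ℤ → M} {N I : ℕ}
    (hP : P ∈ truncated M (-1, 1, 0)) (hQ : Q ∈ truncated M (1, -1, 0))
    (hR : ∀ i ≥ I, R i = 0)
    (hP' : (shiftSub M (1, 0, 0) (0, 0, 1) ^ N) ((shiftSub M (0, 1, 0) (0, 0, 1) ^ N) P) = 0)
    (hQ' : (shiftSub M (1, 0, 0) (0, 0, 1) ^ N) ((shiftSub M (0, 1, 0) (0, 0, 1) ^ N) Q) = 0)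
    (hR' : ∀ i < I, (shiftSub M ((1, 0) : ℤ × ℤ) (0, 1) ^ N) (fun x => R i x.1 x.2) = 0) :
    (shiftSub M (1, 0, 0) (0, 0, 1) ^ N)
      ((shiftSub M (0, 1, 0) (0, 0, 1) ^ N) (jacobiArray l P Q R)) = 0 := by
  set δ := shiftSub M ((1, 0, 0) : ℤ × ℤ × ℤ) (0, 0, 1) ^ N * shiftSub M (0, 1, 0) (0, 0, 1) ^ N
    with hδ
  set δ' := shiftSub M ((0, 1, 0) : ℤ × ℤ × ℤ) (0, 0, 1) ^ N
  have hcomm : ∀ (c : ℕ → ℂ) (g e : ℤ × ℤ × ℤ) (S : ℤ × ℤ × ℤ → M), S ∈ truncated M g → δ S = 0 →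
      δ (fun x => dirSum c g S (x + e)) = 0 := by
    intro c g e S hS h0
    have h1 : δ (dirSum c g S) = 0 := by
      rw [hδ, Module.End.mul_apply, shiftSub_pow_dirSum c hS,
        shiftSub_pow_dirSum c (shiftSub_pow_mem_truncated hS _ _ N), ← Module.End.mul_apply, ← hδ,
        h0]
      funext x
      simp [dirSum]
    have h2 : ∀ (a b : ℤ × ℤ × ℤ) (S : ℤ × ℤ × ℤ → M), (shiftSub M a b ^ N) (fun x => S (x + e))
        = fun x => (shiftSub M a b ^ N) S (x + e) := fun a b S =>
      shiftSub_pow_pullback (· + e) (fun x => add_right_comm x a e)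
        (fun x => add_right_comm x b e) N S
    rw [hδ, Module.End.mul_apply, h2, h2, ← Module.End.mul_apply, ← hδ, h1]
    rfl
  -- With the first index frozen, the binomials are constants and each `R i` is merely translated,
  -- so moving the second index against the third is its own locality relation.
  have hRR : δ' (fun x => ∑ᶠ i : ℕ, ((Ring.choose x.1 i : ℤ) : ℂ) •
      R i (x.1 + x.2.1 - i) x.2.2) = 0 := by
    funext x
    obtain ⟨m, n, k⟩ := x
    have h1 := shiftSub_pow_pullback (M := M) (fun y : ℤ × ℤ => ((m, y) : ℤ × ℤ × ℤ))
      (e := (1, 0)) (f := (0, 1)) (e' := (0, 1, 0)) (f' := (0, 0, 1)) (by simp) (by simp) N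
      (fun x => ∑ᶠ i : ℕ, ((Ring.choose x.1 i : ℤ) : ℂ) • R i (x.1 + x.2.1 - i) x.2.2)
    have h2 := congrFun h1 (n, k)
    simp only at h2
    rw [← h2]
    have h3 : (fun y : ℤ × ℤ => ∑ᶠ i : ℕ, ((Ring.choose m i : ℤ) : ℂ) • R i (m + y.1 - i) y.2)
        = ∑ i ∈ Finset.range I, ((Ring.choose m i : ℤ) : ℂ) •
          fun y : ℤ × ℤ => (fun z : ℤ × ℤ => R i z.1 z.2) (y + (m - i, 0)) := by
      funext y
      rw [finsum_eq_sum_range (N := I) fun i hi => by simp [hR i hi], Finset.sum_apply]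
      refine Finset.sum_congr rfl fun i _ => ?_
      simp only [Pi.smul_apply, Prod.fst_add, Prod.snd_add, add_zero]
      congr 2
      ring
    rw [h3, map_sum, Finset.sum_eq_zero, Pi.zero_apply, Pi.zero_apply]
    intro i hi
    rw [map_smul, shiftSub_pow_pullback (· + ((m - i, 0) : ℤ × ℤ))
      (fun x => add_right_comm x _ _) (fun x => add_right_comm x _ _) N
      (fun z : ℤ × ℤ => R i z.1 z.2), hR' i (by simpa using hi)]
    exact smul_zero _
  have hsum : jacobiArray l P Q R
      = (fun x => dirSum (fun i => (((-1) ^ i * Ring.choose l i : ℤ) : ℂ)) (-1, 1, 0) P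
          (x + (l, 0, 0)))
        - (fun x => dirSum (fun i => ((((l - i).negOnePow : ℤ) * Ring.choose l i : ℤ) : ℂ))
          (1, -1, 0) Q (x + (0, l, 0)))
        - fun x => ∑ᶠ i : ℕ, ((Ring.choose x.1 i : ℤ) : ℂ) • R i (x.1 + x.2.1 - i) x.2.2 := by
    funext x
    obtain ⟨m, n, k⟩ := x
    simp [jacobiArray, jacobiCoeff, dirSum, sub_eq_add_neg]
  change δ _ = 0
  rw [hsum, map_sub, map_sub, hcomm _ _ _ P hP hP', hcomm _ _ _ Q hQ hQ', hδ, Module.End.mul_apply,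
    hRR, map_zero, sub_zero, sub_zero]

end Locality

end

end VOA

/-! ### Locality of weak modules and transfer of the Jacobi identity. -/

namespace VOA

set_option linter.unusedSectionVars false

noncomputable section

variable {V : Type u} [AddCommGroup V] [Module ℂ V] {A : VertexOperatorAlgebra V}

theorem VertexOperatorAlgebra.eventuallyZero (A : VertexOperatorAlgebra V) (a b : V) (n : ℤ) :
    EventuallyZero fun i : ℕ => A.Y a (n + i) b := by
  obtain ⟨N, hN⟩ := A.truncation a b
  exact ⟨(N - n).toNat, fun i hi => hN _ (by omega)⟩

namespace WeakModule

variable {M : Type u} [AddCommGroup M] [Module ℂ M] (X : WeakModule A M)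

theorem eventuallyZero (a : V) (w : M) (n : ℤ) : EventuallyZero fun i : ℕ => X.Y a (n + i) w := by
  obtain ⟨N, hN⟩ := X.truncation a w
  exact ⟨(N - n).toNat, fun i hi => hN _ (by omega)⟩

theorem eventuallyZero_nat (a : V) (w : M) : EventuallyZero fun i : ℕ => X.Y a i w := by
  simpa using X.eventuallyZero a w 0

/-- The commutator formula. -/
theorem commutator (a b : V) (w : M) (m n : ℤ) :
    X.Y a m (X.Y b n w) = X.Y b n (X.Y a m w)
      + ∑ᶠ i : ℕ, ((Ring.choose m i : ℤ) : ℂ) • X.Y (A.Y a i b) (m + n - i) w := by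
  have h := X.jacobi a b w 0 m n
  rw [jacobiCoeff_zero] at h
  simp only [Nat.cast_zero, add_zero, sub_zero, zero_add] at h
  rw [← sub_eq_zero, ← h]
  abel

/-- Locality: the commutator of two vertex operators is killed by a power of `x₁ - x₂`. -/
theorem locality (a b : V) : ∃ N : ℕ, ∀ w : M, (shiftSub M ((1, 0) : ℤ × ℤ) (0, 1) ^ N)
    (fun x => X.Y a x.1 (X.Y b x.2 w) - X.Y b x.2 (X.Y a x.1 w)) = 0 := by
  obtain ⟨N, hN⟩ := A.eventuallyZero a b 0
  refine ⟨N, fun w => ?_⟩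
  convert shiftSub_pow_sum_choose N fun i n => X.Y (A.Y a i b) n w using 2
  funext x
  rw [X.commutator, add_sub_cancel_left, finsum_eq_sum_range fun i hi => ?_]
  have := hN i hi
  simp only [zero_add] at this
  rw [this]
  simp

end WeakModule

/-- Transfer of the Jacobi identity along an operator `g(z) = ∑ g_k z^(-k-1)` that is
truncated and local with respect to all vertex operators: it holds on all `g_k v`. -/
theorem jacobi_transfer {W M : Type u} [AddCommGroup W] [Module ℂ W] [AddCommGroup M] [Module ℂ M]
    (X : WeakModule A W) (Y : V →ₗ[ℂ] (ℤ → Module.End ℂ M)) (g : ℤ → W →ₗ[ℂ] M)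
    (htrunc : ∀ (a : V) (w : M) (n : ℤ), EventuallyZero fun i : ℕ => Y a (n + i) w)
    (hg : ∀ (v : W) (n : ℤ), EventuallyZero fun i : ℕ => g (n + i) v)
    (hloc : ∀ a : V, ∃ N : ℕ, ∀ v : W, (shiftSub M ((1, 0) : ℤ × ℤ) (0, 1) ^ N)
      (fun x => Y a x.1 (g x.2 v) - g x.2 (X.Y a x.1 v)) = 0)
    (a b : V) (v : W) (l m n k : ℤ) :
    jacobiCoeff l m (fun i => Y a (m + l - i) (Y b (n + i) (g k v)))
      (fun i => Y b (n + l - i) (Y a (m + i) (g k v)))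
      (fun i => Y (A.Y a (l + i) b) (m + n - i) (g k v)) = 0 := by
  obtain ⟨I, hI⟩ := A.eventuallyZero a b l
  obtain ⟨Na, hNa⟩ := hloc a
  obtain ⟨Nb, hNb⟩ := hloc b
  choose Nr hNr using fun i : ℕ => hloc (A.Y a (l + i) b)
  -- One exponent serves `a`, `b` and the finitely many nonzero products `a_{l+i} b`.
  set N := max (max Na Nb) ((Finset.range I).sup Nr) with hN
  have hNa' := fun v => shiftSub_pow_eq_zero_mono
    ((le_max_left Na Nb).trans (le_max_left _ _) : Na ≤ N) (hNa v)
  have hNb' := fun v => shiftSub_pow_eq_zero_mono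
    ((le_max_right Na Nb).trans (le_max_left _ _) : Nb ≤ N) (hNb v)
  have hNr' := fun i (hi : i < I) v => shiftSub_pow_eq_zero_mono
    ((Finset.le_sup (f := Nr) (Finset.mem_range.2 hi)).trans (le_max_right _ _) : Nr i ≤ N)
      (hNr i v)
  set P : ℤ × ℤ × ℤ → M := fun x =>
    Y a x.1 (Y b x.2.1 (g x.2.2 v)) - g x.2.2 (X.Y a x.1 (X.Y b x.2.1 v)) with hP
  set Q : ℤ × ℤ × ℤ → M := fun x =>
    Y b x.2.1 (Y a x.1 (g x.2.2 v)) - g x.2.2 (X.Y b x.2.1 (X.Y a x.1 v)) with hQ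
  set R : ℕ → ℤ → ℤ → M := fun i n k =>
    Y (A.Y a (l + i) b) n (g k v) - g k (X.Y (A.Y a (l + i) b) n v) with hR
  -- The arrays are commutators with `g`. As the Jacobi identity holds on `v`, subtracting `g`
  -- applied to it costs nothing, and `φ` is also the Jacobi defect at `g_k v`.
  set φ := jacobiArray l P Q R with hφ
  have hr0 : ∀ i ≥ I, ∀ n w, Y (A.Y a (l + i) b) n w = 0 := fun i hi n w => by
    have := hI i hi
    simp only at this
    rw [this]; simp
  have hr0' : ∀ i ≥ I, ∀ n w, X.Y (A.Y a (l + i) b) n w = 0 := fun i hi n w => by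
    have := hI i hi
    simp only at this
    rw [this]; simp
  have hφ' : φ = fun x => jacobiCoeff l x.1
      (fun i => Y a (x.1 + l - i) (Y b (x.2.1 + i) (g x.2.2 v)))
      (fun i => Y b (x.2.1 + l - i) (Y a (x.1 + i) (g x.2.2 v)))
      (fun i => Y (A.Y a (l + i) b) (x.1 + x.2.1 - i) (g x.2.2 v)) := by
    funext x
    obtain ⟨m, n, k⟩ := x
    have e1 : EventuallyZero fun i : ℕ => X.Y a (m + l - i) (X.Y b (n + i) v) := by
      obtain ⟨K, hK⟩ := X.eventuallyZero b v n
      exact ⟨K, fun i hi => by simp only [hK i hi, map_zero]⟩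
    have e2 : EventuallyZero fun i : ℕ => X.Y b (n + l - i) (X.Y a (m + i) v) := by
      obtain ⟨K, hK⟩ := X.eventuallyZero a v m
      exact ⟨K, fun i hi => by simp only [hK i hi, map_zero]⟩
    have e3 : EventuallyZero fun i : ℕ => X.Y (A.Y a (l + i) b) (m + n - i) v :=
      ⟨I, fun i hi => hr0' i hi _ _⟩
    have f1 : EventuallyZero fun i : ℕ => Y a (m + l - i) (Y b (n + i) (g k v)) := by
      obtain ⟨K, hK⟩ := htrunc b (g k v) n
      exact ⟨K, fun i hi => by simp only [hK i hi, map_zero]⟩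
    have f2 : EventuallyZero fun i : ℕ => Y b (n + l - i) (Y a (m + i) (g k v)) := by
      obtain ⟨K, hK⟩ := htrunc a (g k v) m
      exact ⟨K, fun i hi => by simp only [hK i hi, map_zero]⟩
    have f3 : EventuallyZero fun i : ℕ => Y (A.Y a (l + i) b) (m + n - i) (g k v) :=
      ⟨I, fun i hi => hr0 i hi _ _⟩
    have h := jacobiCoeff_sub (l := l) (m := m) f1 f2 f3 (e1.map (g k)) (e2.map (g k))
      (e3.map (g k))
    rw [← map_jacobiCoeff (g k) e1 e2 e3, X.jacobi, map_zero, sub_zero] at h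
    exact h
  -- The commutator of `g` with `a b` is `[a, g] b + a [b, g]`: the first summand is killed by `(x₁
  -- - z)^N` and the second by `(x₂ - z)^N`. The product in the other order is treated alike.
  have hkill : (shiftSub M (1, 0, 0) (0, 0, 1) ^ N)
      ((shiftSub M (0, 1, 0) (0, 0, 1) ^ N) φ) = 0 := by
    refine shiftSub_pow_jacobiArray (I := I) ?_ ?_ ?_ ?_ ?_ ?_
    · intro x
      obtain ⟨K, hK⟩ := htrunc b (g x.2.2 v) x.2.1
      obtain ⟨K', hK'⟩ := X.eventuallyZero b v x.2.1
      refine ⟨max K K', fun i hi => ?_⟩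
      have h1 := hK i (le_of_max_le_left hi)
      have h2 := hK' i (le_of_max_le_right hi)
      simp [hP, h1, h2]
    · intro x
      obtain ⟨K, hK⟩ := htrunc a (g x.2.2 v) x.1
      obtain ⟨K', hK'⟩ := X.eventuallyZero a v x.1
      refine ⟨max K K', fun i hi => ?_⟩
      have h1 := hK i (le_of_max_le_left hi)
      have h2 := hK' i (le_of_max_le_right hi)
      simp [hQ, h1, h2]
    · intro i hi
      funext n k
      simp [hR, hr0 i hi, hr0' i hi]
    · have h1 := shiftSub_pow_slice_left (N := N) (D := fun n m k =>
        Y a m (g k (X.Y b n v)) - g k (X.Y a m (X.Y b n v))) fun n => hNa' (X.Y b n v)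
      have h2 := shiftSub_pow_slice_right (N := N) (D := fun m n k =>
        Y a m (Y b n (g k v) - g k (X.Y b n v))) fun m => by
          rw [shiftSub_pow_comp (Y a m), hNb' v]; simp; rfl
      convert shiftSub_pow_mul_add h1 h2 using 3
      funext x
      simp [hP]
    · have h1 := shiftSub_pow_slice_left (N := N) (D := fun n m k =>
        Y b n (Y a m (g k v) - g k (X.Y a m v))) fun n => by
          rw [shiftSub_pow_comp (Y b n), hNa' v]; simp; rfl
      have h2 := shiftSub_pow_slice_right (N := N) (D := fun m n k =>
        Y b n (g k (X.Y a m v)) - g k (X.Y b n (X.Y a m v))) fun m => hNb' (X.Y a m v)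
      convert shiftSub_pow_mul_add h1 h2 using 3
      funext x
      simp [hQ]
    · exact fun i hi => hNr' i hi v
  -- In its form as a Jacobi defect at `g_k v`, the array vanishes as soon as `g_k v = 0`, whatever
  -- the other indices are. This is the truncation needed to cancel both factors.
  have htr : ∀ e : ℤ × ℤ × ℤ, e.2.2 = 1 → φ ∈ truncated M e := by
    intro e he x
    obtain ⟨K, hK⟩ := hg v x.2.2
    refine ⟨K, fun i hi => ?_⟩
    rw [hφ']
    have h : g (x + i • e).2.2 v = 0 := by
      have := hK i hi
      simpa [he] using this
    exact jacobiCoeff_eq_zero (fun i => by simp only [h, map_zero])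
      (fun i => by simp only [h, map_zero]) fun i => by simp only [h, map_zero]
  have h1 : φ = 0 := eq_zero_of_shiftSub_pow (htr _ rfl)
    (eq_zero_of_shiftSub_pow (shiftSub_pow_mem_truncated (htr _ rfl) _ _ _) hkill)
  have h2 := congrFun h1 (m, n, k)
  rw [hφ'] at h2
  exact h2

/-! ### Linear maps out of F₀. -/

section Construction

variable {W₁ W₂ : Type u} [AddCommGroup W₁] [Module ℂ W₁] [AddCommGroup W₂] [Module ℂ W₂]
  (X₁ : WeakModule A W₁) (X₂ : WeakModule A W₂)

variable (W₁ W₂) in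
/-- The trilinear map underlying `gen`, for a fixed power of `t`. -/
def genMap (n : ℤ) : W₁ →ₗ[ℂ] W₂ →ₗ[ℂ] F0 W₁ W₂ :=
  (TensorProduct.mk ℂ W₁ W₂).compr₂
    (TensorProduct.mk ℂ ℂ[T;T⁻¹] (W₁ ⊗[ℂ] W₂) (LaurentPolynomial.T n))

theorem F0_hom_ext {M : Type*} [AddCommGroup M] [Module ℂ M] {f g : F0 W₁ W₂ →ₗ[ℂ] M}
    (h : ∀ n u v, f (gen n u v) = g (gen n u v)) : f = g := by
  refine TensorProduct.ext (LinearMap.ext fun p => ?_)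
  induction p using LaurentPolynomial.induction_on' with
  | add p q hp hq => rw [map_add, map_add, hp, hq]
  | C_mul_T n c =>
    rw [← LaurentPolynomial.smul_eq_C_mul, map_smul, map_smul]
    congr 1
    exact TensorProduct.ext' fun u v => h n u v

theorem F0_span (N : Submodule ℂ (F0 W₁ W₂)) (h : ∀ n u v, gen n u v ∈ N) : N = ⊤ := by
  have : N.mkQ = 0 := F0_hom_ext fun n u v => by simpa using h n u v
  rw [← Submodule.ker_mkQ N, this, LinearMap.ker_zero]

/-- Linear maps from `F₀` are given by their values on the `tⁿ ⊗ u ⊗ v`. -/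
theorem exists_F0_lift {M : Type*} [AddCommGroup M] [Module ℂ M] (B : ℤ → W₁ →ₗ[ℂ] W₂ →ₗ[ℂ] M) :
    ∃ f : F0 W₁ W₂ →ₗ[ℂ] M, ∀ n u v, f (gen n u v) = B n u v := by
  refine ⟨TensorProduct.lift ((Finsupp.lsum ℂ fun n : ℤ =>
    LinearMap.toSpanSingleton ℂ _ (TensorProduct.lift (B n))) ∘ₗ
      (AddMonoidAlgebra.coeffLinearEquiv ℂ).toLinearMap), fun n u v => ?_⟩
  rw [gen, TensorProduct.lift.tmul, LinearMap.comp_apply, LaurentPolynomial.T]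
  have h : (AddMonoidAlgebra.coeffLinearEquiv ℂ).toLinearMap
      (AddMonoidAlgebra.single n 1 : ℂ[T;T⁻¹]) = Finsupp.single n 1 := rfl
  rw [h, Finsupp.lsum_single]
  simp

end Construction

end

end VOA

/-! ### The action of V on F₀. -/

namespace VOA

set_option linter.unusedSectionVars false

noncomputable section

variable {V : Type u} [AddCommGroup V] [Module ℂ V] {A : VertexOperatorAlgebra V}
  {W₁ W₂ : Type u} [AddCommGroup W₁] [Module ℂ W₁] [AddCommGroup W₂] [Module ℂ W₂]
  (X₁ : WeakModule A W₁) (X₂ : WeakModule A W₂)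

section Action

theorem gen_zero_left (n : ℤ) (v : W₂) : gen n (0 : W₁) v = 0 := by simp [gen]

theorem gen_zero_right (n : ℤ) (u : W₁) : gen n u (0 : W₂) = 0 := by simp [gen]

theorem gen_add_left (n : ℤ) (u u' : W₁) (v : W₂) : gen n (u + u') v = gen n u v + gen n u' v := by
  simp [gen, TensorProduct.add_tmul, TensorProduct.tmul_add]

theorem gen_add_right (n : ℤ) (u : W₁) (v v' : W₂) :
    gen n u (v + v') = gen n u v + gen n u v' := by
  simp [gen, TensorProduct.tmul_add]

theorem gen_smul_left (n : ℤ) (c : ℂ) (u : W₁) (v : W₂) : gen n (c • u) v = c • gen n u v := by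
  rw [gen, ← TensorProduct.smul_tmul', TensorProduct.tmul_smul, gen]

theorem gen_smul_right (n : ℤ) (c : ℂ) (u : W₁) (v : W₂) : gen n u (c • v) = c • gen n u v := by
  rw [gen, TensorProduct.tmul_smul, TensorProduct.tmul_smul, gen]

theorem eventuallyZero_gen (a : V) (m n : ℤ) (u : W₁) (v : W₂) (c : ℕ → ℂ) :
    EventuallyZero fun i : ℕ => c i • gen (m + n - i) (X₁.Y a i u) v := by
  obtain ⟨N, hN⟩ := X₁.eventuallyZero_nat a u
  exact ⟨N, fun i hi => by simp only [hN i hi, gen, TensorProduct.zero_tmul,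
    TensorProduct.tmul_zero, smul_zero]⟩

theorem act0_gen (a : V) (m n : ℤ) (u : W₁) (v : W₂) :
    act0 X₁ X₂ a m (gen n u v) = gen n u (X₂.Y a m v)
      + ∑ᶠ i : ℕ, ((Ring.choose m i : ℤ) : ℂ) • gen (m + n - i) (X₁.Y a i u) v := by
  have h1 : loopAct X₁ a m (LaurentPolynomial.T n ⊗ₜ[ℂ] u) = ∑ᶠ i : ℕ,
      ((Ring.choose m i : ℤ) : ℂ) • ((LaurentPolynomial.T (m + n - i) : ℂ[T;T⁻¹]) ⊗ₜ[ℂ]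
        X₁.Y a i u) := by
    simp only [loopAct, TensorProduct.lift.tmul, LinearMap.mk₂_apply, ← LaurentPolynomial.T_add]
    refine finsum_congr fun i => ?_
    rw [show m - (i : ℤ) + n = m + n - i by ring]
  have h2 : EventuallyZero fun i : ℕ => ((Ring.choose m i : ℤ) : ℂ) •
      ((LaurentPolynomial.T (m + n - i) : ℂ[T;T⁻¹]) ⊗ₜ[ℂ] X₁.Y a i u) := by
    obtain ⟨N, hN⟩ := X₁.eventuallyZero_nat a u
    exact ⟨N, fun i hi => by simp only [hN i hi, TensorProduct.tmul_zero, smul_zero]⟩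
  have h3 := map_finsum_of_eventuallyZero ((TensorProduct.assoc ℂ ℂ[T;T⁻¹] W₁ W₂).toLinearMap ∘ₗ
    (TensorProduct.mk ℂ (ℂ[T;T⁻¹] ⊗[ℂ] W₁) W₂).flip v) h2
  rw [act0, LinearMap.add_apply, gen, LinearMap.lTensor_tmul, LinearMap.lTensor_tmul,
    LinearEquiv.conj_apply_apply, TensorProduct.assoc_symm_tmul, LinearMap.rTensor_tmul, h1]
  congr 1

/-- The action of `V` on `F₀`, as a linear map. -/
def Y0 : V →ₗ[ℂ] (ℤ → Module.End ℂ (F0 W₁ W₂)) where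
  toFun a m := act0 X₁ X₂ a m
  map_add' a b := by
    funext m
    refine F0_hom_ext fun n u v => ?_
    simp only [Pi.add_apply, LinearMap.add_apply, act0_gen, map_add, gen_add_left, gen_add_right,
      smul_add]
    rw [finsum_add_distrib (eventuallyZero_gen X₁ a m n u v _).finite
      (eventuallyZero_gen X₁ b m n u v _).finite]
    abel
  map_smul' c a := by
    funext m
    refine F0_hom_ext fun n u v => ?_
    simp only [Pi.smul_apply, LinearMap.smul_apply, act0_gen, map_smul, gen_smul_left,
      gen_smul_right, smul_add, RingHom.id_apply]
    rw [smul_finsum' c (eventuallyZero_gen X₁ a m n u v _).finite]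
    simp only [smul_comm c]

theorem act0_vacuum (m : ℤ) (x : F0 W₁ W₂) :
    act0 X₁ X₂ A.vacuum m x = if m = -1 then x else 0 := by
  suffices act0 X₁ X₂ A.vacuum m = if m = -1 then LinearMap.id else 0 by
    rw [this]; split_ifs <;> rfl
  refine F0_hom_ext fun n u v => ?_
  rw [act0_gen, X₂.vacuum_act, finsum_eq_zero_of_forall_eq_zero, add_zero]
  · split_ifs <;> simp [gen]
  · intro i
    rw [X₁.vacuum_act, if_neg (by omega)]
    simp [gen]

/-- The absorption identity; it matches the factor from `(L(-1)a)_{i+1} = -(i+1) a_i` with the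
factor `-m` in the derivative property on F₀. -/
theorem succ_mul_choose (m : ℤ) (i : ℕ) :
    ((i : ℤ) + 1) * Ring.choose m (i + 1) = m * Ring.choose (m - 1) i := by
  have h := Ring.choose_smul_choose m (Nat.succ_le_succ (Nat.zero_le i) : 1 ≤ i + 1)
  simp only [Nat.choose_one_right, Ring.choose_one_right, nsmul_eq_mul,
    Nat.cast_one] at h
  exact_mod_cast h

theorem act0_derivative (a : V) (m : ℤ) :
    act0 X₁ X₂ (A.Y A.conformal 0 a) m = (-m : ℂ) • act0 X₁ X₂ a (m - 1) := by
  refine F0_hom_ext fun n u v => ?_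
  obtain ⟨N, hN⟩ := X₁.eventuallyZero_nat a u
  rw [LinearMap.smul_apply, act0_gen, act0_gen, X₂.derivative, smul_add, LinearMap.smul_apply,
    gen_smul_right]
  congr 1
  have h0 : ∀ i ≥ N, ∀ k : ℤ, gen k (X₁.Y a i u) v = 0 := fun i hi k => by
    have := hN i hi
    simp only at this
    rw [this]
    simp [gen]
  -- The bound moves by one because `(L(-1)a)_i` is a multiple of `a_{i-1}`; the extra term `i = 0`
  -- vanishes since its factor is 0.
  have h1 : ∀ i ≥ N + 1, ((Ring.choose m i : ℤ) : ℂ) •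
      gen (m + n - i) (X₁.Y (A.Y A.conformal 0 a) i u) v = 0 := fun i hi => by
    obtain ⟨j, rfl⟩ : ∃ j, i = j + 1 := ⟨i - 1, by omega⟩
    rw [X₁.derivative, show ((j + 1 : ℕ) : ℤ) - 1 = j by push_cast; ring, LinearMap.smul_apply,
      gen_smul_left, h0 j (by omega), smul_zero, smul_zero]
  rw [finsum_eq_sum_range h1, finsum_eq_sum_range (N := N) fun i hi => by rw [h0 i hi, smul_zero],
    Finset.sum_range_succ', X₁.derivative]
  simp only [Nat.cast_zero, Int.cast_zero, neg_zero, zero_smul, LinearMap.zero_apply,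
    gen_zero_left, smul_zero, add_zero]
  rw [Finset.smul_sum]
  refine Finset.sum_congr rfl fun i _ => ?_
  rw [X₁.derivative, LinearMap.smul_apply, gen_smul_left, smul_smul, smul_smul,
    show ((i + 1 : ℕ) : ℤ) - 1 = i by push_cast; ring,
    show m + n - ((i + 1 : ℕ) : ℤ) = m - 1 + n - i by push_cast; ring]
  congr 1
  have h : (((i : ℂ)) + 1) * (Ring.choose m (i + 1) : ℤ) = m * (Ring.choose (m - 1) i : ℤ) := by
    exact_mod_cast succ_mul_choose m i
  push_cast
  linear_combination -h

end Action

/-! ### F₁ as a weak module. -/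

section F1

variable {X₁ X₂}

theorem gen_mem_J0 {m n : ℕ} {u : W₁} {v : W₂} (hu : u ∈ X₁.deg m) (hv : v ∈ X₂.deg n) {k : ℤ}
    (hk : (m : ℤ) + n ≤ k) : gen k u v ∈ J0 X₁ X₂ := by
  rw [J0, Submodule.mem_sInf]
  intro N hN
  obtain ⟨i, hi⟩ := Int.eq_ofNat_of_zero_le (sub_nonneg.2 hk)
  have := hN.2 m n i u hu v hv
  rwa [← hi, add_sub_cancel] at this

theorem mkQ_gen (n : ℤ) (u : W₁) (v : W₂) : (J0 X₁ X₂).mkQ (gen n u v) = gen1 X₁ X₂ n u v := rfl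

theorem act1_mkQ (a : V) (k : ℤ) (x : F0 W₁ W₂) :
    act1 X₁ X₂ a k ((J0 X₁ X₂).mkQ x) = (J0 X₁ X₂).mkQ (act0 X₁ X₂ a k x) := rfl

variable (X₁ X₂) in
/-- The bilinear map `(u, v) ↦ π₁(tⁿ ⊗ u ⊗ v)`. -/
def genMap1 (n : ℤ) : W₁ →ₗ[ℂ] W₂ →ₗ[ℂ] F1 X₁ X₂ := (genMap W₁ W₂ n).compr₂ (J0 X₁ X₂).mkQ

theorem genMap1_apply (n : ℤ) (u : W₁) (v : W₂) : genMap1 X₁ X₂ n u v = gen1 X₁ X₂ n u v := rfl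

variable (h₁ : ⨆ n, X₁.deg n = ⊤) (h₂ : ⨆ n, X₂.deg n = ⊤)

include h₁ h₂ in
theorem gen1_eventually (u : W₁) (v : W₂) : ∃ N : ℤ, ∀ n ≥ N, gen1 X₁ X₂ n u v = 0 := by
  have hu : u ∈ ⨆ n, X₁.deg n := h₁ ▸ Submodule.mem_top
  have hv : v ∈ ⨆ n, X₂.deg n := h₂ ▸ Submodule.mem_top
  simp only [← genMap1_apply]
  induction hu using Submodule.iSup_induction' with
  | zero => exact ⟨0, fun n _ => by simp⟩
  | add u u' _ _ ih ih' =>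
    obtain ⟨N, hN⟩ := ih
    obtain ⟨K, hK⟩ := ih'
    exact ⟨max N K, fun n hn => by
      rw [map_add, LinearMap.add_apply, hN n (le_of_max_le_left hn),
        hK n (le_of_max_le_right hn), add_zero]⟩
  | mem m u hu =>
    induction hv using Submodule.iSup_induction' with
    | zero => exact ⟨0, fun n _ => by simp⟩
    | add v v' _ _ ih ih' =>
      obtain ⟨N, hN⟩ := ih
      obtain ⟨K, hK⟩ := ih'
      exact ⟨max N K, fun n hn => by
        rw [map_add, hN n (le_of_max_le_left hn), hK n (le_of_max_le_right hn), add_zero]⟩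
    | mem n v hv =>
      exact ⟨m + n, fun k hk => (Submodule.Quotient.mk_eq_zero _).2 (gen_mem_J0 hu hv hk)⟩

include h₁ h₂ in
theorem eventuallyZero_gen1 (u : W₁) (v : W₂) (n : ℤ) :
    EventuallyZero fun i : ℕ => gen1 X₁ X₂ (n + i) u v := by
  obtain ⟨N, hN⟩ := gen1_eventually h₁ h₂ u v
  exact ⟨(N - n).toNat, fun i hi => hN _ (by omega)⟩

theorem act1_gen1 (a : V) (m n : ℤ) (u : W₁) (v : W₂) {N : ℕ} (hN : ∀ i ≥ N, X₁.Y a i u = 0) :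
    act1 X₁ X₂ a m (gen1 X₁ X₂ n u v) = gen1 X₁ X₂ n u (X₂.Y a m v)
      + ∑ i ∈ Finset.range N,
        ((Ring.choose m i : ℤ) : ℂ) • gen1 X₁ X₂ (m + n - i) (X₁.Y a i u) v := by
  have h0 : ∀ i ≥ N, ((Ring.choose m i : ℤ) : ℂ) • gen (m + n - i) (X₁.Y a i u) v = 0 :=
    fun i hi => by rw [hN i hi]; simp [gen]
  rw [gen1, act1_mkQ, act0_gen, finsum_eq_sum_range h0, map_add, map_sum]
  simp only [map_smul]
  rfl

/-- Locality of the action of `V` on `F₁` with the generators. -/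
theorem locality_gen1 (a : V) (u : W₁) : ∃ N : ℕ, ∀ v : W₂,
    (shiftSub (F1 X₁ X₂) ((1, 0) : ℤ × ℤ) (0, 1) ^ N) (fun x =>
      act1 X₁ X₂ a x.1 (gen1 X₁ X₂ x.2 u v) - gen1 X₁ X₂ x.2 u (X₂.Y a x.1 v)) = 0 := by
  obtain ⟨N, hN⟩ := X₁.eventuallyZero_nat a u
  refine ⟨N, fun v => ?_⟩
  convert shiftSub_pow_sum_choose N fun i n => gen1 X₁ X₂ n (X₁.Y a i u) v using 2
  funext x
  rw [act1_gen1 a x.1 x.2 u v hN, add_sub_cancel_left]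

theorem F1_hom_ext {M : Type*} [AddCommGroup M] [Module ℂ M] {f g : F1 X₁ X₂ →ₗ[ℂ] M}
    (h : ∀ n u v, f (gen1 X₁ X₂ n u v) = g (gen1 X₁ X₂ n u v)) : f = g :=
  Submodule.linearMap_qext _ (F0_hom_ext h)

/-- A subspace of `F₁` that contains the generators is everything. -/
theorem F1_induction {p : F1 X₁ X₂ → Prop} (h0 : p 0) (hadd : ∀ x y, p x → p y → p (x + y))
    (hsmul : ∀ (c : ℂ) x, p x → p (c • x)) (hgen : ∀ n u v, p (gen1 X₁ X₂ n u v))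
    (x : F1 X₁ X₂) : p x := by
  let N : Submodule ℂ (F1 X₁ X₂) :=
    { carrier := {x | p x}, add_mem' := hadd _ _, zero_mem' := h0, smul_mem' := hsmul }
  have h : N.mkQ = 0 := F1_hom_ext fun n u v =>
    (Submodule.Quotient.mk_eq_zero N).2 (hgen n u v)
  have h' : x ∈ LinearMap.ker N.mkQ := by rw [h]; simp
  rwa [Submodule.ker_mkQ] at h'

variable (X₁ X₂) in
/-- The action of `V` on `F₁`, as a linear map. -/
def Y1 : V →ₗ[ℂ] (ℤ → Module.End ℂ (F1 X₁ X₂)) where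
  toFun a m := act1 X₁ X₂ a m
  map_add' a b := by
    funext m
    refine Submodule.linearMap_qext _ (LinearMap.ext fun x => ?_)
    have h := congrArg (J0 X₁ X₂).mkQ (LinearMap.congr_fun (congrFun (map_add (Y0 X₁ X₂) a b) m) x)
    exact h.trans (map_add (J0 X₁ X₂).mkQ _ _)
  map_smul' c a := by
    funext m
    refine Submodule.linearMap_qext _ (LinearMap.ext fun x => ?_)
    have h := congrArg (J0 X₁ X₂).mkQ
      (LinearMap.congr_fun (congrFun (map_smul (Y0 X₁ X₂) c a) m) x)
    exact h.trans (map_smul (J0 X₁ X₂).mkQ _ _)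

theorem Y1_apply (a : V) (m : ℤ) : Y1 X₁ X₂ a m = act1 X₁ X₂ a m := rfl

include h₁ h₂ in
-- On a generator only finitely many `a_i u` are nonzero, and each resulting `t^(m+n-i) ⊗ a_i u ⊗ v`
-- lies in J₀ for large m.
theorem act1_truncation (a : V) (x : F1 X₁ X₂) : ∃ N : ℤ, ∀ n ≥ N, act1 X₁ X₂ a n x = 0 := by
  induction x using F1_induction with
  | h0 => exact ⟨0, fun _ _ => map_zero _⟩
  | hadd x y hx hy =>
    obtain ⟨N, hN⟩ := hx
    obtain ⟨K, hK⟩ := hy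
    exact ⟨max N K, fun n hn => by
      rw [map_add, hN n (le_of_max_le_left hn), hK n (le_of_max_le_right hn), add_zero]⟩
  | hsmul c x hx =>
    obtain ⟨N, hN⟩ := hx
    exact ⟨N, fun n hn => by rw [map_smul, hN n hn, smul_zero]⟩
  | hgen n u v =>
    obtain ⟨N, hN⟩ := X₁.eventuallyZero_nat a u
    obtain ⟨K, hK⟩ := X₂.truncation a v
    choose L hL using fun i : ℕ => gen1_eventually h₁ h₂ (X₁.Y a i u) v
    obtain ⟨B, hB⟩ : ∃ B : ℤ, ∀ i ∈ Finset.range N, L i + i - n ≤ B :=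
      ⟨∑ i ∈ Finset.range N, |L i + i - n|, fun i hi => (le_abs_self _).trans
        (Finset.single_le_sum (f := fun i : ℕ => |L i + i - n|) (fun _ _ => abs_nonneg _) hi)⟩
    refine ⟨max K B, fun m hm => ?_⟩
    rw [act1_gen1 a m n u v hN, hK m (le_of_max_le_left hm), ← genMap1_apply, map_zero, zero_add]
    refine Finset.sum_eq_zero fun i hi => ?_
    rw [hL i _ (by have := hB i hi; have := le_of_max_le_right hm; omega), smul_zero]

/-- `F₁` is a weak module. -/
def F1Module : WeakModule A (F1 X₁ X₂) where
  Y := Y1 X₁ X₂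
  vacuum_act n w := by
    obtain ⟨x, rfl⟩ := Submodule.mkQ_surjective _ w
    rw [Y1_apply, act1_mkQ, act0_vacuum]
    split_ifs <;> simp
  derivative a n := by
    refine Submodule.linearMap_qext _ (LinearMap.ext fun x => ?_)
    have := LinearMap.congr_fun (act0_derivative X₁ X₂ a n) x
    have h := congrArg (J0 X₁ X₂).mkQ this
    rw [LinearMap.smul_apply, map_smul] at h
    exact h
  truncation := act1_truncation h₁ h₂
  jacobi a b w l m n := by
    have ez : ∀ (a : V) (x : F1 X₁ X₂) (n : ℤ), EventuallyZero fun i : ℕ =>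
        Y1 X₁ X₂ a (n + i) x := fun a x n => by
      obtain ⟨N, hN⟩ := act1_truncation h₁ h₂ a x
      exact ⟨(N - n).toNat, fun i hi => hN _ (by omega)⟩
    have e1 : ∀ x, EventuallyZero fun i : ℕ =>
        Y1 X₁ X₂ a (m + l - i) (Y1 X₁ X₂ b (n + i) x) := fun x => by
      obtain ⟨N, hN⟩ := ez b x n
      exact ⟨N, fun i hi => by simp only [hN i hi, map_zero]⟩
    have e2 : ∀ x, EventuallyZero fun i : ℕ =>
        Y1 X₁ X₂ b (n + l - i) (Y1 X₁ X₂ a (m + i) x) := fun x => by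
      obtain ⟨N, hN⟩ := ez a x m
      exact ⟨N, fun i hi => by simp only [hN i hi, map_zero]⟩
    have e3 : ∀ x, EventuallyZero fun i : ℕ =>
        Y1 X₁ X₂ (A.Y a (l + i) b) (m + n - i) x := fun x => by
      obtain ⟨N, hN⟩ := A.eventuallyZero a b l
      exact ⟨N, fun i hi => by simp only [hN i hi, map_zero, Pi.zero_apply, LinearMap.zero_apply]⟩
    induction w using F1_induction with
    | h0 => exact jacobiCoeff_eq_zero (by simp) (by simp) (by simp)
    | hadd x y hx hy =>
      simp only [map_add]
      rw [jacobiCoeff_add (e1 x) (e2 x) (e3 x) (e1 y) (e2 y) (e3 y), hx, hy, add_zero]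
    | hsmul c x hx =>
      simp only [map_smul]
      rw [jacobiCoeff_smul c (e1 x) (e2 x) (e3 x), hx, smul_zero]
    | hgen k u v =>
      -- The generator is the mode of index k of `Y_t(u, z)` applied to `v`; the identity is
      -- transferred from W₂ along this operator.
      exact jacobi_transfer X₂ (Y1 X₁ X₂) (fun k => genMap1 X₁ X₂ k u) ez
        (fun v n => eventuallyZero_gen1 h₁ h₂ u v n) (fun a => locality_gen1 a u) a b v l m n k

theorem F1Module_Y (a : V) (n : ℤ) : (F1Module h₁ h₂).Y a n = act1 X₁ X₂ a n := rfl

end F1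

end

end VOA

/-! ### Stability of J₁, and F₂ as a weak module. -/

namespace VOA

set_option linter.unusedSectionVars false

noncomputable section

variable {V : Type u} [AddCommGroup V] [Module ℂ V] {A : VertexOperatorAlgebra V}

namespace WeakModule

variable {M : Type u} [AddCommGroup M] [Module ℂ M] (X : WeakModule A M)

theorem eventuallyZero_left (a b : V) (w : M) (m n : ℤ) :
    EventuallyZero fun i : ℕ => X.Y a (m - i) (X.Y b (n + i) w) := by
  obtain ⟨N, hN⟩ := X.eventuallyZero b w n
  exact ⟨N, fun i hi => by simp only [hN i hi, map_zero]⟩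

theorem eventuallyZero_right (a b : V) (w : M) (l k : ℤ) :
    EventuallyZero fun i : ℕ => X.Y (A.Y a (l + i) b) (k - i) w := by
  obtain ⟨N, hN⟩ := A.eventuallyZero a b l
  exact ⟨N, fun i hi => by simp only [hN i hi, map_zero, Pi.zero_apply, LinearMap.zero_apply]⟩

/-- The quotient of a weak module by a submodule. -/
def quotient (N : Submodule ℂ M) (hN : X.IsSub N) : WeakModule A (M ⧸ N) where
  Y :=
    { toFun a n := N.mapQ N (X.Y a n) (hN a n)
      map_add' a b := by
        funext n
        refine Submodule.linearMap_qext _ (LinearMap.ext fun x => ?_)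
        simp
      map_smul' c a := by
        funext n
        refine Submodule.linearMap_qext _ (LinearMap.ext fun x => ?_)
        simp }
  vacuum_act n w := by
    obtain ⟨x, rfl⟩ := N.mkQ_surjective w
    change N.mkQ (X.Y A.vacuum n x) = _
    rw [X.vacuum_act]
    split_ifs <;> simp
  derivative a n := by
    refine Submodule.linearMap_qext _ (LinearMap.ext fun x => ?_)
    change N.mkQ (X.Y (A.Y A.conformal 0 a) n x) = _
    rw [X.derivative]
    rfl
  truncation a w := by
    obtain ⟨x, rfl⟩ := N.mkQ_surjective w
    obtain ⟨K, hK⟩ := X.truncation a x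
    exact ⟨K, fun n hn => by
      change N.mkQ (X.Y a n x) = 0
      rw [hK n hn, map_zero]⟩
  jacobi a b w l m n := by
    obtain ⟨x, rfl⟩ := N.mkQ_surjective w
    have h := map_jacobiCoeff (l := l) (m := m) N.mkQ (X.eventuallyZero_left a b x (m + l) n)
      (X.eventuallyZero_left b a x (n + l) m) (X.eventuallyZero_right a b x l (m + n))
    rw [X.jacobi, map_zero] at h
    exact h.symm

end WeakModule

variable {W₁ W₂ : Type u} [AddCommGroup W₁] [Module ℂ W₁] [AddCommGroup W₂] [Module ℂ W₂]
  {X₁ : WeakModule A W₁} {X₂ : WeakModule A W₂}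

theorem gen1_zero_left (n : ℤ) (v : W₂) : gen1 X₁ X₂ n 0 v = 0 := by
  rw [← genMap1_apply, map_zero, LinearMap.zero_apply]

theorem gen1_zero_right (n : ℤ) (u : W₁) : gen1 X₁ X₂ n u 0 = 0 := by
  rw [← genMap1_apply, map_zero]

variable (X₁ X₂) in
/-- The Jacobi expressions that span `J₁`. -/
def jacobiGen (a : V) (u : W₁) (v : W₂) (l m n : ℤ) : F1 X₁ X₂ :=
  jacobiCoeff l m (fun i => act1 X₁ X₂ a (m + l - i) (gen1 X₁ X₂ (n + i) u v))
      (fun i => gen1 X₁ X₂ (n + l - i) u (X₂.Y a (m + i) v))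
      (fun i => gen1 X₁ X₂ (m + n - i) (X₁.Y a (l + i) u) v)

theorem jacobiGen_mem (a : V) (u : W₁) (v : W₂) (l m n : ℤ) :
    jacobiGen X₁ X₂ a u v l m n ∈ J1 X₁ X₂ :=
  Submodule.subset_span ⟨a, u, v, l, m, n, rfl⟩

theorem eventuallyZero_jacobiGen_q (a : V) (u : W₁) (v : W₂) (m n : ℤ) :
    EventuallyZero fun i : ℕ => gen1 X₁ X₂ (n - i) u (X₂.Y a (m + i) v) := by
  obtain ⟨N, hN⟩ := X₂.eventuallyZero a v m
  exact ⟨N, fun i hi => by simp only [hN i hi, gen1_zero_right]⟩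

theorem eventuallyZero_jacobiGen_r (a : V) (u : W₁) (v : W₂) (l k : ℤ) :
    EventuallyZero fun i : ℕ => gen1 X₁ X₂ (k - i) (X₁.Y a (l + i) u) v := by
  obtain ⟨N, hN⟩ := X₁.eventuallyZero a u l
  exact ⟨N, fun i hi => by simp only [hN i hi, gen1_zero_left]⟩

theorem J1_induction {N : Submodule ℂ (F1 X₁ X₂)}
    (h : ∀ a u v l m n, jacobiGen X₁ X₂ a u v l m n ∈ N) : J1 X₁ X₂ ≤ N := by
  refine Submodule.span_le.2 ?_
  rintro x ⟨a, u, v, l, m, n, rfl⟩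
  exact h a u v l m n

variable (h₁ : ⨆ n, X₁.deg n = ⊤) (h₂ : ⨆ n, X₂.deg n = ⊤)

include h₁ h₂

theorem eventuallyZero_jacobiGen_p (a : V) (u : W₁) (v : W₂) (m n : ℤ) :
    EventuallyZero fun i : ℕ => act1 X₁ X₂ a (m - i) (gen1 X₁ X₂ (n + i) u v) := by
  obtain ⟨N, hN⟩ := eventuallyZero_gen1 h₁ h₂ u v n
  exact ⟨N, fun i hi => by simp only [hN i hi, map_zero]⟩

/-- Only finitely many summation indices can contribute for any m, and each of their terms vanishes
for large m. This and its analogue in n supply the truncations used to cancel locality factors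
modulo J₁. -/
theorem jacobiGen_eventually_left (a : V) (u : W₁) (v : W₂) (l m n : ℤ) :
    EventuallyZero fun j : ℕ => jacobiGen X₁ X₂ a u v l (m + j) n := by
  obtain ⟨I, hI⟩ := eventuallyZero_gen1 h₁ h₂ u v n
  obtain ⟨I', hI'⟩ := X₁.eventuallyZero a u l
  choose Np hNp using fun i : ℕ => (F1Module h₁ h₂).truncation a (gen1 X₁ X₂ (n + i) u v)
  choose Nr hNr using fun i : ℕ => gen1_eventually h₁ h₂ (X₁.Y a (l + i) u) v
  obtain ⟨Nq, hNq⟩ := X₂.truncation a v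
  obtain ⟨B, hB⟩ : ∃ B : ℕ, ∀ i < I, Np i - m - l + i ≤ B :=
    ⟨∑ i ∈ Finset.range I, (Np i - m - l + i).toNat, fun i hi => by
      have := Finset.single_le_sum (f := fun i : ℕ => (Np i - m - l + i).toNat)
        (fun _ _ => Nat.zero_le _) (Finset.mem_range.2 hi)
      omega⟩
  obtain ⟨B', hB'⟩ : ∃ B : ℕ, ∀ i < I', Nr i - m - n + i ≤ B :=
    ⟨∑ i ∈ Finset.range I', (Nr i - m - n + i).toNat, fun i hi => by
      have := Finset.single_le_sum (f := fun i : ℕ => (Nr i - m - n + i).toNat)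
        (fun _ _ => Nat.zero_le _) (Finset.mem_range.2 hi)
      omega⟩
  refine ⟨B + B' + (Nq - m).toNat, fun j hj => jacobiCoeff_eq_zero (fun i => ?_) (fun i => ?_)
    fun i => ?_⟩
  · by_cases hi : i < I
    · exact hNp i _ (by have := hB i hi; omega)
    · have := hI i (not_lt.1 hi)
      simp only at this
      rw [this, map_zero]
  · rw [hNq _ (by omega), gen1_zero_right]
  · by_cases hi : i < I'
    · exact hNr i _ (by have := hB' i hi; omega)
    · have := hI' i (not_lt.1 hi)
      simp only at this
      rw [this, gen1_zero_left]

theorem jacobiGen_eventually_right (a : V) (u : W₁) (v : W₂) (l m n : ℤ) :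
    EventuallyZero fun j : ℕ => jacobiGen X₁ X₂ a u v l m (n + j) := by
  obtain ⟨I, hI⟩ := X₂.eventuallyZero a v m
  obtain ⟨I', hI'⟩ := X₁.eventuallyZero a u l
  obtain ⟨Np, hNp⟩ := gen1_eventually h₁ h₂ u v
  choose Nq hNq using fun i : ℕ => gen1_eventually h₁ h₂ u (X₂.Y a (m + i) v)
  choose Nr hNr using fun i : ℕ => gen1_eventually h₁ h₂ (X₁.Y a (l + i) u) v
  obtain ⟨B, hB⟩ : ∃ B : ℕ, ∀ i < I, Nq i - n - l + i ≤ B :=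
    ⟨∑ i ∈ Finset.range I, (Nq i - n - l + i).toNat, fun i hi => by
      have := Finset.single_le_sum (f := fun i : ℕ => (Nq i - n - l + i).toNat)
        (fun _ _ => Nat.zero_le _) (Finset.mem_range.2 hi)
      omega⟩
  obtain ⟨B', hB'⟩ : ∃ B : ℕ, ∀ i < I', Nr i - m - n + i ≤ B :=
    ⟨∑ i ∈ Finset.range I', (Nr i - m - n + i).toNat, fun i hi => by
      have := Finset.single_le_sum (f := fun i : ℕ => (Nr i - m - n + i).toNat)
        (fun _ _ => Nat.zero_le _) (Finset.mem_range.2 hi)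
      omega⟩
  refine ⟨B + B' + (Np - n).toNat, fun j hj => jacobiCoeff_eq_zero (fun i => ?_) (fun i => ?_)
    fun i => ?_⟩
  · rw [hNp _ (by omega), map_zero]
  · by_cases hi : i < I
    · exact hNq i _ (by have := hB i hi; omega)
    · have := hI i (not_lt.1 hi)
      simp only at this
      rw [this, gen1_zero_right]
  · by_cases hi : i < I'
    · exact hNr i _ (by have := hB' i hi; omega)
    · have := hI' i (not_lt.1 hi)
      simp only at this
      rw [this, gen1_zero_left]

/-- `J₁` is a submodule of `F₁`. -/
theorem J1_isSub : (F1Module h₁ h₂).IsSub (J1 X₁ X₂) := by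
  intro b k
  refine J1_induction (N := (J1 X₁ X₂).comap ((F1Module h₁ h₂).Y b k)) fun a u v l m n => ?_
  rw [Submodule.mem_comap, F1Module_Y, ← Submodule.Quotient.mk_eq_zero]
  obtain ⟨I, hI⟩ := X₁.eventuallyZero a u l
  obtain ⟨N₁, hN₁⟩ := (F1Module h₁ h₂).locality a b
  obtain ⟨N₂, hN₂⟩ := X₂.locality a b
  obtain ⟨N₃, hN₃⟩ := locality_gen1 (X₁ := X₁) (X₂ := X₂) b u
  choose Nr hNr using fun i : ℕ => locality_gen1 (X₁ := X₁) (X₂ := X₂) b (X₁.Y a (l + i) u)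
  have hI0 : ∀ i ≥ I, X₁.Y a (l + i) u = 0 := hI
  set N := N₁ + N₂ + N₃ + (Finset.range I).sup Nr with hN
  have hN₁' := fun w => shiftSub_pow_eq_zero_mono (by omega : N₁ ≤ N) (hN₁ w)
  have hN₂' := fun w => shiftSub_pow_eq_zero_mono (by omega : N₂ ≤ N) (hN₂ w)
  -- Exchanging the two variables changes `(x₁ - x₂)^N` only by a sign. Locality of `b` with the
  -- generators has the index of `b` first, whereas here it must be last.
  have swap : ∀ f : ℤ → ℤ → F1 X₁ X₂,
      (shiftSub _ ((1, 0) : ℤ × ℤ) (0, 1) ^ N) (fun x => f x.1 x.2) = 0 →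
      (shiftSub _ ((1, 0) : ℤ × ℤ) (0, 1) ^ N) (fun x => f x.2 x.1) = 0 := fun f hf => by
    rw [shiftSub_pow_pullback (fun x : ℤ × ℤ => (x.2, x.1)) (e' := (0, 1)) (f' := (1, 0))
      (by simp) (by simp) N fun x => f x.1 x.2, show shiftSub (F1 X₁ X₂) ((0, 1) : ℤ × ℤ) (1, 0)
      = -shiftSub _ (1, 0) (0, 1) from (neg_sub _ _).symm,
      neg_pow (shiftSub (F1 X₁ X₂) ((1, 0) : ℤ × ℤ) (0, 1)), Module.End.mul_apply, hf, map_zero]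
    rfl
  have hN₃' := fun w => swap (fun p q =>
    act1 X₁ X₂ b p (gen1 X₁ X₂ q u w) - gen1 X₁ X₂ q u (X₂.Y b p w))
    (shiftSub_pow_eq_zero_mono (by omega : N₃ ≤ N) (hN₃ w))
  have hNr' := fun i (hi : i < I) v => swap (fun p q =>
    act1 X₁ X₂ b p (gen1 X₁ X₂ q (X₁.Y a (l + i) u) v)
      - gen1 X₁ X₂ q (X₁.Y a (l + i) u) (X₂.Y b p v)) (shiftSub_pow_eq_zero_mono
    ((Finset.le_sup (f := Nr) (Finset.mem_range.2 hi)).trans (by omega) : Nr i ≤ N) (hNr i v))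
  set P : ℤ × ℤ × ℤ → F1 X₁ X₂ := fun x =>
    act1 X₁ X₂ b x.2.2 (act1 X₁ X₂ a x.1 (gen1 X₁ X₂ x.2.1 u v))
      - act1 X₁ X₂ a x.1 (gen1 X₁ X₂ x.2.1 u (X₂.Y b x.2.2 v)) with hP
  set Q : ℤ × ℤ × ℤ → F1 X₁ X₂ := fun x =>
    act1 X₁ X₂ b x.2.2 (gen1 X₁ X₂ x.2.1 u (X₂.Y a x.1 v))
      - gen1 X₁ X₂ x.2.1 u (X₂.Y a x.1 (X₂.Y b x.2.2 v)) with hQ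
  set R : ℕ → ℤ → ℤ → F1 X₁ X₂ := fun i n k =>
    act1 X₁ X₂ b k (gen1 X₁ X₂ n (X₁.Y a (l + i) u) v)
      - gen1 X₁ X₂ n (X₁.Y a (l + i) u) (X₂.Y b k v) with hR
  set φ := jacobiArray l P Q R with hφ
  have hφ' : ∀ x, φ x = act1 X₁ X₂ b x.2.2 (jacobiGen X₁ X₂ a u v l x.1 x.2.1)
      - jacobiGen X₁ X₂ a u (X₂.Y b x.2.2 v) l x.1 x.2.1 := by
    intro x
    obtain ⟨m, n, k⟩ := x
    have e1 := eventuallyZero_jacobiGen_p h₁ h₂ a u v (m + l) n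
    have e2 := eventuallyZero_jacobiGen_q (X₁ := X₁) (X₂ := X₂) a u v m (n + l)
    have e3 := eventuallyZero_jacobiGen_r (X₁ := X₁) (X₂ := X₂) a u v l (m + n)
    have f1 := eventuallyZero_jacobiGen_p h₁ h₂ a u (X₂.Y b k v) (m + l) n
    have f2 := eventuallyZero_jacobiGen_q (X₁ := X₁) (X₂ := X₂) a u (X₂.Y b k v) m (n + l)
    have f3 := eventuallyZero_jacobiGen_r (X₁ := X₁) (X₂ := X₂) a u (X₂.Y b k v) l (m + n)
    have h := jacobiCoeff_sub (l := l) (m := m) (e1.map (act1 X₁ X₂ b k))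
      (e2.map (act1 X₁ X₂ b k)) (e3.map (act1 X₁ X₂ b k)) f1 f2 f3
    rw [← map_jacobiCoeff (act1 X₁ X₂ b k) e1 e2 e3] at h
    exact h
  -- As in the transfer argument, but `b` is the operator moved to the right: past `a` by locality
  -- in F₁ or in W₂, and past `Y_t(u, x₂)` by locality with the generators.
  have hkill : (shiftSub _ (1, 0, 0) (0, 0, 1) ^ N)
      ((shiftSub _ (0, 1, 0) (0, 0, 1) ^ N) φ) = 0 := by
    refine shiftSub_pow_jacobiArray (I := I) ?_ ?_ ?_ ?_ ?_ ?_
    · intro x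
      obtain ⟨K, hK⟩ := eventuallyZero_gen1 h₁ h₂ u v x.2.1
      obtain ⟨K', hK'⟩ := eventuallyZero_gen1 h₁ h₂ u (X₂.Y b x.2.2 v) x.2.1
      refine ⟨max K K', fun i hi => ?_⟩
      have h1 := hK i (le_of_max_le_left hi)
      have h2 := hK' i (le_of_max_le_right hi)
      simp [hP, h1, h2]
    · intro x
      obtain ⟨K, hK⟩ := X₂.eventuallyZero a v x.1
      obtain ⟨K', hK'⟩ := X₂.eventuallyZero a (X₂.Y b x.2.2 v) x.1
      refine ⟨max K K', fun i hi => ?_⟩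
      have h1 := hK i (le_of_max_le_left hi)
      have h2 := hK' i (le_of_max_le_right hi)
      simp [hQ, h1, h2, gen1_zero_right]
    · intro i hi
      funext n k
      simp [hR, hI0 i hi, gen1_zero_left]
    · have h1 := shiftSub_pow_slice_left (N := N) (D := fun n m k =>
        -(act1 X₁ X₂ a m (act1 X₁ X₂ b k (gen1 X₁ X₂ n u v))
          - act1 X₁ X₂ b k (act1 X₁ X₂ a m (gen1 X₁ X₂ n u v)))) fun n => by
          have := shiftSub_pow_comp (-LinearMap.id) (1, 0) (0, 1) N fun x : ℤ × ℤ =>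
            act1 X₁ X₂ a x.1 (act1 X₁ X₂ b x.2 (gen1 X₁ X₂ n u v))
            - act1 X₁ X₂ b x.2 (act1 X₁ X₂ a x.1 (gen1 X₁ X₂ n u v))
          refine this.trans ?_
          have h := hN₁' (gen1 X₁ X₂ n u v)
          simp only [F1Module_Y] at h
          rw [h]
          funext x
          simp
      have h2 := shiftSub_pow_slice_right (N := N) (D := fun m n k =>
        act1 X₁ X₂ a m (act1 X₁ X₂ b k (gen1 X₁ X₂ n u v) - gen1 X₁ X₂ n u (X₂.Y b k v)))
        fun m => by
          rw [shiftSub_pow_comp (act1 X₁ X₂ a m), hN₃' v]; simp; rfl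
      convert shiftSub_pow_mul_add h1 h2 using 3
      funext x
      simp [hP]
    · have h1 := shiftSub_pow_slice_left (N := N) (D := fun n m k =>
        (-genMap1 X₁ X₂ n u) (X₂.Y a m (X₂.Y b k v) - X₂.Y b k (X₂.Y a m v))) fun n => by
          rw [shiftSub_pow_comp (-genMap1 X₁ X₂ n u), hN₂' v]; simp; rfl
      have h2 := shiftSub_pow_slice_right (N := N) (D := fun m n k =>
        act1 X₁ X₂ b k (gen1 X₁ X₂ n u (X₂.Y a m v)) - gen1 X₁ X₂ n u (X₂.Y b k (X₂.Y a m v)))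
        fun m => hN₃' (X₂.Y a m v)
      convert shiftSub_pow_mul_add h1 h2 using 3
      funext x
      simp only [hQ, Pi.add_apply, LinearMap.neg_apply, map_sub, genMap1_apply]
      abel
    · exact fun i hi => hNr' i hi v
  -- Modulo J₁ the correction term, a Jacobi expression with `b_k v` in place of `v`, disappears.
  -- What remains applies `b_k` to expressions independent of k, so it is truncated as m or n grows,
  -- uniformly in k. The factors can thus be cancelled in the quotient.
  set ψ : ℤ × ℤ × ℤ → F2 X₁ X₂ := fun x => (J1 X₁ X₂).mkQ (φ x) with hψ
  have hψ' : ψ = fun x =>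
      (J1 X₁ X₂).mkQ (act1 X₁ X₂ b x.2.2 (jacobiGen X₁ X₂ a u v l x.1 x.2.1)) := by
    funext x
    rw [hψ]
    simp only
    rw [hφ', map_sub, sub_eq_self]
    exact (Submodule.Quotient.mk_eq_zero _).2 (jacobiGen_mem _ _ _ _ _ _)
  have hkill' : (shiftSub _ (1, 0, 0) (0, 0, 1) ^ N)
      ((shiftSub _ (0, 1, 0) (0, 0, 1) ^ N) ψ) = 0 := by
    rw [hψ, shiftSub_pow_comp, shiftSub_pow_comp, hkill]
    funext x
    simp
  have ht1 : ψ ∈ truncated _ ((1, 0, 0) - (0, 0, 1) : ℤ × ℤ × ℤ) := fun x => by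
    obtain ⟨K, hK⟩ := jacobiGen_eventually_left h₁ h₂ a u v l x.1 x.2.1
    refine ⟨K, fun j hj => ?_⟩
    have := hK j hj
    simp [hψ', this]
  have ht2 : ψ ∈ truncated _ ((0, 1, 0) - (0, 0, 1) : ℤ × ℤ × ℤ) := fun x => by
    obtain ⟨K, hK⟩ := jacobiGen_eventually_right h₁ h₂ a u v l x.1 x.2.1
    refine ⟨K, fun j hj => ?_⟩
    have := hK j hj
    simp [hψ', this]
  have h1 : ψ = 0 := eq_zero_of_shiftSub_pow' ht2
    (eq_zero_of_shiftSub_pow' (shiftSub_pow_mem_truncated ht1 _ _ _) hkill')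
  have h2 := congrFun h1 (m, n, k)
  rw [hψ'] at h2
  exact h2

/-- `F₂` is a weak module. -/
def F2Module : WeakModule A (F2 X₁ X₂) :=
  (F1Module h₁ h₂).quotient (J1 X₁ X₂) (J1_isSub h₁ h₂)

theorem F2Module_π₂ (a : V) (n : ℤ) (x : F0 W₁ W₂) :
    (F2Module h₁ h₂).Y a n (π₂ X₁ X₂ x) = π₂ X₁ X₂ (act0 X₁ X₂ a n x) := rfl

end

end VOA

/-! ### Eigenspaces and degree operators. -/

namespace VOA

set_option linter.unusedSectionVars false

noncomputable section

section LinearAlgebra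

variable {M : Type*} [AddCommGroup M] [Module ℂ M] {ι : Type*}

/-- There is an operator with prescribed eigenvalues on an independent family. -/
theorem exists_scalar_of_iSupIndep {p : ι → Submodule ℂ M} (hp : iSupIndep p) (c : ι → ℂ) :
    ∃ f : Module.End ℂ M, ∀ i, ∀ x ∈ p i, f x = c i • x := by
  classical
  obtain ⟨g, hg⟩ := LinearMap.exists_leftInverse_of_injective (DirectSum.coeLinearMap p)
    (LinearMap.ker_eq_bot.2 hp.dfinsupp_lsum_injective)
  refine ⟨DirectSum.toModule ℂ ι M (fun i => c i • (p i).subtype) ∘ₗ g, fun i x hx => ?_⟩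
  have h1 : g x = DirectSum.lof ℂ ι (fun i => p i) i ⟨x, hx⟩ := by
    have := LinearMap.congr_fun hg (DirectSum.lof ℂ ι (fun i => p i) i ⟨x, hx⟩)
    rw [LinearMap.comp_apply, DirectSum.coeLinearMap_lof] at this
    exact this
  rw [LinearMap.comp_apply, h1, DirectSum.toModule_lof]
  rfl

/-- The projection onto one summand of the larger family maps the span of the smaller family into
the corresponding smaller summand. -/
theorem eq_of_le_of_iSupIndep {p q : ι → Submodule ℂ M} (hq : iSupIndep q) (hle : ∀ i, p i ≤ q i)
    (htop : ⨆ i, p i = ⊤) (i : ι) : p i = q i := by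
  classical
  refine le_antisymm (hle i) fun x hx => ?_
  obtain ⟨f, hf⟩ := exists_scalar_of_iSupIndep hq fun j => if j = i then 1 else 0
  have h1 : f x = x := by simpa using hf i x hx
  have h2 : ⨆ j, p j ≤ (p i).comap f := iSup_le fun j y hy => by
    rw [Submodule.mem_comap, hf j y (hle j hy)]
    split_ifs with h
    · subst h; simpa using hy
    · simp
  rw [← h1]
  exact h2 (htop ▸ Submodule.mem_top)

/-- Eigencomponents of an element of a stable subspace lie in the subspace. -/
theorem eigencomponent_mem {f : Module.End ℂ M} {N : Submodule ℂ M} (hN : ∀ x ∈ N, f x ∈ N)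
    (s : Finset ℂ) (y : ℂ → M) (hy : ∀ k ∈ s, y k ∈ f.eigenspace k) (hs : ∑ k ∈ s, y k ∈ N) :
    ∀ k ∈ s, y k ∈ N := by
  classical
  induction s using Finset.induction_on generalizing y with
  | empty => simp
  | insert k₀ s hk₀ ih =>
    -- Applying `f - k₀` removes the component of eigenvalue `k₀` and rescales the others by nonzero
    -- factors.
    have h1 : ∑ k ∈ s, (k - k₀) • y k ∈ N := by
      have h2 : f (∑ k ∈ insert k₀ s, y k) - k₀ • ∑ k ∈ insert k₀ s, y k
          = ∑ k ∈ s, (k - k₀) • y k := by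
        rw [map_sum, Finset.smul_sum, ← Finset.sum_sub_distrib, Finset.sum_insert hk₀,
          Module.End.mem_eigenspace_iff.1 (hy k₀ (Finset.mem_insert_self _ _)), sub_self, zero_add]
        refine Finset.sum_congr rfl fun k hk => ?_
        rw [Module.End.mem_eigenspace_iff.1 (hy k (Finset.mem_insert_of_mem hk)), sub_smul]
      rw [← h2]
      exact N.sub_mem (hN _ hs) (N.smul_mem _ hs)
    have h3 := ih (fun k => (k - k₀) • y k)
      (fun k hk => Submodule.smul_mem _ _ (hy k (Finset.mem_insert_of_mem hk))) h1
    have h4 : ∀ k ∈ s, y k ∈ N := fun k hk => by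
      have hne : k - k₀ ≠ 0 := sub_ne_zero.2 fun h => hk₀ (h ▸ hk)
      exact (Submodule.smul_mem_iff N hne).1 (h3 k hk)
    intro k hk
    rcases Finset.mem_insert.1 hk with rfl | hk
    · rw [Finset.sum_insert hk₀] at hs
      exact (Submodule.add_mem_iff_left N (N.sum_mem h4)).1 hs
    · exact h4 k hk

theorem eq_iSup_inf_eigenspace {f : Module.End ℂ M} {N : Submodule ℂ M}
    (hN : ∀ x ∈ N, f x ∈ N) (h : ⨆ k, f.eigenspace k = ⊤) : ⨆ k, N ⊓ f.eigenspace k = N := by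
  refine le_antisymm (iSup_le fun k => inf_le_left) fun x hx => ?_
  have hx' : x ∈ ⨆ k, f.eigenspace k := h ▸ Submodule.mem_top
  obtain ⟨y, hy, rfl⟩ := (Submodule.mem_iSup_iff_exists_finsupp _ _).1 hx'
  exact Submodule.sum_mem _ fun k hk => Submodule.mem_iSup_of_mem k
    ⟨eigencomponent_mem hN y.support y (fun k _ => hy k) hx k hk, hy k⟩

theorem iSup_int_eq_top_of_nat {f : Module.End ℂ M} (h : ⨆ k : ℕ, f.eigenspace k = ⊤) :
    ⨆ k : ℤ, f.eigenspace k = ⊤ :=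
  top_le_iff.1 (h ▸ iSup_le fun k => (le_of_eq (by simp)).trans
    (le_iSup (fun k : ℤ => f.eigenspace k) (k : ℤ)))

theorem iSup_complex_eq_top_of_int {f : Module.End ℂ M} (h : ⨆ k : ℤ, f.eigenspace k = ⊤) :
    ⨆ k : ℂ, f.eigenspace k = ⊤ :=
  top_le_iff.1 (h ▸ iSup_le fun k => le_iSup (fun k : ℂ => f.eigenspace k) (k : ℂ))

theorem iSupIndep_eigenspace_int (f : Module.End ℂ M) :
    iSupIndep fun k : ℤ => f.eigenspace (k : ℂ) :=
  f.eigenspaces_iSupIndep.comp Int.cast_injective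

theorem eq_iSup_inf_eigenspace_int {f : Module.End ℂ M} {N : Submodule ℂ M}
    (hN : ∀ x ∈ N, f x ∈ N) (h : ⨆ k : ℤ, f.eigenspace k = ⊤) :
    ⨆ k : ℤ, N ⊓ f.eigenspace k = N := by
  refine le_antisymm (iSup_le fun k => inf_le_left) fun x hx => ?_
  rw [← eq_iSup_inf_eigenspace hN (iSup_complex_eq_top_of_int h)] at hx
  refine (iSup_le fun k => ?_ : ⨆ k, N ⊓ f.eigenspace k ≤ _) hx
  by_cases hk : ∃ j : ℤ, (j : ℂ) = k
  · obtain ⟨j, rfl⟩ := hk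
    exact le_iSup (fun k : ℤ => N ⊓ f.eigenspace k) j
  -- A non-integral eigenspace is independent of the integral ones, which already span everything,
  -- so it is zero.
  · have hd := f.eigenspaces_iSupIndep k
    have h1 : ⨆ j, ⨆ (_ : j ≠ k), f.eigenspace j = ⊤ := by
      rw [← top_le_iff, ← h]
      exact iSup_le fun j => le_iSup₂_of_le (j : ℂ) (fun h => hk ⟨j, h⟩) le_rfl
    rw [h1, disjoint_top] at hd
    rw [hd]
    simp

end LinearAlgebra

variable {V : Type u} [AddCommGroup V] [Module ℂ V] {A : VertexOperatorAlgebra V}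

namespace WeakModule

variable {M : Type u} [AddCommGroup M] [Module ℂ M] (X : WeakModule A M)

/-- The action of `L(0)` on `V` itself. -/
def _root_.VOA.VertexOperatorAlgebra.L0 (A : VertexOperatorAlgebra V) : Module.End ℂ V :=
  A.Y A.conformal 1

theorem choose_one (i : ℕ) (hi : 2 ≤ i) : Ring.choose (1 : ℤ) i = 0 := by
  have := Ring.choose_natCast (R := ℤ) 1 i
  rw [Nat.choose_eq_zero_of_lt (by omega)] at this
  simpa using this

theorem L_zero_bracket (a : V) (n : ℤ) (w : M) :
    X.L 0 (X.Y a n w) = X.Y a n (X.L 0 w) + X.Y (A.L0 a) n w - ((n : ℂ) + 1) • X.Y a n w := by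
  have h := X.commutator A.conformal a w 1 n
  rw [finsum_eq_sum_range (N := 2) fun i hi => by rw [choose_one i hi]; simp,
    Finset.sum_range_succ, Finset.sum_range_one] at h
  simp only [Ring.choose_zero_right, Ring.choose_one_right, Nat.cast_zero, Nat.cast_one,
    Int.cast_one, one_smul, sub_zero, add_sub_cancel_left, X.derivative] at h
  rw [L, zero_add, h, VertexOperatorAlgebra.L0, LinearMap.smul_apply]
  push_cast
  module

/-- `d` is the operator of degree for a gradation by `ℕ` of a weak module. -/
def IsDegreeOp (d : Module.End ℂ M) : Prop :=
  (⨆ k : ℕ, d.eigenspace k = ⊤) ∧ ∀ (a : V) (n : ℤ) (w : M),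
    d (X.Y a n w) = X.Y a n (d w) + X.Y (A.L0 a) n w - ((n : ℂ) + 1) • X.Y a n w

end WeakModule

/-! ### Gradations of F₀, F₁, F₂ and T as degree operators. -/

section Grading

variable {W₁ W₂ : Type u} [AddCommGroup W₁] [Module ℂ W₁] [AddCommGroup W₂] [Module ℂ W₂]
  (X₁ : WeakModule A W₁) (X₂ : WeakModule A W₂)

/-- The operator of degree, `L(0) - h` with `h` the lowest weight. -/
def WeakModule.degOp (X : WeakModule A W₁) : Module.End ℂ W₁ :=
  X.L 0 - X.lowestWeight • LinearMap.id

theorem WeakModule.degOp_apply (X : WeakModule A W₁) (w : W₁) :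
    X.degOp w = X.L 0 w - X.lowestWeight • w := rfl

theorem WeakModule.degOp_bracket (X : WeakModule A W₁) (a : V) (n : ℤ) (w : W₁) :
    X.degOp (X.Y a n w) = X.Y a n (X.degOp w) + X.Y (A.L0 a) n w - ((n : ℂ) + 1) • X.Y a n w := by
  rw [degOp_apply, degOp_apply, X.L_zero_bracket, map_sub, map_smul]
  abel

theorem WeakModule.degOp_of_mem_deg {X : WeakModule A W₁} {n : ℕ} {w : W₁} (hw : w ∈ X.deg n) :
    X.degOp w = (n : ℂ) • w := by
  rw [degOp_apply, Module.End.mem_eigenspace_iff.1 hw, ← sub_smul, add_sub_cancel_left]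

theorem exists_degree0 : ∃ D : Module.End ℂ (F0 W₁ W₂), ∀ n u v, D (gen n u v)
    = gen n (X₁.degOp u) v + gen n u (X₂.degOp v) - ((n : ℂ) + 1) • gen n u v := by
  obtain ⟨D, hD⟩ := exists_F0_lift fun n => genMap W₁ W₂ n ∘ₗ X₁.degOp
    + (genMap W₁ W₂ n).compl₂ X₂.degOp + (-((n : ℂ) + 1)) • genMap W₁ W₂ n
  refine ⟨D, fun n u v => ?_⟩
  rw [hD, sub_eq_add_neg, ← neg_smul ((n : ℂ) + 1) (gen n u v)]
  rfl

/-- The operator of degree on `F₀`. -/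
def degree0 : Module.End ℂ (F0 W₁ W₂) := (exists_degree0 X₁ X₂).choose

theorem degree0_gen (n : ℤ) (u : W₁) (v : W₂) : degree0 X₁ X₂ (gen n u v)
    = gen n (X₁.degOp u) v + gen n u (X₂.degOp v) - ((n : ℂ) + 1) • gen n u v :=
  (exists_degree0 X₁ X₂).choose_spec n u v

theorem degree0_of_deg {m n : ℕ} {u : W₁} {v : W₂} (hu : u ∈ X₁.deg m) (hv : v ∈ X₂.deg n) (k : ℤ) :
    degree0 X₁ X₂ (gen k u v) = (((m : ℤ) + n - k - 1 : ℤ) : ℂ) • gen k u v := by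
  rw [degree0_gen, WeakModule.degOp_of_mem_deg hu, WeakModule.degOp_of_mem_deg hv, gen_smul_left,
    gen_smul_right]
  push_cast
  module

theorem gen_sub_left (n : ℤ) (u u' : W₁) (v : W₂) : gen n (u - u') v = gen n u v - gen n u' v := by
  simp [gen, TensorProduct.sub_tmul, TensorProduct.tmul_sub]

theorem gen_sub_right (n : ℤ) (u : W₁) (v v' : W₂) :
    gen n u (v - v') = gen n u v - gen n u v' := by
  simp [gen, TensorProduct.tmul_sub]

theorem act0_gen_range (a : V) (m n : ℤ) (u : W₁) (v : W₂) {N : ℕ}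
    (hN : ∀ i ≥ N, X₁.Y a i u = 0) :
    act0 X₁ X₂ a m (gen n u v) = gen n u (X₂.Y a m v) + ∑ i ∈ Finset.range N,
      ((Ring.choose m i : ℤ) : ℂ) • gen (m + n - i) (X₁.Y a i u) v := by
  rw [act0_gen, finsum_eq_sum_range fun i hi => by rw [hN i hi, gen_zero_left, smul_zero]]

/-- The mode `a(m)` raises the degree by the weight of `a` minus m minus 1. Writing the weight
through `L(0)` on V makes the formula linear in `a` and avoids homogeneous elements; it then passes
to all quotients. -/
theorem degree0_act0 (a : V) (m : ℤ) (x : F0 W₁ W₂) : degree0 X₁ X₂ (act0 X₁ X₂ a m x)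
    = act0 X₁ X₂ a m (degree0 X₁ X₂ x) + act0 X₁ X₂ (A.L0 a) m x
      - ((m : ℂ) + 1) • act0 X₁ X₂ a m x := by
  suffices degree0 X₁ X₂ ∘ₗ act0 X₁ X₂ a m = act0 X₁ X₂ a m ∘ₗ degree0 X₁ X₂
      + act0 X₁ X₂ (A.L0 a) m - ((m : ℂ) + 1) • act0 X₁ X₂ a m from LinearMap.congr_fun this x
  refine F0_hom_ext fun n u v => ?_
  obtain ⟨N₁, hN₁⟩ := X₁.eventuallyZero_nat a u
  obtain ⟨N₂, hN₂⟩ := X₁.eventuallyZero_nat (A.L0 a) u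
  obtain ⟨N₃, hN₃⟩ := X₁.eventuallyZero_nat a (X₁.degOp u)
  set N := N₁ + N₂ + N₃
  have e1 : ∀ i ≥ N, X₁.Y a i u = 0 := fun i hi => hN₁ i (by omega)
  have e2 : ∀ i ≥ N, X₁.Y (A.L0 a) i u = 0 := fun i hi => hN₂ i (by omega)
  have e3 : ∀ i ≥ N, X₁.Y a i (X₁.degOp u) = 0 := fun i hi => hN₃ i (by omega)
  simp only [LinearMap.comp_apply, LinearMap.add_apply, LinearMap.sub_apply, LinearMap.smul_apply]
  rw [degree0_gen, map_sub, map_add, map_smul, act0_gen_range _ _ a m n u v e1,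
    act0_gen_range _ _ a m n u (X₂.degOp v) e1, act0_gen_range _ _ (A.L0 a) m n u v e2,
    act0_gen_range _ _ a m n (X₁.degOp u) v e3, map_add, map_sum, degree0_gen, X₂.degOp_bracket]
  have hs : ∑ i ∈ Finset.range N, degree0 X₁ X₂
      (((Ring.choose m i : ℤ) : ℂ) • gen (m + n - i) (X₁.Y a i u) v)
      = ∑ i ∈ Finset.range N, ((Ring.choose m i : ℤ) : ℂ) •
          gen (m + n - i) (X₁.Y a i (X₁.degOp u)) v
        + ∑ i ∈ Finset.range N, ((Ring.choose m i : ℤ) : ℂ) •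
          gen (m + n - i) (X₁.Y (A.L0 a) i u) v
        + ∑ i ∈ Finset.range N, ((Ring.choose m i : ℤ) : ℂ) •
          gen (m + n - i) (X₁.Y a i u) (X₂.degOp v)
        - ((m : ℂ) + n + 2) • ∑ i ∈ Finset.range N, ((Ring.choose m i : ℤ) : ℂ) •
          gen (m + n - i) (X₁.Y a i u) v := by
    rw [Finset.smul_sum, ← Finset.sum_add_distrib, ← Finset.sum_add_distrib,
      ← Finset.sum_sub_distrib]
    refine Finset.sum_congr rfl fun i _ => ?_
    rw [map_smul, degree0_gen, X₁.degOp_bracket, gen_sub_left, gen_add_left, gen_smul_left]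
    push_cast
    module
  rw [hs]
  simp only [gen_sub_right, gen_add_right, gen_smul_right]
  module

theorem degree0_mem_J0 : J0 X₁ X₂ ≤ (J0 X₁ X₂).comap (degree0 X₁ X₂) := by
  refine le_trans (sInf_le ⟨?_, ?_⟩ : J0 X₁ X₂ ≤ J0 X₁ X₂ ⊓ (J0 X₁ X₂).comap (degree0 X₁ X₂))
    inf_le_right
  · rintro a k x ⟨hx, hx'⟩
    refine ⟨act0_mem_J0 X₁ X₂ a k hx, ?_⟩
    rw [SetLike.mem_coe, Submodule.mem_comap, degree0_act0]
    exact Submodule.sub_mem _ (Submodule.add_mem _ (act0_mem_J0 X₁ X₂ a k hx')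
      (act0_mem_J0 X₁ X₂ _ k hx)) (Submodule.smul_mem _ _ (act0_mem_J0 X₁ X₂ a k hx))
  · intro m n i u hu v hv
    have h := gen_mem_J0 hu hv (k := (m : ℤ) + n + i) (by omega)
    refine ⟨h, ?_⟩
    rw [SetLike.mem_coe, Submodule.mem_comap, degree0_of_deg X₁ X₂ hu hv]
    exact Submodule.smul_mem _ _ h

/-- The operator of degree on `F₁`. -/
def degree1 : Module.End ℂ (F1 X₁ X₂) :=
  (J0 X₁ X₂).mapQ (J0 X₁ X₂) (degree0 X₁ X₂) (degree0_mem_J0 X₁ X₂)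

theorem degree1_gen1 (n : ℤ) (u : W₁) (v : W₂) : degree1 X₁ X₂ (gen1 X₁ X₂ n u v)
    = gen1 X₁ X₂ n (X₁.degOp u) v + gen1 X₁ X₂ n u (X₂.degOp v)
      - ((n : ℂ) + 1) • gen1 X₁ X₂ n u v := by
  have h := congrArg (J0 X₁ X₂).mkQ (degree0_gen X₁ X₂ n u v)
  rw [map_sub, map_add, map_smul] at h
  exact h

theorem degree1_act1 (a : V) (m : ℤ) (x : F1 X₁ X₂) : degree1 X₁ X₂ (act1 X₁ X₂ a m x)
    = act1 X₁ X₂ a m (degree1 X₁ X₂ x) + act1 X₁ X₂ (A.L0 a) m x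
      - ((m : ℂ) + 1) • act1 X₁ X₂ a m x := by
  obtain ⟨x, rfl⟩ := Submodule.mkQ_surjective _ x
  have h := congrArg (J0 X₁ X₂).mkQ (degree0_act0 X₁ X₂ a m x)
  rw [map_sub, map_add, map_smul] at h
  exact h

variable {X₁ X₂}
variable (h₁ : ⨆ n, X₁.deg n = ⊤) (h₂ : ⨆ n, X₂.deg n = ⊤)

include h₁ h₂

/-- Every term of a Jacobi expression carries the same total index, so the degree operator acts by a
Leibniz rule with the common shift -(l + m + n + 2). This makes J₁ graded. -/
theorem degree1_jacobiGen (a : V) (u : W₁) (v : W₂) (l m n : ℤ) :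
    degree1 X₁ X₂ (jacobiGen X₁ X₂ a u v l m n)
      = jacobiGen X₁ X₂ a (X₁.degOp u) v l m n + jacobiGen X₁ X₂ a u (X₂.degOp v) l m n
        + jacobiGen X₁ X₂ (A.L0 a) u v l m n
        + (-((l : ℂ) + m + n + 2)) • jacobiGen X₁ X₂ a u v l m n := by
  have p1 := fun a u v => eventuallyZero_jacobiGen_p h₁ h₂ a u v (m + l) n
  have q1 := fun a u v => eventuallyZero_jacobiGen_q (X₁ := X₁) (X₂ := X₂) a u v m (n + l)
  have r1 := fun a u v => eventuallyZero_jacobiGen_r (X₁ := X₁) (X₂ := X₂) a u v l (m + n)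
  unfold jacobiGen
  rw [← jacobiCoeff_smul _ (p1 _ _ _) (q1 _ _ _) (r1 _ _ _),
    map_jacobiCoeff _ (p1 _ _ _) (q1 _ _ _) (r1 _ _ _),
    ← jacobiCoeff_add (p1 _ _ _) (q1 _ _ _) (r1 _ _ _) (p1 _ _ _) (q1 _ _ _) (r1 _ _ _),
    ← jacobiCoeff_add ((p1 _ _ _).add (p1 _ _ _)) ((q1 _ _ _).add (q1 _ _ _))
      ((r1 _ _ _).add (r1 _ _ _)) (p1 _ _ _) (q1 _ _ _) (r1 _ _ _),
    ← jacobiCoeff_add (((p1 _ _ _).add (p1 _ _ _)).add (p1 _ _ _))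
      (((q1 _ _ _).add (q1 _ _ _)).add (q1 _ _ _)) (((r1 _ _ _).add (r1 _ _ _)).add (r1 _ _ _))
      ((p1 _ _ _).smul _) ((q1 _ _ _).smul _) ((r1 _ _ _).smul _)]
  congr 1
  · funext i
    rw [degree1_act1, degree1_gen1, map_sub, map_add, map_smul]
    push_cast
    module
  · funext i
    rw [degree1_gen1, X₂.degOp_bracket]
    simp only [← genMap1_apply, map_sub, map_add, map_smul]
    push_cast
    module
  · funext i
    rw [degree1_gen1, X₁.degOp_bracket]
    simp only [← genMap1_apply, map_sub, map_add, map_smul, LinearMap.sub_apply,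
      LinearMap.add_apply, LinearMap.smul_apply]
    push_cast
    module

theorem degree1_mem_J1 : J1 X₁ X₂ ≤ (J1 X₁ X₂).comap (degree1 X₁ X₂) :=
  J1_induction fun a u v l m n => by
    rw [Submodule.mem_comap, degree1_jacobiGen h₁ h₂]
    exact Submodule.add_mem _ (Submodule.add_mem _ (Submodule.add_mem _ (jacobiGen_mem _ _ _ _ _ _)
      (jacobiGen_mem _ _ _ _ _ _)) (jacobiGen_mem _ _ _ _ _ _))
      (Submodule.smul_mem _ _ (jacobiGen_mem _ _ _ _ _ _))

/-- The operator of degree on `F₂`. -/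
def degree2 : Module.End ℂ (F2 X₁ X₂) :=
  (J1 X₁ X₂).mapQ (J1 X₁ X₂) (degree1 X₁ X₂) (degree1_mem_J1 h₁ h₂)

theorem degree2_π₂ (x : F0 W₁ W₂) :
    degree2 h₁ h₂ (π₂ X₁ X₂ x) = π₂ X₁ X₂ (degree0 X₁ X₂ x) := rfl

omit h₁ h₂ in
theorem π₂_surjective : Function.Surjective (π₂ X₁ X₂) :=
  (Submodule.mkQ_surjective _).comp (Submodule.mkQ_surjective _)

theorem iSup_grade0 : ⨆ d, grade0 X₁ X₂ d = ⊤ := by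
  refine F0_span _ fun k u v => ?_
  have hu : u ∈ ⨆ n, X₁.deg n := h₁ ▸ Submodule.mem_top
  have hv : v ∈ ⨆ n, X₂.deg n := h₂ ▸ Submodule.mem_top
  induction hu using Submodule.iSup_induction' with
  | zero => rw [gen_zero_left]; exact Submodule.zero_mem _
  | add u u' _ _ ih ih' => rw [gen_add_left]; exact Submodule.add_mem _ ih ih'
  | mem m u hu =>
    induction hv using Submodule.iSup_induction' with
    | zero => rw [gen_zero_right]; exact Submodule.zero_mem _
    | add v v' _ _ ih ih' => rw [gen_add_right]; exact Submodule.add_mem _ ih ih'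
    | mem n v hv =>
      exact Submodule.mem_iSup_of_mem _ (Submodule.subset_span ⟨k, m, n, u, hu, v, hv, rfl, rfl⟩)

theorem iSup_grade2 : ⨆ d, grade2 X₁ X₂ d = ⊤ := by
  simp only [grade2]
  rw [← Submodule.map_iSup, iSup_grade0 h₁ h₂, Submodule.map_top,
    LinearMap.range_eq_top.2 π₂_surjective]

theorem grade2_le (d : ℤ) : grade2 X₁ X₂ d ≤ (degree2 h₁ h₂).eigenspace d := by
  rw [grade2, Submodule.map_le_iff_le_comap]
  refine Submodule.span_le.2 ?_
  rintro x ⟨k, m, n, u, hu, v, hv, rfl, rfl⟩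
  rw [SetLike.mem_coe, Submodule.mem_comap, Module.End.mem_eigenspace_iff, degree2_π₂,
    degree0_of_deg X₁ X₂ hu hv, map_smul]

/-- The induced gradation lies inside the eigenspaces and already spans, so independence of
eigenspaces forces equality. -/
theorem grade2_eq (d : ℤ) : grade2 X₁ X₂ d = (degree2 h₁ h₂).eigenspace d :=
  eq_of_le_of_iSupIndep (iSupIndep_eigenspace_int _) (grade2_le h₁ h₂) (iSup_grade2 h₁ h₂) d

omit h₁ h₂ in
-- The element `t^k ⊗ u ⊗ v` with `u ∈ W₁(m)`, `v ∈ W₂(n)` has negative degree exactly when `k ≥ m +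
-- n`, which is the condition defining the generators of J₀.
theorem grade2_of_neg {d : ℤ} (hd : d < 0) : grade2 X₁ X₂ d = ⊥ := by
  rw [grade2, ← le_bot_iff, Submodule.map_le_iff_le_comap]
  refine Submodule.span_le.2 ?_
  rintro x ⟨k, m, n, u, hu, v, hv, hk, rfl⟩
  have h : gen1 X₁ X₂ k u v = 0 :=
    (Submodule.Quotient.mk_eq_zero _).2 (gen_mem_J0 hu hv (by omega))
  rw [SetLike.mem_coe, Submodule.mem_comap, Submodule.mem_bot, π₂, LinearMap.comp_apply, mkQ_gen,
    h, map_zero]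

theorem degree2_isDegreeOp : (F2Module h₁ h₂).IsDegreeOp (degree2 h₁ h₂) := by
  refine ⟨?_, fun a n w => ?_⟩
  · rw [← top_le_iff, ← iSup_grade2 h₁ h₂]
    refine iSup_le fun d => ?_
    rcases lt_or_ge d 0 with hd | hd
    · rw [grade2_of_neg hd]; exact bot_le
    · obtain ⟨k, rfl⟩ := Int.eq_ofNat_of_zero_le hd
      rw [grade2_eq h₁ h₂]
      exact (le_of_eq (by simp)).trans
        (le_iSup (fun k : ℕ => (degree2 h₁ h₂).eigenspace k) k)
  · obtain ⟨x, rfl⟩ := π₂_surjective w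
    rw [degree2_π₂]
    simp only [F2Module_π₂]
    rw [degree2_π₂, degree0_act0, map_sub, map_add, map_smul]

theorem iSup_degree2 : ⨆ k : ℤ, (degree2 h₁ h₂).eigenspace k = ⊤ :=
  iSup_int_eq_top_of_nat (degree2_isDegreeOp h₁ h₂).1

theorem isGradedSub2_iff (N : Submodule ℂ (F2 X₁ X₂)) : IsGradedSub2 X₁ X₂ N ↔
    (F2Module h₁ h₂).IsSub N ∧ ∀ x ∈ N, degree2 h₁ h₂ x ∈ N := by
  constructor
  · rintro ⟨hN, hN'⟩
    refine ⟨fun a n w hw => ?_, fun x hx => ?_⟩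
    · obtain ⟨x, rfl⟩ := π₂_surjective w
      exact hN a n x hw
    · have h : N ≤ N.comap (degree2 h₁ h₂) := by
        conv_lhs => rw [← hN']
        refine iSup_le fun d => ?_
        rintro y ⟨hy, hy'⟩
        rw [Submodule.mem_comap, Module.End.mem_eigenspace_iff.1 (grade2_le h₁ h₂ d hy')]
        exact N.smul_mem _ hy
      exact h hx
  · rintro ⟨hN, hN'⟩
    refine ⟨fun a k x hx => hN a k _ hx, ?_⟩
    simp only [grade2_eq h₁ h₂]
    exact eq_iSup_inf_eigenspace_int hN' (iSup_degree2 h₁ h₂)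

theorem radical_isSub : (F2Module h₁ h₂).IsSub (radical X₁ X₂) := by
  intro a n
  suffices radical X₁ X₂ ≤ (radical X₁ X₂).comap ((F2Module h₁ h₂).Y a n) from this
  refine sSup_le fun N hN x hx => ?_
  exact (le_sSup hN : N ≤ radical X₁ X₂) (((isGradedSub2_iff h₁ h₂ N).1 hN.1).1 a n x hx)

theorem degree2_mem_radical :
    radical X₁ X₂ ≤ (radical X₁ X₂).comap (degree2 h₁ h₂) := by
  refine sSup_le fun N hN x hx => ?_
  exact (le_sSup hN : N ≤ radical X₁ X₂) (((isGradedSub2_iff h₁ h₂ N).1 hN.1).2 x hx)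

/-- A graded submodule without degree-0 part lies in the sum of the nonzero degrees, and this bound
survives arbitrary sums. Hence the radical itself meets degree 0 trivially and is indeed the largest
such submodule. -/
theorem radical_le :
    radical X₁ X₂ ≤ ⨆ (k : ℤ) (_ : k ≠ 0), (degree2 h₁ h₂).eigenspace k := by
  refine sSup_le fun N hN => ?_
  rw [← hN.1.2]
  refine iSup_le fun d => ?_
  rcases eq_or_ne d 0 with rfl | hd
  · rw [hN.2]; exact bot_le
  · exact inf_le_right.trans ((grade2_le h₁ h₂ d).trans
      (le_iSup₂_of_le (f := fun (k : ℤ) (_ : k ≠ 0) => (degree2 h₁ h₂).eigenspace k) d hd le_rfl))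

theorem radical_inf : radical X₁ X₂ ⊓ grade2 X₁ X₂ 0 = ⊥ := by
  have h := iSupIndep_eigenspace_int (degree2 h₁ h₂) 0
  rw [grade2_eq h₁ h₂, inf_comm]
  exact (h.mono_right (radical_le h₁ h₂)).eq_bot

/-- `T(W₁, W₂)` is a weak module. -/
def TModule : WeakModule A (TP X₁ X₂) :=
  (F2Module h₁ h₂).quotient (radical X₁ X₂) (radical_isSub h₁ h₂)

theorem TModule_proj (a : V) (n : ℤ) (x : F0 W₁ W₂) :
    (TModule h₁ h₂).Y a n (proj X₁ X₂ x) = proj X₁ X₂ (act0 X₁ X₂ a n x) := rfl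

omit h₁ h₂ in
theorem proj_surjective : Function.Surjective (proj X₁ X₂) :=
  (Submodule.mkQ_surjective _).comp π₂_surjective

/-- The operator of degree on `T(W₁, W₂)`. -/
def degreeT : Module.End ℂ (TP X₁ X₂) :=
  (radical X₁ X₂).mapQ (radical X₁ X₂) (degree2 h₁ h₂) (degree2_mem_radical h₁ h₂)

theorem degreeT_mkQ (x : F2 X₁ X₂) : degreeT h₁ h₂ ((radical X₁ X₂).mkQ x)
    = (radical X₁ X₂).mkQ (degree2 h₁ h₂ x) := rfl

theorem degreeT_proj (x : F0 W₁ W₂) :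
    degreeT h₁ h₂ (proj X₁ X₂ x) = proj X₁ X₂ (degree0 X₁ X₂ x) := rfl

theorem degreeT_isDegreeOp : (TModule h₁ h₂).IsDegreeOp (degreeT h₁ h₂) := by
  refine ⟨?_, fun a n w => ?_⟩
  · have h := congrArg (Submodule.map (radical X₁ X₂).mkQ) (degree2_isDegreeOp h₁ h₂).1
    rw [Submodule.map_iSup, Submodule.map_top, Submodule.range_mkQ] at h
    rw [← top_le_iff, ← h]
    refine iSup_mono fun k => ?_
    rintro _ ⟨x, hx, rfl⟩
    rw [Module.End.mem_eigenspace_iff, degreeT_mkQ, Module.End.mem_eigenspace_iff.1 hx, map_smul]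
  · obtain ⟨x, rfl⟩ := proj_surjective w
    rw [degreeT_proj]
    simp only [TModule_proj]
    rw [degreeT_proj, degree0_act0, map_sub, map_add, map_smul]

/-- A nonzero graded submodule of `T(W₁, W₂)` meets the component of degree zero. -/
theorem eq_bot_of_inf_degreeT {S : Submodule ℂ (TP X₁ X₂)} (hS : (TModule h₁ h₂).IsSub S)
    (hS' : ∀ x ∈ S, degreeT h₁ h₂ x ∈ S) (h : S ⊓ (degreeT h₁ h₂).eigenspace 0 = ⊥) : S = ⊥ := by
  -- The preimage in F₂ is graded, and its degree-0 elements map to 0 in T; they lie in the radical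
  -- and in F₂(0), hence vanish. So the preimage is one of the submodules making up the radical.
  have hN : S.comap (radical X₁ X₂).mkQ ≤ radical X₁ X₂ := by
    refine le_sSup ⟨(isGradedSub2_iff h₁ h₂ _).2 ⟨fun a n w hw => ?_, fun x hx => ?_⟩, ?_⟩
    · exact hS a n _ hw
    · exact hS' _ hx
    · rw [eq_bot_iff, ← radical_inf h₁ h₂]
      rintro x ⟨hx, hx'⟩
      refine ⟨?_, hx'⟩
      rw [SetLike.mem_coe, ← Submodule.Quotient.mk_eq_zero, ← Submodule.mem_bot ℂ, ← h]
      refine ⟨hx, ?_⟩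
      have h0 := Module.End.mem_eigenspace_iff.1 (grade2_le h₁ h₂ 0 hx')
      rw [SetLike.mem_coe, Module.End.mem_eigenspace_iff]
      change degreeT h₁ h₂ ((radical X₁ X₂).mkQ x) = _
      rw [degreeT_mkQ, h0]
      simp
  rw [eq_bot_iff]
  intro y hy
  obtain ⟨x, rfl⟩ := Submodule.mkQ_surjective _ y
  exact (Submodule.mem_bot ℂ).2 ((Submodule.Quotient.mk_eq_zero _).2 (hN hy))

end Grading

end

end VOA

/-! ### Schur's lemma, lowest weights and complete reducibility. -/

namespace VOA

set_option linter.unusedSectionVars false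

noncomputable section

section Dixmier

open Polynomial in
/-- Dixmier's lemma: an endomorphism of a nonzero complex vector space of countable dimension has
nonempty spectrum. -/
theorem spectrum_nonempty_of_rank_le_aleph0 {E : Type*} [AddCommGroup E] [Module ℂ E] [Nontrivial E]
    (hE : Module.rank ℂ E ≤ Cardinal.aleph0) (f : Module.End ℂ E) : (spectrum ℂ f).Nonempty := by
  classical
  by_contra hne
  rw [Set.not_nonempty_iff_eq_empty] at hne
  obtain ⟨v, hv⟩ := exists_ne (0 : E)
  -- By the spectral mapping theorem an empty spectrum makes every nonzero polynomial in `f`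
  -- invertible.
  have hunit : ∀ q : ℂ[X], q ≠ 0 → IsUnit (aeval f q) := by
    intro q hq
    rcases lt_or_ge 0 q.degree with hd | hd
    · have h := spectrum.map_polynomial_aeval_of_degree_pos f q hd
      rw [hne, Set.image_empty] at h
      by_contra hu
      exact (Set.eq_empty_iff_forall_notMem.1 h 0) ((spectrum.zero_mem_iff ℂ).2 hu)
    · rw [eq_C_of_degree_le_zero hd] at hq ⊢
      rw [aeval_C]
      exact (IsUnit.mk0 _ fun h => hq (by rw [h, C_0])).map _
  -- The vectors `(f - c)⁻¹ v`, one for each complex number c, turn out to be linearly independent,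
  -- which is impossible in countable dimension.
  have hg : ∀ c : ℂ, ∃ x, (aeval f (X - C c)) x = v := fun c =>
    ((Module.End.isUnit_iff _).1 (hunit _ (X_sub_C_ne_zero c))).2 v
  choose g hg using hg
  have hli : LinearIndependent ℂ g := by
    rw [linearIndependent_iff']
    intro s α hα c₀ hc₀
    -- Clearing denominators in a linear relation gives `q(f) v = 0`, hence `q = 0`; evaluation at
    -- `c₀` isolates the coefficient of `c₀`.
    set q : ℂ[X] := ∑ c ∈ s, C (α c) * ∏ c' ∈ s.erase c, (X - C c') with hq
    have hqv : aeval f q v = 0 := by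
      have h1 : aeval f (∏ c ∈ s, (X - C c)) (∑ c ∈ s, α c • g c) = aeval f q v := by
        rw [hq, map_sum, map_sum, LinearMap.sum_apply]
        refine Finset.sum_congr rfl fun c hc => ?_
        rw [← Finset.prod_erase_mul s _ hc, map_smul, map_mul, Module.End.mul_apply, hg, map_mul,
          Module.End.mul_apply, aeval_C]
        rfl
      rw [← h1, hα, map_zero]
    have hq0 : q = 0 := by
      by_contra hq0
      exact hv (((Module.End.isUnit_iff _).1 (hunit q hq0)).1 (hqv.trans (map_zero _).symm))
    have h2 := congrArg (eval c₀) hq0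
    rw [hq, eval_finsetSum, Finset.sum_eq_single c₀] at h2
    · rw [eval_mul, eval_C, eval_prod, eval_zero, mul_eq_zero] at h2
      refine h2.resolve_right (Finset.prod_ne_zero_iff.2 fun c hc => ?_)
      rw [eval_sub, eval_X, eval_C]
      exact sub_ne_zero.2 (Finset.ne_of_mem_erase hc).symm
    · intro c _ hcc
      rw [eval_mul, eval_prod, Finset.prod_eq_zero (Finset.mem_erase.2 ⟨hcc.symm, hc₀⟩), mul_zero]
      simp
    · exact fun h => absurd hc₀ h
  have h3 := hli.cardinal_lift_le_rank
  have h4 := h3.trans (Cardinal.lift_le.2 hE)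
  rw [Cardinal.lift_aleph0, Cardinal.lift_le_aleph0, Cardinal.mk_complex] at h4
  exact absurd h4 (not_le.2 Cardinal.aleph0_lt_continuum)

end Dixmier

variable {V : Type u} [AddCommGroup V] [Module ℂ V] {A : VertexOperatorAlgebra V}

theorem VertexOperatorAlgebra.exists_countable_span (A : VertexOperatorAlgebra V) :
    ∃ B : Set V, B.Countable ∧ Submodule.span ℂ B = ⊤ := by
  have h : ∀ n, ∃ s : Finset V, Submodule.span ℂ (s : Set V) = A.grade n := fun n =>
    have := A.grade_finite n
    (Submodule.fg_iff_finiteDimensional _).2 this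
  choose s hs using h
  refine ⟨⋃ n, s n, Set.countable_iUnion fun n => (s n).countable_toSet, ?_⟩
  rw [Submodule.span_iUnion, ← A.grade_iSup]
  exact iSup_congr hs

theorem VertexOperatorAlgebra.L0_of_mem (A : VertexOperatorAlgebra V) {n : ℤ} {a : V}
    (ha : a ∈ A.grade n) : A.L0 a = (n : ℂ) • a := A.weight n a ha

/-- Induction over homogeneous elements. -/
theorem VertexOperatorAlgebra.grade_induction (A : VertexOperatorAlgebra V) {p : V → Prop}
    (h0 : p 0) (hadd : ∀ a b, p a → p b → p (a + b)) (hmem : ∀ n, ∀ a ∈ A.grade n, p a) (a : V) :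
    p a := by
  have ha : a ∈ ⨆ n, A.grade n := A.grade_iSup ▸ Submodule.mem_top
  induction ha using Submodule.iSup_induction' with
  | zero => exact h0
  | add a b _ _ ha hb => exact hadd a b ha hb
  | mem n a ha => exact hmem n a ha

namespace WeakModule

variable {M : Type u} [AddCommGroup M] [Module ℂ M] {X : WeakModule A M}
  {M' : Type u} [AddCommGroup M'] [Module ℂ M'] {X' : WeakModule A M'}

/-- V has a countable spanning set because its graded pieces are finite-dimensional. Words in the
modes of that set, applied to one nonzero vector, span a submodule, hence all of `S`. -/
theorem IsIrredSub.rank_le {S : Submodule ℂ M} (hS : X.IsIrredSub S) :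
    Module.rank ℂ S ≤ Cardinal.aleph0 := by
  obtain ⟨B, hB, hspan⟩ := A.exists_countable_span
  obtain ⟨w, hw, hw0⟩ := Submodule.exists_mem_ne_zero_of_ne_bot hS.2.1
  have : Countable B := hB
  set word : List (B × ℤ) → M := fun l => l.foldr (fun p x => X.Y p.1 p.2 x) w with hword
  set N := Submodule.span ℂ (Set.range word) with hN
  have hsub : X.IsSub N := by
    intro a n x hx
    induction hx using Submodule.span_induction with
    | zero => rw [map_zero]; exact N.zero_mem
    | add x y _ _ hx hy => rw [map_add]; exact N.add_mem hx hy
    | smul c x _ hx => rw [map_smul]; exact N.smul_mem c hx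
    | mem x hx =>
      obtain ⟨l, rfl⟩ := hx
      have ha : a ∈ Submodule.span ℂ B := hspan ▸ Submodule.mem_top
      induction ha using Submodule.span_induction with
      | zero => simp
      | add a b _ _ ha hb =>
        rw [map_add, Pi.add_apply, LinearMap.add_apply]; exact N.add_mem ha hb
      | smul c a _ ha =>
        rw [map_smul, Pi.smul_apply, LinearMap.smul_apply]; exact N.smul_mem c ha
      | mem a ha => exact Submodule.subset_span ⟨(⟨a, ha⟩, n) :: l, rfl⟩
  have hle : N ≤ S := by
    refine Submodule.span_le.2 ?_
    rintro x ⟨l, rfl⟩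
    induction l with
    | nil => exact hw
    | cons p l ih => exact hS.1 _ _ _ ih
  have hNS : N = S := (hS.2.2 N hle hsub).resolve_left fun h => hw0 <| by
    rw [← Submodule.mem_bot ℂ, ← h]
    exact Submodule.subset_span ⟨[], rfl⟩
  rw [← hNS]
  exact (rank_span_le _).trans (Cardinal.mk_le_aleph0_iff.2 (Set.countable_range word).to_subtype)

/-- Schur's lemma. -/
theorem IsIrredSub.exists_scalar {S : Submodule ℂ M} (hS : X.IsIrredSub S) (f : Module.End ℂ M)
    (hfS : ∀ x ∈ S, f x ∈ S) (hf : ∀ a n, ∀ x ∈ S, f (X.Y a n x) = X.Y a n (f x)) :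
    ∃ c : ℂ, ∀ x ∈ S, f x = c • x := by
  have : Nontrivial S := Submodule.nontrivial_iff_ne_bot.2 hS.2.1
  obtain ⟨c, hc⟩ := spectrum_nonempty_of_rank_le_aleph0 hS.rank_le (f.restrict hfS)
  refine ⟨c, fun x hx => ?_⟩
  set g : Module.End ℂ M := f - c • LinearMap.id with hg
  have hgS : ∀ x ∈ S, g x ∈ S := fun x hx => S.sub_mem (hfS x hx) (S.smul_mem c hx)
  have hgY : ∀ a n, ∀ x ∈ S, g (X.Y a n x) = X.Y a n (g x) := fun a n x hx => by
    simp [hg, hf a n x hx]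
  suffices g x = 0 by simpa [hg, sub_eq_zero] using this
  have hker := hS.2.2 (S ⊓ LinearMap.ker g) inf_le_left fun a n x hx =>
    ⟨hS.1 a n x hx.1, by
      rw [SetLike.mem_coe, LinearMap.mem_ker, hgY a n x hx.1, LinearMap.mem_ker.1 hx.2, map_zero]⟩
  have hrange := hS.2.2 (S.map g) (Submodule.map_le_iff_le_comap.2 hgS) (by
    rintro a n _ ⟨x, hx, rfl⟩
    exact ⟨X.Y a n x, hS.1 a n x hx, hgY a n x hx⟩)
  rcases hker with hker | hker
  · rcases hrange with hrange | hrange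
    · rw [← Submodule.mem_bot ℂ, ← hrange]
      exact Submodule.mem_map_of_mem hx
    · refine absurd ?_ hc
      rw [spectrum.mem_resolventSet_iff, ← IsUnit.neg_iff, neg_sub, Module.End.isUnit_iff]
      constructor
      · rw [injective_iff_map_eq_zero]
        rintro ⟨y, hy⟩ h
        have h1 : g y = 0 := congrArg Subtype.val h
        have h2 : y ∈ S ⊓ LinearMap.ker g := ⟨hy, h1⟩
        rw [hker, Submodule.mem_bot] at h2
        exact Subtype.ext h2
      · rintro ⟨y, hy⟩
        rw [← hrange] at hy
        obtain ⟨z, hz, rfl⟩ := hy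
        exact ⟨⟨z, hz⟩, rfl⟩
  · rw [← hker] at hx
    exact hx.2

/-- `L(0)` and the degree have the same commutator with every mode, so their difference is an
endomorphism, a scalar by Schur's lemma. The grading is therefore the weight decomposition up to a
shift. -/
theorem exists_isLowestWeight {S : Submodule ℂ M} (hS : X.IsIrredSub S) (hG : X.IsNGradableSub S) :
    ∃ h, X.IsLowestWeight S h := by
  obtain ⟨G, hind, hsup, hneg, hact⟩ := hG
  obtain ⟨d, hd⟩ := exists_scalar_of_iSupIndep hind fun n => (n : ℂ)
  have hGS : ∀ n, G n ≤ S := fun n => hsup ▸ le_iSup G n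
  have hdS : ∀ x ∈ S, d x ∈ S := by
    suffices S ≤ S.comap d from this
    conv_lhs => rw [← hsup]
    exact iSup_le fun n x hx => by
      rw [Submodule.mem_comap, hd n x hx]
      exact S.smul_mem _ (hGS n hx)
  obtain ⟨c, hc⟩ := hS.exists_scalar (X.L 0 - d) (fun x hx => S.sub_mem (hS.1 _ _ x hx) (hdS x hx))
    (by
      intro a n x hx
      rw [← hsup] at hx
      induction hx using Submodule.iSup_induction' with
      | zero => simp
      | add x y _ _ hx hy => simp only [map_add, hx, hy]
      | mem k x hx =>
        induction a using A.grade_induction with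
        | h0 => simp
        | hadd a b ha hb => simp only [map_add, Pi.add_apply, LinearMap.add_apply, ha, hb]
        | hmem m a ha =>
          rw [LinearMap.sub_apply, LinearMap.sub_apply, X.L_zero_bracket, A.L0_of_mem ha,
            hd _ _ (hact m n k a ha x hx), hd k x hx, map_smul, map_sub, map_smul,
            Pi.smul_apply, LinearMap.smul_apply]
          push_cast
          module)
  have hwt : ∀ n, G n ≤ X.wt (c + n) := fun n x hx => by
    have h1 := hc x (hGS n hx)
    rw [LinearMap.sub_apply, hd n x hx, sub_eq_iff_eq_add] at h1
    rw [wt, Module.End.mem_eigenspace_iff, h1, add_smul]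
  have hex : ∃ k : ℕ, G k ≠ ⊥ := by
    by_contra hcon
    push Not at hcon
    refine hS.2.1 (hsup ▸ iSup_eq_bot.2 fun n => ?_)
    rcases lt_or_ge n 0 with hn | hn
    · exact hneg n hn
    · obtain ⟨k, rfl⟩ := Int.eq_ofNat_of_zero_le hn
      exact hcon k
  classical
  -- The given grading may begin above degree 0, so the scalar is corrected by the first nonzero
  -- degree.
  refine ⟨c + (Nat.find hex : ℂ), fun h => Nat.find_spec hex ?_, le_antisymm
    (iSup_le fun _ => inf_le_left) ?_⟩
  · exact eq_bot_iff.2 ((le_inf (hGS _) (by simpa using hwt (Nat.find hex))).trans h.le)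
  · conv_lhs => rw [← hsup]
    refine iSup_le fun n => ?_
    by_cases hn : G n = ⊥
    · rw [hn]; exact bot_le
    have hn0 : 0 ≤ n := not_lt.1 fun h => hn (hneg n h)
    obtain ⟨k, rfl⟩ := Int.eq_ofNat_of_zero_le hn0
    obtain ⟨j, rfl⟩ := Nat.exists_eq_add_of_le (Nat.find_min' hex hn)
    refine le_iSup_of_le j (le_inf (hGS _) ?_)
    convert hwt _ using 2
    push_cast
    ring

theorem mem_wt_map {g : M →ₗ[ℂ] M'} (hg : IsHom X X' g) {h : ℂ} {x : M} (hx : x ∈ X.wt h) :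
    g x ∈ X'.wt h := by
  rw [wt, Module.End.mem_eigenspace_iff] at hx ⊢
  rw [L, ← hg, ← map_smul, ← hx]
  rfl

theorem IsIrredSub.map {S : Submodule ℂ M} (hS : X.IsIrredSub S) {g : M →ₗ[ℂ] M'}
    (hg : IsHom X X' g) (h0 : S.map g ≠ ⊥) :
    X'.IsIrredSub (S.map g) ∧ S ⊓ LinearMap.ker g = ⊥ := by
  have hker : S ⊓ LinearMap.ker g = ⊥ := by
    refine (hS.2.2 _ inf_le_left fun a n x hx => ⟨hS.1 a n x hx.1, ?_⟩).resolve_right fun h => h0 ?_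
    · rw [SetLike.mem_coe, LinearMap.mem_ker, hg, LinearMap.mem_ker.1 hx.2, map_zero]
    · rw [eq_bot_iff]
      rintro _ ⟨x, hx, rfl⟩
      rw [SetLike.mem_coe, ← h] at hx
      exact hx.2
  refine ⟨⟨?_, h0, fun N hN hNsub => ?_⟩, hker⟩
  · rintro a n _ ⟨x, hx, rfl⟩
    exact ⟨X.Y a n x, hS.1 a n x hx, hg a n x⟩
  · rcases hS.2.2 (S ⊓ N.comap g) inf_le_left (fun a n x hx => ⟨hS.1 a n x hx.1, by
      rw [SetLike.mem_coe, Submodule.mem_comap, hg]; exact hNsub a n _ hx.2⟩) with h | h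
    · left
      rw [eq_bot_iff]
      intro y hy
      obtain ⟨x, hx, rfl⟩ := hN hy
      have : x ∈ S ⊓ N.comap g := ⟨hx, hy⟩
      rw [h, Submodule.mem_bot] at this
      rw [this, map_zero]
      exact Submodule.zero_mem _
    · right
      refine le_antisymm hN ?_
      rintro _ ⟨x, hx, rfl⟩
      rw [SetLike.mem_coe, ← h] at hx
      exact hx.2

theorem IsLowestWeight.map {S : Submodule ℂ M} {c : ℂ} (hc : X.IsLowestWeight S c)
    {g : M →ₗ[ℂ] M'} (hg : IsHom X X' g) (hker : S ⊓ LinearMap.ker g = ⊥) :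
    X'.IsLowestWeight (S.map g) c := by
  refine ⟨fun h => hc.1 ?_, le_antisymm (iSup_le fun _ => inf_le_left) ?_⟩
  · rw [eq_bot_iff, ← hker]
    rintro x ⟨hx, hx'⟩
    refine ⟨hx, ?_⟩
    rw [SetLike.mem_coe, LinearMap.mem_ker, ← Submodule.mem_bot ℂ, ← h]
    exact ⟨Submodule.mem_map_of_mem hx, mem_wt_map hg hx'⟩
  · conv_lhs => rw [← hc.2]
    rw [Submodule.map_iSup]
    refine iSup_mono fun n => ?_
    rintro _ ⟨x, hx, rfl⟩
    exact ⟨Submodule.mem_map_of_mem hx.1, mem_wt_map hg hx.2⟩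

theorem IsLowestWeight.exists_nat {S : Submodule ℂ M} {c h : ℂ} (hc : X.IsLowestWeight S c)
    (hh : S ⊓ X.wt h ≠ ⊥) : ∃ n : ℕ, h = c + n := by
  by_contra hcon
  push Not at hcon
  refine hh ?_
  have hd := (X.L 0).eigenspaces_iSupIndep h
  rw [eq_bot_iff, ← hd.eq_bot]
  refine le_inf inf_le_right (inf_le_left.trans ?_)
  conv_lhs => rw [← hc.2]
  exact iSup_le fun n => inf_le_right.trans
    (le_iSup₂_of_le (f := fun k (_ : k ≠ h) => (X.L 0).eigenspace k) (c + n) (hcon n).symm le_rfl)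

theorem IsLowestWeight.unique {S : Submodule ℂ M} {c c' : ℂ} (hc : X.IsLowestWeight S c)
    (hc' : X.IsLowestWeight S c') : c = c' := by
  obtain ⟨n, hn⟩ := hc.exists_nat hc'.1
  obtain ⟨m, hm⟩ := hc'.exists_nat hc.1
  have h : ((n + m : ℕ) : ℂ) = 0 := by
    push_cast
    linear_combination hn.symm + hm.symm
  have h' : n + m = 0 := by exact_mod_cast h
  rw [hn, show n = 0 by omega]
  simp

theorem isotypic_map {g : M →ₗ[ℂ] M'} (hg : IsHom X X' g) (c : ℂ) :
    (X.isotypic c).map g ≤ X'.isotypic c := by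
  rw [Submodule.map_le_iff_le_comap]
  refine sSup_le fun S hS => Submodule.map_le_iff_le_comap.1 ?_
  by_cases h0 : S.map g = ⊥
  · rw [h0]; exact bot_le
  · have h := hS.1.map hg h0
    exact le_sSup ⟨h.1, hS.2.map hg h.2⟩

/-- Complete reducibility of an `ℕ`-gradable weak module over a rational vertex operator algebra:
there is an endomorphism `θ` that acts on each irreducible submodule as its lowest weight. -/
theorem exists_lowestWeightOp (hA : A.IsRational) (hX : X.IsNGradable) :
    ∃ θ : Module.End ℂ M, IsHom X X θ ∧ (⨆ k : ℕ, (X.L 0 - θ).eigenspace k = ⊤) ∧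
      (∀ c, X.isotypic c ≤ θ.eigenspace c) ∧ (⨆ c, X.isotypic c = ⊤) ∧ (⨆ h, X.wt h = ⊤) ∧
      ∀ N, X.IsSub N → N ≤ ⨆ (k : ℤ) (_ : k ≠ 0), (X.L 0 - θ).eigenspace k → N = ⊥ := by
  classical
  obtain ⟨ι, S, hS, hind, hsup⟩ := hA M X hX
  choose c hc using fun i => exists_isLowestWeight (hS i).1 (hS i).2
  obtain ⟨θ, hθ⟩ := exists_scalar_of_iSupIndep hind c
  -- These are the projections onto the summands of the decomposition.
  choose p hp using fun i => exists_scalar_of_iSupIndep hind fun j => if j = i then (1 : ℂ) else 0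
  have ind : ∀ {q : M → Prop}, q 0 → (∀ x y, q x → q y → q (x + y)) → (∀ i, ∀ x ∈ S i, q x) →
      ∀ x, q x := by
    intro q h0 hadd hmem x
    have hx : x ∈ ⨆ i, S i := hsup ▸ Submodule.mem_top
    induction hx using Submodule.iSup_induction' with
    | zero => exact h0
    | add x y _ _ hx hy => exact hadd x y hx hy
    | mem i x hx => exact hmem i x hx
  have hθhom : IsHom X X θ := fun a n => ind (by simp) (fun x y hx hy => by simp [hx, hy])
    fun i x hx => by rw [hθ i x hx, hθ i _ ((hS i).1.1 a n x hx), map_smul]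
  have hphom : ∀ i, IsHom X X (p i) := fun i a n => ind (by simp)
    (fun x y hx hy => by simp [hx, hy])
    fun j x hx => by rw [hp i j x hx, hp i j _ ((hS j).1.1 a n x hx), map_smul]
  have hpmem : ∀ i x, p i x ∈ S i := fun i => ind (by simp)
    (fun x y hx hy => by rw [map_add]; exact (S i).add_mem hx hy)
    fun j x hx => by
      rw [hp i j x hx]
      split_ifs with h
      · subst h; exact (S j).smul_mem _ hx
      · simp
  have hpθ : ∀ i x, p i (θ x) = θ (p i x) := fun i => ind (by simp)
    (fun x y hx hy => by simp [hx, hy])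
    fun j x hx => by rw [hθ j x hx, map_smul, hp i j x hx, map_smul, hθ j x hx, smul_comm]
  have hsep : ∀ x, (∀ i, p i x = 0) → x = 0 := by
    intro x hx
    have hx' : x ∈ ⨆ i, S i := hsup ▸ Submodule.mem_top
    obtain ⟨y, hy, rfl⟩ := (Submodule.mem_iSup_iff_exists_finsupp _ _).1 hx'
    refine Finset.sum_eq_zero fun i hi => ?_
    have h := hx i
    rw [Finsupp.sum, map_sum, Finset.sum_eq_single i] at h
    · rwa [hp i i _ (hy i), if_pos rfl, one_smul] at h
    · intro j _ hj
      rw [hp i j _ (hy j), if_neg hj, zero_smul]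
    · exact fun h => absurd hi h
  -- An irreducible submodule need not be one of the summands. Its projection to a summand is zero
  -- or an isomorphism onto it, so only summands with the same lowest weight are involved.
  have hirr : ∀ c', ∀ T, X.IsIrredSub T → X.IsLowestWeight T c' → T ≤ θ.eigenspace c' := by
    intro c' T hT hc' x hx
    rw [Module.End.mem_eigenspace_iff, ← sub_eq_zero]
    refine hsep _ fun i => ?_
    rw [map_sub, hpθ, hθ i _ (hpmem i x), map_smul, ← sub_smul]
    by_cases h0 : T.map (p i) = ⊥
    · have : p i x ∈ T.map (p i) := Submodule.mem_map_of_mem hx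
      rw [h0, Submodule.mem_bot] at this
      rw [this, smul_zero]
    · have h1 := hT.map (hphom i) h0
      have h2 := hc'.map (hphom i) h1.2
      have h3 : T.map (p i) = S i := ((hS i).1.2.2 _ (Submodule.map_le_iff_le_comap.2
        fun x _ => hpmem i x) h1.1.1).resolve_left h0
      rw [h3] at h2
      rw [(hc i).unique h2, sub_self, zero_smul]
  refine ⟨θ, hθhom, ?_, fun c' => sSup_le fun T hT => hirr c' T hT.1 hT.2, ?_, ?_, ?_⟩
  · rw [← top_le_iff, ← hsup]
    refine iSup_le fun i => ?_
    conv_lhs => rw [← (hc i).2]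
    refine iSup_mono fun n x hx => ?_
    rw [Module.End.mem_eigenspace_iff, LinearMap.sub_apply, Module.End.mem_eigenspace_iff.1 hx.2,
      hθ i x hx.1, ← sub_smul, add_sub_cancel_left]
  · rw [← top_le_iff, ← hsup]
    exact iSup_le fun i => le_iSup_of_le (c i) (le_sSup ⟨(hS i).1, hc i⟩)
  · rw [← top_le_iff, ← hsup]
    refine iSup_le fun i => ?_
    conv_lhs => rw [← (hc i).2]
    exact iSup_le fun n => inf_le_right.trans (le_iSup X.wt _)
  -- A nonzero projection of `N` would be a whole summand, whose lowest weight vectors have degree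
  -- 0, while projections preserve the nonzero degrees in which `N` lies.
  · intro N hN hle
    rw [eq_bot_iff]
    intro x hx
    refine (Submodule.mem_bot ℂ).2 (hsep x fun i => ?_)
    have h1 : N.map (p i) = ⊥ := by
      refine ((hS i).1.2.2 (N.map (p i)) (Submodule.map_le_iff_le_comap.2
        fun x _ => hpmem i x) ?_).resolve_right fun h => (hc i).1 ?_
      · rintro a n _ ⟨y, hy, rfl⟩
        exact ⟨X.Y a n y, hN a n y hy, hphom i a n y⟩
      · have hd := iSupIndep_eigenspace_int (X.L 0 - θ) 0
        rw [eq_bot_iff, ← hd.eq_bot]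
        rintro y ⟨hy, hy'⟩
        constructor
        · rw [SetLike.mem_coe, Module.End.mem_eigenspace_iff, LinearMap.sub_apply,
            Module.End.mem_eigenspace_iff.1 hy', hθ i y hy]
          simp
        · rw [SetLike.mem_coe, ← h] at hy
          refine (Submodule.map_le_iff_le_comap.2 (hle.trans ?_) :
            N.map (p i) ≤ ⨆ (k : ℤ) (_ : k ≠ 0), (X.L 0 - θ).eigenspace k) hy
          refine iSup₂_le fun k hk z hz => ?_
          refine (le_iSup₂_of_le (f := fun (k : ℤ) (_ : k ≠ 0) => (X.L 0 - θ).eigenspace k)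
            k hk le_rfl) ?_
          rw [Module.End.mem_eigenspace_iff, LinearMap.sub_apply] at hz ⊢
          rw [← hpθ, ← map_smul, ← hz, map_sub, L, hphom]
    have h2 : p i x ∈ N.map (p i) := Submodule.mem_map_of_mem hx
    rwa [h1, Submodule.mem_bot] at h2

end WeakModule

end

end VOA

/-! ### Sequences of bounded degree; finiteness of the set of lowest weights. -/

namespace VOA

set_option linter.unusedSectionVars false

noncomputable section

variable {V : Type u} [AddCommGroup V] [Module ℂ V] {A : VertexOperatorAlgebra V}

theorem eigenspace_int_of_neg {M : Type*} [AddCommGroup M] [Module ℂ M] {d : Module.End ℂ M}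
    (h : ⨆ k : ℕ, d.eigenspace k = ⊤) {k : ℤ} (hk : k < 0) : d.eigenspace (k : ℂ) = ⊥ := by
  have hd := iSupIndep_eigenspace_int d k
  have h1 : ⨆ (j : ℤ) (_ : j ≠ k), d.eigenspace (j : ℂ) = ⊤ := by
    rw [← top_le_iff, ← h]
    refine iSup_le fun j => ?_
    exact (le_of_eq (by simp)).trans (le_iSup₂_of_le
      (f := fun (j : ℤ) (_ : j ≠ k) => d.eigenspace (j : ℂ)) (j : ℤ) (by omega) le_rfl)
  rw [h1, disjoint_top] at hd
  exact hd

namespace WeakModule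

variable {M : Type u} [AddCommGroup M] [Module ℂ M] {X : WeakModule A M}

theorem IsDegreeOp.act_mem {d : Module.End ℂ M} (hd : X.IsDegreeOp d) {m : ℤ} {a : V}
    (ha : a ∈ A.grade m) (n : ℤ) {k : ℤ} {w : M} (hw : w ∈ d.eigenspace (k : ℂ)) :
    X.Y a n w ∈ d.eigenspace ((m - n - 1 + k : ℤ) : ℂ) := by
  rw [Module.End.mem_eigenspace_iff] at hw ⊢
  rw [hd.2, hw, A.L0_of_mem ha, map_smul, map_smul, Pi.smul_apply, LinearMap.smul_apply]
  push_cast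
  module

theorem IsDegreeOp.isNGradable {d : Module.End ℂ M} (hd : X.IsDegreeOp d) : X.IsNGradable :=
  ⟨fun k => d.eigenspace (k : ℂ), iSupIndep_eigenspace_int d, iSup_int_eq_top_of_nat hd.1,
    fun _ hn => eigenspace_int_of_neg hd.1 hn, fun _ n _ _ ha _ hw => hd.act_mem ha n hw⟩

theorem isDegreeOp_of_hom {θ : Module.End ℂ M} (hθ : IsHom X X θ)
    (h : ⨆ k : ℕ, (X.L 0 - θ).eigenspace k = ⊤) : X.IsDegreeOp (X.L 0 - θ) :=
  ⟨h, fun a n w => by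
    rw [LinearMap.sub_apply, LinearMap.sub_apply, X.L_zero_bracket, hθ, map_sub]
    abel⟩

section BoundedSequences

variable (d : Module.End ℂ M)

/-- The space of sequences in a graded space that are of bounded degree. -/
def boundedSeq : Submodule ℂ (ℕ → M) :=
  ⨆ k : ℕ, Module.End.eigenspace (d.compLeft ℕ) (k : ℂ)

theorem mem_eigenspace_compLeft {c : ℂ} {f : ℕ → M} :
    f ∈ Module.End.eigenspace (d.compLeft ℕ) c ↔ ∀ j, f j ∈ d.eigenspace c := by
  simp only [Module.End.mem_eigenspace_iff]
  exact funext_iff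

variable {d}

theorem boundedSeq_induction {p : (ℕ → M) → Prop} (h0 : p 0)
    (hadd : ∀ f g, p f → p g → p (f + g))
    (hmem : ∀ (k : ℕ) (f : ℕ → M), (∀ j, f j ∈ d.eigenspace (k : ℂ)) → p f) (f : ℕ → M)
    (hf : f ∈ boundedSeq d) : p f := by
  rw [boundedSeq] at hf
  induction hf using Submodule.iSup_induction' with
  | zero => exact h0
  | add f g _ _ hf hg => exact hadd f g hf hg
  | mem k f hf => exact hmem k f ((mem_eigenspace_compLeft d).1 hf)

theorem mem_boundedSeq_of_forall {k : ℤ} (hd : ⨆ k : ℕ, d.eigenspace k = ⊤) {f : ℕ → M}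
    (hf : ∀ j, f j ∈ d.eigenspace (k : ℂ)) : f ∈ boundedSeq d := by
  rcases lt_or_ge k 0 with hk | hk
  · have : f = 0 := funext fun j => by
      have := hf j
      rwa [eigenspace_int_of_neg hd hk, Submodule.mem_bot] at this
    rw [this]
    exact Submodule.zero_mem _
  · obtain ⟨k, rfl⟩ := Int.eq_ofNat_of_zero_le hk
    exact Submodule.mem_iSup_of_mem k ((mem_eigenspace_compLeft d).2 (by simpa using hf))

theorem act_mem_boundedSeq (hd : X.IsDegreeOp d) (a : V) (n : ℤ) :
    ∀ f ∈ boundedSeq d, (X.Y a n).compLeft ℕ f ∈ boundedSeq d := by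
  refine boundedSeq_induction ?_ (fun f g hf hg => ?_) fun k f hf => ?_
  · rw [map_zero]; exact Submodule.zero_mem _
  · rw [map_add]; exact Submodule.add_mem _ hf hg
  · induction a using A.grade_induction with
    | h0 =>
      have : ((X.Y 0 n).compLeft ℕ) f = 0 := funext fun j => by simp
      rw [this]
      exact Submodule.zero_mem _
    | hadd a b ha hb =>
      have : ((X.Y (a + b) n).compLeft ℕ) f
          = (X.Y a n).compLeft ℕ f + (X.Y b n).compLeft ℕ f := funext fun j => by simp
      rw [this]
      exact Submodule.add_mem _ ha hb
    | hmem m a ha =>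
      exact mem_boundedSeq_of_forall hd.1 fun j =>
        hd.act_mem ha n (k := k) (by simpa using hf j)

/-- Bounded degree gives one truncation bound for all coordinates at once, which arbitrary sequences
need not have. This is why the full product of copies of the module is not used. -/
theorem boundedSeq_truncation (hd : X.IsDegreeOp d) (a : V) :
    ∀ f ∈ boundedSeq d, ∃ N : ℤ, ∀ n ≥ N, ∀ j, X.Y a n (f j) = 0 := by
  refine boundedSeq_induction ?_ (fun f g hf hg => ?_) fun k f hf => ?_
  · exact ⟨0, fun n _ j => by simp⟩
  · obtain ⟨N, hN⟩ := hf
    obtain ⟨K, hK⟩ := hg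
    exact ⟨max N K, fun n hn j => by
      rw [Pi.add_apply, map_add, hN n (le_of_max_le_left hn), hK n (le_of_max_le_right hn),
        add_zero]⟩
  · induction a using A.grade_induction with
    | h0 => exact ⟨0, fun n _ j => by simp⟩
    | hadd a b ha hb =>
      obtain ⟨N, hN⟩ := ha
      obtain ⟨K, hK⟩ := hb
      exact ⟨max N K, fun n hn j => by
        rw [map_add, Pi.add_apply, LinearMap.add_apply, hN n (le_of_max_le_left hn),
          hK n (le_of_max_le_right hn), add_zero]⟩
    | hmem m a ha =>
      refine ⟨m + k, fun n hn j => ?_⟩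
      have h := hd.act_mem ha n (k := k) (w := f j) (by simpa using hf j)
      rwa [eigenspace_int_of_neg hd.1 (by omega), Submodule.mem_bot] at h

/-- The weak module of sequences of bounded degree in a graded weak module. -/
def boundedSeqModule (hd : X.IsDegreeOp d) : WeakModule A (boundedSeq d) where
  Y :=
    { toFun a n := ((X.Y a n).compLeft ℕ).restrict (act_mem_boundedSeq hd a n)
      map_add' a b := by
        funext n
        refine LinearMap.ext fun f => Subtype.ext (funext fun j => ?_)
        simp
      map_smul' c a := by
        funext n
        refine LinearMap.ext fun f => Subtype.ext (funext fun j => ?_)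
        simp }
  vacuum_act n w := by
    refine Subtype.ext (funext fun j => ?_)
    change X.Y A.vacuum n (w.1 j) = _
    rw [X.vacuum_act]
    split_ifs <;> rfl
  derivative a n := by
    refine LinearMap.ext fun w => Subtype.ext (funext fun j => ?_)
    change X.Y (A.Y A.conformal 0 a) n (w.1 j) = _
    rw [X.derivative]
    rfl
  truncation a w := by
    obtain ⟨N, hN⟩ := boundedSeq_truncation hd a _ w.2
    exact ⟨N, fun n hn => Subtype.ext (funext fun j => hN n hn j)⟩
  jacobi a b w l m n := by
    have ez : ∀ (a b : V) (w : boundedSeq d) (m n : ℤ), EventuallyZero fun i : ℕ =>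
        ((X.Y a (m - i)).compLeft ℕ).restrict (act_mem_boundedSeq hd a (m - i))
          (((X.Y b (n + i)).compLeft ℕ).restrict (act_mem_boundedSeq hd b (n + i)) w) := by
      intro a b w m n
      obtain ⟨N, hN⟩ := boundedSeq_truncation hd b _ w.2
      refine ⟨(N - n).toNat, fun i hi => Subtype.ext (funext fun j => ?_)⟩
      change X.Y a (m - i) (X.Y b (n + i) (w.1 j)) = 0
      rw [hN _ (by omega), map_zero]
    have ez' : EventuallyZero fun i : ℕ =>
        ((X.Y (A.Y a (l + i) b) (m + n - i)).compLeft ℕ).restrict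
          (act_mem_boundedSeq hd (A.Y a (l + i) b) (m + n - i)) w := by
      obtain ⟨N, hN⟩ := A.eventuallyZero a b l
      refine ⟨N, fun i hi => Subtype.ext (funext fun j => ?_)⟩
      change X.Y (A.Y a (l + i) b) (m + n - i) (w.1 j) = 0
      have := hN i hi
      simp only at this
      rw [this]
      simp
    refine Subtype.ext (funext fun j => ?_)
    have h := map_jacobiCoeff (l := l) (m := m) (LinearMap.proj j ∘ₗ (boundedSeq d).subtype)
      (ez a b w (m + l) n) (ez b a w (n + l) m) ez'
    exact h.trans (X.jacobi a b (w.1 j) l m n)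

theorem compLeft_mem_boundedSeq (d : Module.End ℂ M) :
    ∀ f ∈ boundedSeq d, d.compLeft ℕ f ∈ boundedSeq d := by
  refine boundedSeq_induction ?_ (fun f g hf hg => ?_) fun k f hf => ?_
  · rw [map_zero]; exact Submodule.zero_mem _
  · rw [map_add]; exact Submodule.add_mem _ hf hg
  · have h := (mem_eigenspace_compLeft d).2 hf
    rw [Module.End.mem_eigenspace_iff.1 h]
    exact Submodule.smul_mem _ _ (Submodule.mem_iSup_of_mem k h)

theorem boundedSeqModule_isDegreeOp (hd : X.IsDegreeOp d) : (boundedSeqModule hd).IsDegreeOp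
    ((d.compLeft ℕ).restrict (compLeft_mem_boundedSeq d)) := by
  refine ⟨top_le_iff.1 ?_, fun a n w => Subtype.ext (funext fun j => hd.2 a n (w.1 j))⟩
  rintro ⟨f, hf⟩ -
  have key : ∀ f (hf : f ∈ ⨆ k : ℕ, Module.End.eigenspace (d.compLeft ℕ) (k : ℂ)),
      (⟨f, hf⟩ : boundedSeq d) ∈ ⨆ k : ℕ,
        Module.End.eigenspace ((d.compLeft ℕ).restrict (compLeft_mem_boundedSeq d)) (k : ℂ) := by
    intro f hf
    induction hf using Submodule.iSup_induction' with
    | zero => exact Submodule.zero_mem _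
    | add f g _ _ hf hg => exact Submodule.add_mem _ hf hg
    | mem k f hf =>
      refine Submodule.mem_iSup_of_mem k ?_
      rw [Module.End.mem_eigenspace_iff] at hf ⊢
      exact Subtype.ext hf
  exact key f hf

end BoundedSequences

/-- Only finitely many lowest weights occur in an `ℕ`-gradable weak module over a rational vertex
operator algebra. -/
theorem finite_isotypic (hA : A.IsRational) (hX : X.IsNGradable) :
    {c : ℂ | X.isotypic c ≠ ⊥}.Finite := by
  obtain ⟨θ, hθ, hnat, hiso, -, -, -⟩ := exists_lowestWeightOp hA hX
  have hd := isDegreeOp_of_hom hθ hnat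
  set d := X.L 0 - θ with hdef
  by_contra hinf
  have hinf' : {c : ℂ | X.isotypic c ≠ ⊥}.Infinite := hinf
  set c := hinf'.natEmbedding with hc
  -- From infinitely many distinct lowest weights one picks lowest weight vectors. All have degree
  -- 0, so they form a sequence of bounded degree.
  have hex : ∀ j, ∃ w : M, w ≠ 0 ∧ w ∈ X.wt (c j) ∧ w ∈ d.eigenspace (0 : ℂ) := by
    intro j
    have h1 : ∃ S, X.IsIrredSub S ∧ X.IsLowestWeight S (c j) := by
      by_contra hcon
      push Not at hcon
      refine (c j).2 (eq_bot_iff.2 (sSup_le fun S hS => absurd hS.2 (hcon S hS.1)))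
    obtain ⟨S, hS, hS'⟩ := h1
    obtain ⟨w, hw, hw0⟩ := Submodule.exists_mem_ne_zero_of_ne_bot hS'.1
    refine ⟨w, hw0, hw.2, ?_⟩
    have h2 : S ≤ X.isotypic (c j) := le_sSup ⟨hS, hS'⟩
    rw [Module.End.mem_eigenspace_iff, hdef, LinearMap.sub_apply,
      Module.End.mem_eigenspace_iff.1 hw.2, Module.End.mem_eigenspace_iff.1 (hiso _ (h2 hw.1))]
    simp
  choose w hw0 hwt hwd using hex
  have hwB : w ∈ boundedSeq d := mem_boundedSeq_of_forall (k := 0) hd.1 (by simpa using hwd)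
  obtain ⟨-, -, -, -, -, htop, -⟩ :=
    exists_lowestWeightOp hA (boundedSeqModule_isDegreeOp hd).isNGradable
  -- By rationality `L(0)` is diagonalizable on the sequence module, so the sequence is a finite sum
  -- of eigenvectors. Reading off coordinates puts every one of the distinct weights in a single
  -- finite set.
  have hmem : (⟨w, hwB⟩ : boundedSeq d) ∈ ⨆ h, (boundedSeqModule hd).wt h :=
    htop ▸ Submodule.mem_top
  obtain ⟨y, hy, hsum⟩ := (Submodule.mem_iSup_iff_exists_finsupp _ _).1 hmem
  refine Set.infinite_of_injective_forall_mem (f := fun j => ((c j : ℂ)))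
    (Subtype.val_injective.comp c.injective) (s := (y.support : Set ℂ)) (fun j => ?_)
    y.support.finite_toSet
  by_contra hj
  have h1 : w j = ∑ h ∈ y.support, (y h).1 j := by
    have := congrArg (LinearMap.proj j ∘ₗ (boundedSeq d).subtype) hsum
    rw [Finsupp.sum, map_sum] at this
    exact this.symm
  have hyj : ∀ h, (y h).1 j ∈ X.wt h := fun h => by
    have := Module.End.mem_eigenspace_iff.1 (hy h)
    rw [wt, Module.End.mem_eigenspace_iff]
    exact congrFun (congrArg Subtype.val this) j
  have hdis := (X.L 0).eigenspaces_iSupIndep (c j : ℂ)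
  refine hw0 j (Submodule.disjoint_def.1 hdis _ (hwt j) ?_)
  rw [h1]
  refine Submodule.sum_mem _ fun h hh => ?_
  refine (le_iSup₂_of_le (f := fun k (_ : k ≠ (c j : ℂ)) => (X.L 0).eigenspace k) h
    (fun e => hj (e ▸ hh)) le_rfl) (hyj h)

theorem act_mem_wt {m : ℤ} {a : V} (ha : a ∈ A.grade m) (n : ℤ) {h : ℂ} {w : M} (hw : w ∈ X.wt h) :
    X.Y a n w ∈ X.wt (h + (m - n - 1 : ℤ)) := by
  rw [wt, Module.End.mem_eigenspace_iff] at hw ⊢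
  rw [L_zero_bracket, hw, A.L0_of_mem ha, map_smul, map_smul, Pi.smul_apply, LinearMap.smul_apply]
  push_cast
  module

/-- Objects of `𝒞₀` are `ℕ`-gradable. -/
theorem InC0.isNGradable (hX : X.InC0) : X.IsNGradable := by
  -- In each coset of ℤ in ℂ one chooses a point below all occurring weights. Modes shift weights by
  -- integers and do not change this point, so weight minus base point is a degree operator.
  have hrep : ∃ base : ℂ → ℂ, (∀ (h : ℂ) (j : ℤ), base (h + j) = base h) ∧
      ∀ h, X.wt h ≠ ⊥ → ∃ k : ℕ, h = base h + k := by
    choose N hN using hX.2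
    set Z := AddSubgroup.zmultiples (1 : ℂ)
    set r : ℂ → ℂ := fun h => (QuotientAddGroup.mk h : ℂ ⧸ Z).out with hr
    have hr1 : ∀ h, ∃ j : ℤ, h = r h + j := by
      intro h
      have h1 : (QuotientAddGroup.mk (r h) : ℂ ⧸ Z) = QuotientAddGroup.mk h :=
        Quotient.out_eq' _
      obtain ⟨j, hj⟩ := AddSubgroup.mem_zmultiples_iff.1 (QuotientAddGroup.eq.1 h1)
      refine ⟨j, ?_⟩
      rw [zsmul_one] at hj
      rw [hj]
      ring
    have hr2 : ∀ (h : ℂ) (j : ℤ), r (h + j) = r h := by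
      intro h j
      have : (QuotientAddGroup.mk (h + j) : ℂ ⧸ Z) = QuotientAddGroup.mk h := by
        rw [QuotientAddGroup.eq]
        exact AddSubgroup.mem_zmultiples_iff.2 ⟨-j, by rw [zsmul_one]; push_cast; ring⟩
      rw [hr]
      simp only [this]
    refine ⟨fun h => r h + N (r h), fun h j => by simp only [hr2], fun h hh => ?_⟩
    obtain ⟨j, hj⟩ := hr1 h
    have hjN : N (r h) ≤ j := by
      by_contra hlt
      have := hN (r h) j (not_le.1 hlt)
      rw [← hj] at this
      exact hh this
    obtain ⟨k, hk⟩ := Int.eq_ofNat_of_zero_le (sub_nonneg.2 hjN)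
    refine ⟨k, ?_⟩
    have hk' : (j : ℂ) - N (r h) = k := by exact_mod_cast hk
    rw [← hk']
    linear_combination hj
  obtain ⟨base, hb1, hb2⟩ := hrep
  obtain ⟨d, hd⟩ := exists_scalar_of_iSupIndep (X.L 0).eigenspaces_iSupIndep fun h => h - base h
  refine IsDegreeOp.isNGradable (d := d) ⟨?_, fun a n w => ?_⟩
  · rw [← top_le_iff, ← hX.1]
    refine iSup_le fun h => ?_
    by_cases hh : X.wt h = ⊥
    · rw [hh]; exact bot_le
    · obtain ⟨k, hk⟩ := hb2 h hh
      refine le_iSup_of_le k fun x hx => ?_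
      rw [Module.End.mem_eigenspace_iff, hd h x hx]
      congr 1
      linear_combination hk
  · have hw : w ∈ ⨆ h, X.wt h := hX.1 ▸ Submodule.mem_top
    induction hw using Submodule.iSup_induction' with
    | zero => simp
    | add x y _ _ hx hy => simp only [map_add, hx, hy, smul_add]; abel
    | mem h x hx =>
      induction a using A.grade_induction with
      | h0 => simp
      | hadd a b ha hb =>
        simp only [map_add, Pi.add_apply, LinearMap.add_apply, ha, hb, smul_add]; abel
      | hmem m a ha =>
        rw [hd _ _ (act_mem_wt ha n hx), hd h x hx, hb1, A.L0_of_mem ha, map_smul, map_smul,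
          Pi.smul_apply, LinearMap.smul_apply]
        push_cast
        module

/-- For irreducible objects of 𝒞₀ the default value 0 in the definition plays no role. -/
theorem isLowestWeight_lowestWeight (hX : X.InC0) (hI : X.IsIrreducible) :
    X.IsLowestWeight ⊤ X.lowestWeight := by
  have h := exists_isLowestWeight hI hX.isNGradable
  rw [lowestWeight, dif_pos h]
  exact h.choose_spec

theorem iSup_deg (hX : X.InC0) (hI : X.IsIrreducible) : ⨆ n, X.deg n = ⊤ := by
  have h := (isLowestWeight_lowestWeight hX hI).2
  simp only [top_inf_eq] at h
  exact h

/-! ### Isotypic components and their projections. -/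

section Isotypic

/-- The components lie in distinct eigenspaces of `θ`, which gives independence; complete
reducibility gives spanning. -/
theorem isInternal_isotypic (hA : A.IsRational) (hX : X.IsNGradable) :
    DirectSum.IsInternal X.isotypic := by
  obtain ⟨θ, -, -, hiso, htop, -, -⟩ := exists_lowestWeightOp hA hX
  exact DirectSum.isInternal_submodule_of_iSupIndep_of_iSup_eq_top
    (θ.eigenspaces_iSupIndep.mono hiso) htop

theorem isotypicProj_apply_of_mem (h : DirectSum.IsInternal X.isotypic) {c : ℂ} {x : M} (hx : x ∈ X.isotypic c) :
    X.isotypicProj c x = x := by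
  have e : Function.Bijective (DirectSum.coeLinearMap X.isotypic) := h
  unfold isotypicProj
  rw [dif_pos e]
  set E := LinearEquiv.ofBijective (DirectSum.coeLinearMap X.isotypic) e
  have h1 : E.symm x = DirectSum.lof ℂ ℂ (fun c => X.isotypic c) c ⟨x, hx⟩ := by
    rw [LinearEquiv.symm_apply_eq]
    exact (DirectSum.coeLinearMap_lof X.isotypic c ⟨x, hx⟩).symm.trans
      (LinearEquiv.ofBijective_apply (hf := e) _ _).symm
  rw [LinearMap.comp_apply, LinearMap.comp_apply, LinearEquiv.coe_coe, h1,
    DirectSum.component.lof_self]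
  rfl

theorem isotypicProj_apply_of_ne (h : DirectSum.IsInternal X.isotypic) {c c' : ℂ} (hc : c' ≠ c) {x : M} (hx : x ∈ X.isotypic c') :
    X.isotypicProj c x = 0 := by
  have e : Function.Bijective (DirectSum.coeLinearMap X.isotypic) := h
  unfold isotypicProj
  rw [dif_pos e]
  set E := LinearEquiv.ofBijective (DirectSum.coeLinearMap X.isotypic) e
  have h1 : E.symm x = DirectSum.lof ℂ ℂ (fun c => X.isotypic c) c' ⟨x, hx⟩ := by
    rw [LinearEquiv.symm_apply_eq]
    exact (DirectSum.coeLinearMap_lof X.isotypic c' ⟨x, hx⟩).symm.trans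
      (LinearEquiv.ofBijective_apply (hf := e) _ _).symm
  rw [LinearMap.comp_apply, LinearMap.comp_apply, LinearEquiv.coe_coe, h1,
    DirectSum.component.of, dif_neg hc]
  rfl

theorem isotypic_induction (h : DirectSum.IsInternal X.isotypic) {p : M → Prop} (h0 : p 0) (hadd : ∀ x y, p x → p y → p (x + y))
    (hmem : ∀ c, ∀ x ∈ X.isotypic c, p x) (x : M) : p x := by
  have hx : x ∈ ⨆ c, X.isotypic c := h.submodule_iSup_eq_top ▸ Submodule.mem_top
  induction hx using Submodule.iSup_induction' with
  | zero => exact h0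
  | add x y _ _ hx hy => exact hadd x y hx hy
  | mem c x hx => exact hmem c x hx

theorem isotypicProj_mem (h : DirectSum.IsInternal X.isotypic) (c : ℂ) (x : M) : X.isotypicProj c x ∈ X.isotypic c := by
  induction x using isotypic_induction h with
  | h0 => rw [map_zero]; exact Submodule.zero_mem _
  | hadd x y hx hy => rw [map_add]; exact Submodule.add_mem _ hx hy
  | hmem c' x hx =>
    rcases eq_or_ne c' c with rfl | hc
    · rwa [isotypicProj_apply_of_mem h hx]
    · rw [isotypicProj_apply_of_ne h hc hx]; exact Submodule.zero_mem _

/-- Homomorphisms commute with the projections to the isotypic components. -/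
theorem isotypicProj_hom (h : DirectSum.IsInternal X.isotypic) {M' : Type u} [AddCommGroup M'] [Module ℂ M'] {X' : WeakModule A M'}
    (h' : DirectSum.IsInternal X'.isotypic) {g : M →ₗ[ℂ] M'} (hg : IsHom X X' g) (c : ℂ) (x : M) :
    g (X.isotypicProj c x) = X'.isotypicProj c (g x) := by
  induction x using isotypic_induction h with
  | h0 => simp only [map_zero]
  | hadd x y hx hy => simp only [map_add, hx, hy]
  | hmem c' x hx =>
    have hgx := isotypic_map hg c' (Submodule.mem_map_of_mem hx)
    rcases eq_or_ne c' c with rfl | hc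
    · rw [isotypicProj_apply_of_mem h hx, isotypicProj_apply_of_mem h' hgx]
    · rw [isotypicProj_apply_of_ne h hc hx, isotypicProj_apply_of_ne h' hc hgx, map_zero]

theorem isotypicProj_Y (h : DirectSum.IsInternal X.isotypic) (c : ℂ) (a : V) (n : ℤ) (x : M) :
    X.isotypicProj c (X.Y a n x) = X.Y a n (X.isotypicProj c x) := by
  have hsub : ∀ c, X.IsSub (X.isotypic c) := by
    intro c a n
    suffices X.isotypic c ≤ (X.isotypic c).comap (X.Y a n) from this
    exact sSup_le fun S hS x hx =>
      (le_sSup hS : S ≤ X.isotypic c) (hS.1.1 a n x hx)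
  induction x using isotypic_induction h with
  | h0 => simp only [map_zero]
  | hadd x y hx hy => simp only [map_add, hx, hy]
  | hmem c' x hx =>
    rcases eq_or_ne c' c with rfl | hc
    · rw [isotypicProj_apply_of_mem h hx, isotypicProj_apply_of_mem h (hsub _ a n x hx)]
    · rw [isotypicProj_apply_of_ne h hc hx, isotypicProj_apply_of_ne h hc (hsub _ a n x hx),
        map_zero]

theorem sum_isotypicProj (h : DirectSum.IsInternal X.isotypic) {s : Finset ℂ} (hs : ∀ c, X.isotypic c ≠ ⊥ → c ∈ s) (x : M) :
    ∑ c ∈ s, X.isotypicProj c x = x := by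
  classical
  induction x using isotypic_induction h with
  | h0 => simp
  | hadd x y hx hy => simp only [map_add, Finset.sum_add_distrib, hx, hy]
  | hmem c x hx =>
    rw [Finset.sum_eq_single c]
    · exact isotypicProj_apply_of_mem h hx
    · exact fun c' _ hc => isotypicProj_apply_of_ne h hc.symm hx
    · intro hc
      by_contra hne
      refine hc (hs c fun h0 => hne ?_)
      rw [h0, Submodule.mem_bot] at hx
      rw [hx, map_zero]

end Isotypic

end WeakModule

end

end VOA

/-! ### Comparison of degree operators; membership in 𝒞₀. -/

namespace VOA

set_option linter.unusedSectionVars false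

noncomputable section

variable {V : Type u} [AddCommGroup V] [Module ℂ V] {A : VertexOperatorAlgebra V}

theorem eigenspace_eq_bot_of_forall_ne {M : Type*} [AddCommGroup M] [Module ℂ M]
    {d : Module.End ℂ M} (h : ⨆ k : ℕ, d.eigenspace k = ⊤) {c : ℂ} (hc : ∀ k : ℕ, c ≠ k) :
    d.eigenspace c = ⊥ := by
  have hd := d.eigenspaces_iSupIndep c
  have h1 : ⨆ (μ : ℂ) (_ : μ ≠ c), d.eigenspace μ = ⊤ := by
    rw [← top_le_iff, ← h]
    exact iSup_le fun j => le_iSup₂_of_le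
      (f := fun (μ : ℂ) (_ : μ ≠ c) => d.eigenspace μ) (j : ℂ) (hc j).symm le_rfl
  rw [h1, disjoint_top] at hd
  exact hd

namespace WeakModule

variable {M : Type u} [AddCommGroup M] [Module ℂ M] {X : WeakModule A M}

/-- Commuting degree operators agree if every nonzero submodule has nonzero elements of degree
zero. -/
theorem IsDegreeOp.eq {D d : Module.End ℂ M} (hD : X.IsDegreeOp D) (hd : X.IsDegreeOp d)
    (hcomm : Commute D d)
    (h1 : ∀ N, X.IsSub N → (∀ x ∈ N, D x ∈ N) → N ⊓ D.eigenspace 0 = ⊥ → N = ⊥)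
    (h2 : ∀ N, X.IsSub N → (∀ x ∈ N, d x ∈ N) → N ⊓ d.eigenspace 0 = ⊥ → N = ⊥) : D = d := by
  have hc : ∀ x, D (d x) = d (D x) := fun x => LinearMap.congr_fun hcomm.eq x
  have hsub : ∀ j, X.IsSub ((D - d).eigenspace j) := by
    intro j a n w hw
    rw [Module.End.mem_eigenspace_iff, LinearMap.sub_apply] at hw ⊢
    have h := congrArg (X.Y a n) hw
    rw [map_sub, map_smul] at h
    rw [hD.2, hd.2, ← h]
    abel
  have hstabD : ∀ j, ∀ x ∈ (D - d).eigenspace j, D x ∈ (D - d).eigenspace j := by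
    intro j x hx
    rw [Module.End.mem_eigenspace_iff, LinearMap.sub_apply] at hx ⊢
    rw [← map_smul, ← hx, map_sub, hc]
  have hstabd : ∀ j, ∀ x ∈ (D - d).eigenspace j, d x ∈ (D - d).eigenspace j := by
    intro j x hx
    rw [Module.End.mem_eigenspace_iff, LinearMap.sub_apply] at hx ⊢
    rw [← map_smul, ← hx, map_sub, hc]
  -- If nonzero, this submodule contains a vector of `D`-degree 0, whose `d`-degree is -j, and one
  -- of `d`-degree 0, whose `D`-degree is j. Both -j and j are then natural numbers, so `j = 0`.
  have hzero : ∀ j, j ≠ 0 → (D - d).eigenspace j = ⊥ := by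
    intro j hj
    by_contra hne
    obtain ⟨x, hx, hx0⟩ := Submodule.exists_mem_ne_zero_of_ne_bot
      (fun e => hne (h1 _ (hsub j) (hstabD j) e))
    obtain ⟨y, hy, hy0⟩ := Submodule.exists_mem_ne_zero_of_ne_bot
      (fun e => hne (h2 _ (hsub j) (hstabd j) e))
    rw [Submodule.mem_inf, Module.End.mem_eigenspace_iff, Module.End.mem_eigenspace_iff,
      zero_smul, LinearMap.sub_apply] at hx hy
    have hxd : x ∈ d.eigenspace (-j) := by
      rw [Module.End.mem_eigenspace_iff, neg_smul, ← hx.1, hx.2, zero_sub, neg_neg]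
    have hyD : y ∈ D.eigenspace j := by
      rw [Module.End.mem_eigenspace_iff, ← hy.1, hy.2, sub_zero]
    obtain ⟨k, hk⟩ : ∃ k : ℕ, -j = k := by
      by_contra hcon
      push Not at hcon
      rw [eigenspace_eq_bot_of_forall_ne hd.1 hcon] at hxd
      exact hx0 hxd
    obtain ⟨l, hl⟩ : ∃ k : ℕ, j = k := by
      by_contra hcon
      push Not at hcon
      rw [eigenspace_eq_bot_of_forall_ne hD.1 hcon] at hyD
      exact hy0 hyD
    have hkl : ((k + l : ℕ) : ℂ) = 0 := by
      push_cast
      rw [← hk, ← hl]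
      ring
    have hkl' : k + l = 0 := by exact_mod_cast hkl
    exact hj (by rw [hl, show l = 0 by omega, Nat.cast_zero])
  -- Commuting diagonalizable operators have a common eigenspace decomposition, so their difference
  -- is diagonalizable.
  have htop : ⨆ j, (D - d).eigenspace j = ⊤ := by
    rw [← top_le_iff, ← hD.1]
    refine iSup_le fun k => ?_
    have hst : ∀ x ∈ D.eigenspace (k : ℂ), d x ∈ D.eigenspace (k : ℂ) := by
      intro x hx
      rw [Module.End.mem_eigenspace_iff] at hx ⊢
      rw [hc, hx, map_smul]
    rw [← eq_iSup_inf_eigenspace_int hst (iSup_int_eq_top_of_nat hd.1)]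
    refine iSup_le fun i x hx => Submodule.mem_iSup_of_mem ((k : ℂ) - (i : ℂ)) ?_
    rw [Submodule.mem_inf, Module.End.mem_eigenspace_iff, Module.End.mem_eigenspace_iff] at hx
    rw [Module.End.mem_eigenspace_iff, LinearMap.sub_apply, hx.1, hx.2, sub_smul]
  have h0 : (D - d).eigenspace 0 = ⊤ := by
    rw [← top_le_iff, ← htop]
    refine iSup_le fun j => ?_
    rcases eq_or_ne j 0 with rfl | hj
    · exact le_rfl
    · rw [hzero j hj]
      exact bot_le
  rw [Module.End.eigenspace_zero, LinearMap.ker_eq_top] at h0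
  exact sub_eq_zero.1 h0

/-- Over a rational vertex operator algebra, `ℕ`-gradable weak modules are in `𝒞₀`. -/
theorem IsNGradable.inC0 (hA : A.IsRational) (hX : X.IsNGradable) : X.InC0 := by
  obtain ⟨θ, hθ, hnat, hiso, -, htop, -⟩ := exists_lowestWeightOp hA hX
  have hint := isInternal_isotypic hA hX
  refine ⟨htop, fun h => ?_⟩
  -- Weights in c + ℕ bound n from below when c lies in h + ℤ; otherwise the condition is vacuous. A
  -- common bound exists because only finitely many c occur.
  have hN : ∀ c : ℂ, ∃ N : ℤ, ∀ (n : ℤ) (k : ℕ), h + n = c + k → N ≤ n := by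
    intro c
    by_cases hc : ∃ n₀ : ℤ, h + n₀ = c
    · obtain ⟨n₀, rfl⟩ := hc
      refine ⟨n₀, fun n k hk => ?_⟩
      have : (n : ℂ) = (n₀ + k : ℤ) := by push_cast; linear_combination hk
      rw [Int.cast_inj.1 this]
      omega
    · exact ⟨0, fun n k hk => (hc ⟨n - k, by push_cast; linear_combination hk⟩).elim⟩
  choose N hN using hN
  set s := (finite_isotypic hA hX).toFinset with hs
  obtain ⟨K, hK⟩ := (s.image fun c => -N c).exists_le
  refine ⟨-K, fun n hn => (Submodule.eq_bot_iff _).2 fun x hx => ?_⟩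
  rw [← sum_isotypicProj hint (s := s) (by simp [hs]) x]
  refine Finset.sum_eq_zero fun c hc => ?_
  have hmem := isotypicProj_mem hint c x
  have hd : X.isotypicProj c x ∈ (X.L 0 - θ).eigenspace (h + n - c) := by
    rw [Module.End.mem_eigenspace_iff, LinearMap.sub_apply,
      Module.End.mem_eigenspace_iff.1 (hiso c hmem), L, ← isotypicProj_Y hint, ← L,
      Module.End.mem_eigenspace_iff.1 hx, map_smul, sub_smul]
  rw [eigenspace_eq_bot_of_forall_ne hnat, Submodule.mem_bot] at hd
  · exact hd
  · intro k hk
    have h1 := hN c n k (by linear_combination hk)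
    have h2 := hK _ (Finset.mem_image_of_mem (fun c => -N c) hc)
    omega

end WeakModule

/-! ### Intertwining operators and their commutator formulas. -/

section Intertwining

open WeakModule

variable {W₁ W₂ W₃ : Type u} [AddCommGroup W₁] [Module ℂ W₁] [AddCommGroup W₂] [Module ℂ W₂]
  [AddCommGroup W₃] [Module ℂ W₃] {X₁ : WeakModule A W₁} {X₂ : WeakModule A W₂}
  {X₃ : WeakModule A W₃} {I I' : W₁ →ₗ[ℂ] (ℂ → (W₂ →ₗ[ℂ] W₃))}

namespace IsIntertwining

theorem eventuallyZero (hI : IsIntertwining X₁ X₂ X₃ I) (u : W₁) (v : W₂) (α : ℂ) :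
    EventuallyZero fun i : ℕ => I u (α + i) v := by
  obtain ⟨N, hN⟩ := hI.truncation u v α
  exact ⟨N.toNat, fun i hi => by simpa using hN i (by omega)⟩

theorem eventuallyZero_p (hI : IsIntertwining X₁ X₂ X₃ I) (a : V) (u : W₁) (v : W₂) (k : ℤ)
    (α : ℂ) : EventuallyZero fun i : ℕ => X₃.Y a (k - i) (I u (α + i) v) := by
  obtain ⟨N, hN⟩ := hI.eventuallyZero u v α
  exact ⟨N, fun i hi => by
    have := hN i hi
    simp only at this
    simp only [this, map_zero]⟩

theorem eventuallyZero_q (I : W₁ →ₗ[ℂ] (ℂ → (W₂ →ₗ[ℂ] W₃))) (X₂ : WeakModule A W₂) (a : V)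
    (u : W₁) (v : W₂) (m : ℤ) (α : ℂ) :
    EventuallyZero fun i : ℕ => I u (α - i) (X₂.Y a (m + i) v) := by
  obtain ⟨N, hN⟩ := X₂.eventuallyZero a v m
  exact ⟨N, fun i hi => by
    have := hN i hi
    simp only at this
    simp only [this, map_zero]⟩

theorem eventuallyZero_r (I : W₁ →ₗ[ℂ] (ℂ → (W₂ →ₗ[ℂ] W₃))) (X₁ : WeakModule A W₁) (a : V)
    (u : W₁) (v : W₂) (l : ℤ) (α : ℂ) :
    EventuallyZero fun i : ℕ => I (X₁.Y a (l + i) u) (α - i) v := by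
  obtain ⟨N, hN⟩ := X₁.eventuallyZero a u l
  exact ⟨N, fun i hi => by
    have := hN i hi
    simp only at this
    simp only [this, map_zero, Pi.zero_apply, LinearMap.zero_apply]⟩

theorem zero : IsIntertwining X₁ X₂ X₃ 0 where
  truncation _ _ _ := ⟨0, fun _ _ => rfl⟩
  derivative _ _ _ := by simp
  jacobi _ _ _ _ _ _ := jacobiCoeff_eq_zero (fun _ => by simp) (fun _ => rfl) fun _ => rfl

theorem add (hI : IsIntertwining X₁ X₂ X₃ I) (hI' : IsIntertwining X₁ X₂ X₃ I') :
    IsIntertwining X₁ X₂ X₃ (I + I') where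
  truncation u v α := by
    obtain ⟨N, hN⟩ := hI.truncation u v α
    obtain ⟨K, hK⟩ := hI'.truncation u v α
    refine ⟨max N K, fun n hn => ?_⟩
    change I u (α + n) v + I' u (α + n) v = 0
    rw [hN n (le_of_max_le_left hn), hK n (le_of_max_le_right hn), add_zero]
  derivative u v α := by
    change I _ α v + I' _ α v = (-α) • (I u (α - 1) v + I' u (α - 1) v)
    rw [hI.derivative, hI'.derivative, smul_add]
  jacobi a u v l m α := by
    have h := jacobiCoeff_add (l := l) (m := m) (hI.eventuallyZero_p a u v (m + l) α)
      (eventuallyZero_q I X₂ a u v m (α + l)) (eventuallyZero_r I X₁ a u v l (m + α))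
      (hI'.eventuallyZero_p a u v (m + l) α)
      (eventuallyZero_q I' X₂ a u v m (α + l)) (eventuallyZero_r I' X₁ a u v l (m + α))
    rw [hI.jacobi, hI'.jacobi, add_zero] at h
    rw [← h]
    congr 1
    funext i
    exact map_add _ _ _

theorem sum {ι : Type*} {s : Finset ι} {J : ι → W₁ →ₗ[ℂ] (ℂ → (W₂ →ₗ[ℂ] W₃))}
    (hJ : ∀ c ∈ s, IsIntertwining X₁ X₂ X₃ (J c)) : IsIntertwining X₁ X₂ X₃ (∑ c ∈ s, J c) :=
  Finset.sum_induction J (IsIntertwining X₁ X₂ X₃) (fun _ _ => add) zero hJ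

theorem commutator (hI : IsIntertwining X₁ X₂ X₃ I) (a : V) (u : W₁) (v : W₂) (m : ℤ) (α : ℂ)
    {N : ℕ} (hN : ∀ i ≥ N, X₁.Y a i u = 0) :
    X₃.Y a m (I u α v) = I u α (X₂.Y a m v) + ∑ i ∈ Finset.range N,
      ((Ring.choose m i : ℤ) : ℂ) • I (X₁.Y a i u) (m + α - i) v := by
  have h := hI.jacobi a u v 0 m α
  rw [jacobiCoeff_zero, finsum_eq_sum_range (N := N) (fun i hi => by simp [hN i hi])] at h
  simp only [Nat.cast_zero, add_zero, sub_zero, zero_add, Int.cast_zero] at h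
  rw [sub_sub, sub_eq_zero] at h
  exact h

/-- The commutator of `L(0)` with the modes of an intertwining operator. -/
theorem L_zero_bracket (hI : IsIntertwining X₁ X₂ X₃ I) (u : W₁) (v : W₂) (α : ℂ) :
    X₃.L 0 (I u α v) = I u α (X₂.L 0 v) + I (X₁.L 0 u) α v - (α + 1) • I u α v := by
  obtain ⟨N, hN⟩ := X₁.eventuallyZero_nat A.conformal u
  -- Since `L(0)` is the mode `ω_1`, only two terms survive: `ω_0 u = L(-1)u`, handled by the
  -- derivative property, and `ω_1 u = L(0)u`. The `+ 2` leaves room to split them off.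
  have h := hI.commutator A.conformal u v 1 α (N := N + 2) fun i hi => hN i (by omega)
  rw [Finset.sum_range_succ', Finset.sum_range_succ'] at h
  rw [Finset.sum_eq_zero (fun i _ => by rw [choose_one _ (by omega)]; simp)] at h
  have hd := hI.derivative u v (1 + α)
  simp only [L, zero_add, neg_add_cancel, add_sub_cancel_left] at hd ⊢
  simp only [Ring.choose_zero_right, Ring.choose_one_right, Nat.cast_zero, Int.cast_one, one_smul,
    zero_add, Nat.cast_one, sub_zero, add_sub_cancel_left, hd] at h
  rw [h]
  module

end IsIntertwining

end Intertwining

/-! ### The canonical intertwining operator on T. -/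

section TensorProduct

open WeakModule

variable {W₁ W₂ : Type u} [AddCommGroup W₁] [Module ℂ W₁] [AddCommGroup W₂] [Module ℂ W₂]
  {X₁ : WeakModule A W₁} {X₂ : WeakModule A W₂}

section CanonicalPart

variable {Z : WeakModule A (TP X₁ X₂)}

theorem canonicalPart_of_int {c α : ℂ} {n : ℤ}
    (hn : (n : ℂ) = α + c - X₁.lowestWeight - X₂.lowestWeight) (u : W₁) (v : W₂) :
    canonicalPart X₁ X₂ Z c u α v = Z.isotypicProj c (proj X₁ X₂ (gen n u v)) := by
  have e : ∃ n : ℤ, (n : ℂ) = α + c - X₁.lowestWeight - X₂.lowestWeight := ⟨n, hn⟩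
  have he : e.choose = n := Int.cast_injective (α := ℂ) (e.choose_spec.trans hn.symm)
  rw [canonicalPart, LinearMap.pi_apply, dif_pos e, he]
  rfl

theorem canonicalPart_of_not {c α : ℂ}
    (h : ¬ ∃ n : ℤ, (n : ℂ) = α + c - X₁.lowestWeight - X₂.lowestWeight) (u : W₁) (v : W₂) :
    canonicalPart X₁ X₂ Z c u α v = 0 := by
  rw [canonicalPart, LinearMap.pi_apply, dif_neg h]
  rfl

theorem canonicalPart_mem (hZ : DirectSum.IsInternal Z.isotypic) (c α : ℂ) (u : W₁) (v : W₂) :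
    canonicalPart X₁ X₂ Z c u α v ∈ Z.isotypic c := by
  by_cases e : ∃ n : ℤ, (n : ℂ) = α + c - X₁.lowestWeight - X₂.lowestWeight
  · obtain ⟨n, hn⟩ := e
    rw [canonicalPart_of_int hn]
    exact isotypicProj_mem hZ c _
  · rw [canonicalPart_of_not e]
    exact Submodule.zero_mem _

theorem canonicalPart_eq_zero (hZ : DirectSum.IsInternal Z.isotypic) {c : ℂ}
    (hc : Z.isotypic c = ⊥) : canonicalPart X₁ X₂ Z c = 0 := by
  refine LinearMap.ext fun u => funext fun α => LinearMap.ext fun v => ?_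
  have h := canonicalPart_mem hZ c α u v
  rwa [hc, Submodule.mem_bot] at h

theorem canonicalF_eq_sum (hZ : DirectSum.IsInternal Z.isotypic) {s : Finset ℂ}
    (hs : ∀ c, Z.isotypic c ≠ ⊥ → c ∈ s) :
    canonicalF X₁ X₂ Z = ∑ c ∈ s, canonicalPart X₁ X₂ Z c :=
  finsum_eq_finsetSum_of_support_subset _ fun c hc =>
    hs c fun h => hc (canonicalPart_eq_zero hZ h)

theorem canonicalF_apply (hZ : DirectSum.IsInternal Z.isotypic) {s : Finset ℂ}
    (hs : ∀ c, Z.isotypic c ≠ ⊥ → c ∈ s) (u : W₁) (α : ℂ) (v : W₂) :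
    canonicalF X₁ X₂ Z u α v = ∑ c ∈ s, canonicalPart X₁ X₂ Z c u α v := by
  rw [canonicalF_eq_sum hZ hs]
  simp only [LinearMap.sum_apply, Finset.sum_apply]

theorem isotypicProj_canonicalF (hZ : DirectSum.IsInternal Z.isotypic)
    (hfin : {c : ℂ | Z.isotypic c ≠ ⊥}.Finite) (c α : ℂ) (u : W₁) (v : W₂) :
    Z.isotypicProj c (canonicalF X₁ X₂ Z u α v) = canonicalPart X₁ X₂ Z c u α v := by
  classical
  rw [canonicalF_apply hZ (s := insert c hfin.toFinset) (fun c hc => by simp [hc]), map_sum,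
    Finset.sum_eq_single c]
  · exact isotypicProj_apply_of_mem hZ (canonicalPart_mem hZ c α u v)
  · exact fun c' _ hc => isotypicProj_apply_of_ne hZ hc (canonicalPart_mem hZ c' α u v)
  · exact fun h => absurd (Finset.mem_insert_self _ _) h

end CanonicalPart

variable (h₁ : ⨆ n, X₁.deg n = ⊤) (h₂ : ⨆ n, X₂.deg n = ⊤)

theorem TModule_isNGradable : (TModule h₁ h₂).IsNGradable :=
  (degreeT_isDegreeOp h₁ h₂).isNGradable

/-- The degree of T and the degree `L(0) - θ` from complete reducibility agree: both have the
property that a nonzero stable submodule meets degree 0, the first by the radical quotient. Thus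
`L(0)` minus the degree of T is `θ`. -/
theorem isotypicProj_L_zero_sub_degreeT (hA : A.IsRational) (c : ℂ) (x : TP X₁ X₂) :
    (TModule h₁ h₂).isotypicProj c ((TModule h₁ h₂).L 0 x - degreeT h₁ h₂ x)
      = c • (TModule h₁ h₂).isotypicProj c x := by
  have hG := TModule_isNGradable h₁ h₂
  have hint := isInternal_isotypic hA hG
  obtain ⟨θ, hθ, hnat, hiso, -, -, hbot⟩ := exists_lowestWeightOp hA hG
  have hd := isDegreeOp_of_hom hθ hnat
  have hD := degreeT_isDegreeOp h₁ h₂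
  have hE : IsHom (TModule h₁ h₂) (TModule h₁ h₂) ((TModule h₁ h₂).L 0 - degreeT h₁ h₂) := by
    intro a n w
    rw [LinearMap.sub_apply, LinearMap.sub_apply, hD.2, WeakModule.L_zero_bracket, map_sub]
    abel
  -- Every endomorphism preserves the isotypic components, on which `θ` is scalar, so `θ` commutes
  -- with it. Applied to `L(0)` minus the degree, this makes the two degree operators commute.
  have hhomθ : ∀ {f}, IsHom (TModule h₁ h₂) (TModule h₁ h₂) f → ∀ x, f (θ x) = θ (f x) := by
    intro f hf x
    induction x using isotypic_induction hint with
    | h0 => simp only [map_zero]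
    | hadd x y hx hy => simp only [map_add, hx, hy]
    | hmem c x hx =>
      rw [Module.End.mem_eigenspace_iff.1 (hiso c hx), map_smul,
        Module.End.mem_eigenspace_iff.1 (hiso c (isotypic_map hf c (Submodule.mem_map_of_mem hx)))]
  have hcomm : Commute (degreeT h₁ h₂) ((TModule h₁ h₂).L 0 - θ) := by
    refine LinearMap.ext fun x => ?_
    have e1 := hhomθ hE x
    have e2 : θ ((TModule h₁ h₂).L 0 x) = (TModule h₁ h₂).L 0 (θ x) := hθ _ _ _
    have e3 : ((TModule h₁ h₂).L 0 - degreeT h₁ h₂) ((TModule h₁ h₂).L 0 x)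
      = (TModule h₁ h₂).L 0 (((TModule h₁ h₂).L 0 - degreeT h₁ h₂) x) := hE _ _ _
    simp only [LinearMap.sub_apply, map_sub, Module.End.mul_apply] at e1 e3 ⊢
    have e4 : degreeT h₁ h₂ ((TModule h₁ h₂).L 0 x) = (TModule h₁ h₂).L 0 (degreeT h₁ h₂ x) :=
      sub_right_injective e3
    rw [e2] at e1
    rw [e4, sub_right_injective e1]
  have heq : degreeT h₁ h₂ = (TModule h₁ h₂).L 0 - θ := by
    refine hD.eq hd hcomm (fun N => eq_bot_of_inf_degreeT h₁ h₂) fun N hN hN' h0 => hbot N hN ?_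
    rw [← eq_iSup_inf_eigenspace_int hN' (iSup_int_eq_top_of_nat hnat)]
    refine iSup_le fun k => ?_
    rcases eq_or_ne k 0 with rfl | hk
    · rw [Int.cast_zero, h0]
      exact bot_le
    · exact inf_le_right.trans (le_iSup₂_of_le (f := fun (k : ℤ) (_ : k ≠ 0) =>
        ((TModule h₁ h₂).L 0 - θ).eigenspace (k : ℂ)) k hk le_rfl)
  rw [heq, LinearMap.sub_apply, sub_sub_cancel]
  induction x using isotypic_induction hint with
  | h0 => simp only [map_zero, smul_zero]
  | hadd x y hx hy => simp only [map_add, hx, hy, smul_add]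
  | hmem c' x hx =>
    rw [Module.End.mem_eigenspace_iff.1 (hiso c' hx), map_smul]
    rcases eq_or_ne c' c with rfl | hc
    · rfl
    · rw [isotypicProj_apply_of_ne hint hc hx, smul_zero, smul_zero]

/-- The `L(-1)`-derivative property of the canonical operator, in components. -/
theorem isotypicProj_proj_gen_derivative (hA : A.IsRational) (c : ℂ) (n : ℤ) (u : W₁) (v : W₂) :
    (TModule h₁ h₂).isotypicProj c (proj X₁ X₂ (gen (n + 1) (X₁.L (-1) u) v))
      = (c - X₁.lowestWeight - X₂.lowestWeight - (n + 1)) •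
        (TModule h₁ h₂).isotypicProj c (proj X₁ X₂ (gen n u v)) := by
  have h := isotypicProj_L_zero_sub_degreeT h₁ h₂ hA c (proj X₁ X₂ (gen n u v))
  obtain ⟨N, hN⟩ := X₁.eventuallyZero_nat A.conformal u
  rw [L, TModule_proj, degreeT_proj, degree0_gen,
    act0_gen_range X₁ X₂ A.conformal (0 + 1) n u v (N := N + 2) fun i hi => hN i (by omega),
    Finset.sum_range_succ', Finset.sum_range_succ',
    Finset.sum_eq_zero (fun i _ => by rw [zero_add, choose_one _ (by omega)]; simp)] at h
  -- The terms with `L(0)u` and `L(0)v` cancel between `L(0)` and the degree. There remain `t^(n+1)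
  -- ⊗ L(-1)u ⊗ v` and the scalar h₁ + h₂ + n + 1.
  simp only [degOp_apply, L, gen_sub_left, gen_sub_right, gen_smul_left, gen_smul_right, zero_add,
    Ring.choose_zero_right, Ring.choose_one_right, Nat.cast_zero, Int.cast_one, one_smul,
    Nat.cast_one, sub_zero, add_sub_cancel_left, map_add, map_sub, map_smul] at h
  simp only [L, neg_add_cancel, add_comm n 1]
  linear_combination (norm := module) h

/-- The map F₁ → T followed by `P_c` is a homomorphism killing J₁, whence the Jacobi identity. The
indices in each identity differ by integers, so either all of them correspond to powers of t or
every mode vanishes. -/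
theorem canonicalPart_isIntertwining (hA : A.IsRational) (c : ℂ) :
    IsIntertwining X₁ X₂ (TModule h₁ h₂) (canonicalPart X₁ X₂ (TModule h₁ h₂) c) := by
  have hint := isInternal_isotypic hA (TModule_isNGradable h₁ h₂)
  set Z := TModule h₁ h₂ with hZ
  set q : F1 X₁ X₂ →ₗ[ℂ] TP X₁ X₂ :=
    Z.isotypicProj c ∘ₗ (radical X₁ X₂).mkQ ∘ₗ (J1 X₁ X₂).mkQ with hq
  have hqgen : ∀ n u v, q (gen1 X₁ X₂ n u v) = Z.isotypicProj c (proj X₁ X₂ (gen n u v)) :=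
    fun _ _ _ => rfl
  have hqact : ∀ a n x, q (act1 X₁ X₂ a n x) = Z.Y a n (q x) := by
    intro a n x
    obtain ⟨x, rfl⟩ := (J0 X₁ X₂).mkQ_surjective x
    exact isotypicProj_Y hint c a n (proj X₁ X₂ x)
  have hqJ : ∀ x ∈ J1 X₁ X₂, q x = 0 := by
    intro x hx
    have h : (J1 X₁ X₂).mkQ x = 0 := (Submodule.Quotient.mk_eq_zero _).2 hx
    rw [hq, LinearMap.comp_apply, LinearMap.comp_apply, h, map_zero, map_zero]
  constructor
  · intro u v α
    by_cases e : ∃ n : ℤ, (n : ℂ) = α + c - X₁.lowestWeight - X₂.lowestWeight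
    · obtain ⟨k, hk⟩ := e
      obtain ⟨N, hN⟩ := gen1_eventually h₁ h₂ u v
      refine ⟨N - k, fun n hn => ?_⟩
      rw [canonicalPart_of_int (n := k + n) (by push_cast; linear_combination hk), ← hqgen,
        hN _ (by omega), map_zero]
    · refine ⟨0, fun n _ => canonicalPart_of_not (fun ⟨k, hk⟩ => e ⟨k - n, ?_⟩) u v⟩
      push_cast
      linear_combination hk
  · intro u v α
    by_cases e : ∃ n : ℤ, (n : ℂ) = α + c - X₁.lowestWeight - X₂.lowestWeight
    · obtain ⟨k, hk⟩ := e
      rw [canonicalPart_of_int (n := k - 1 + 1) (by push_cast; linear_combination hk),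
        canonicalPart_of_int (n := k - 1) (by push_cast; linear_combination hk), hZ,
        isotypicProj_proj_gen_derivative h₁ h₂ hA]
      congr 1
      push_cast
      linear_combination -hk
    · rw [canonicalPart_of_not e, canonicalPart_of_not, smul_zero]
      refine fun ⟨k, hk⟩ => e ⟨k + 1, ?_⟩
      push_cast
      linear_combination hk
  · intro a u v l m α
    by_cases e : ∃ n : ℤ, (n : ℂ) = α + c - X₁.lowestWeight - X₂.lowestWeight
    · obtain ⟨k, hk⟩ := e
      have h := hqJ _ (jacobiGen_mem (X₁ := X₁) (X₂ := X₂) a u v l m k)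
      rw [jacobiGen, map_jacobiCoeff q (eventuallyZero_jacobiGen_p h₁ h₂ a u v _ _)
        (eventuallyZero_jacobiGen_q a u v _ _) (eventuallyZero_jacobiGen_r a u v _ _)] at h
      rw [← h]
      congr 1 <;> funext i
      · rw [hqact, hqgen, canonicalPart_of_int (n := k + i) (by push_cast; linear_combination hk)]
      · rw [hqgen,
          canonicalPart_of_int (n := k + l - i) (by push_cast; linear_combination hk)]
      · rw [hqgen,
          canonicalPart_of_int (n := m + k - i) (by push_cast; linear_combination hk)]
    · refine jacobiCoeff_eq_zero (fun i => ?_) (fun i => ?_) fun i => ?_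
      · rw [canonicalPart_of_not, map_zero]
        refine fun ⟨k, hk⟩ => e ⟨k - i, ?_⟩
        push_cast
        linear_combination hk
      · rw [canonicalPart_of_not]
        refine fun ⟨k, hk⟩ => e ⟨k - l + i, ?_⟩
        push_cast
        linear_combination hk
      · rw [canonicalPart_of_not]
        refine fun ⟨k, hk⟩ => e ⟨k - m + i, ?_⟩
        push_cast
        linear_combination hk

theorem canonicalF_isIntertwining (hA : A.IsRational) :
    IsIntertwining X₁ X₂ (TModule h₁ h₂) (canonicalF X₁ X₂ (TModule h₁ h₂)) := by
  have hG := TModule_isNGradable h₁ h₂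
  rw [canonicalF_eq_sum (isInternal_isotypic hA hG) (s := (finite_isotypic hA hG).toFinset)
    (by simp)]
  exact .sum fun c _ => canonicalPart_isIntertwining h₁ h₂ hA c

/-! ### The universal property. -/

section Universal

variable {W : Type u} [AddCommGroup W] [Module ℂ W] {X : WeakModule A W}
  {I : W₁ →ₗ[ℂ] (ℂ → (W₂ →ₗ[ℂ] W))}

/-- The homomorphism from the tensor product to the component of lowest weight `c` that is
induced by an intertwining operator. -/
theorem exists_componentHom (hA : A.IsRational) (hX : X.IsNGradable)
    (hI : IsIntertwining X₁ X₂ X I) (c : ℂ) :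
    ∃ g : TP X₁ X₂ →ₗ[ℂ] W, IsHom (TModule h₁ h₂) X g ∧ ∀ n u v,
      g (proj X₁ X₂ (gen n u v))
        = X.isotypicProj c (I u (n - c + X₁.lowestWeight + X₂.lowestWeight) v) := by
  have hint := isInternal_isotypic hA hX
  obtain ⟨θ, hθ, hnat, hiso, -, -, hbot⟩ := exists_lowestWeightOp hA hX
  -- The index shift that undoes the factor x^(c - h₁ - h₂) in F.
  set β : ℤ → ℂ := fun n => n - c + X₁.lowestWeight + X₂.lowestWeight with hβ
  obtain ⟨f, hf⟩ := exists_F0_lift (W₁ := W₁) (W₂ := W₂) (M := W) fun n =>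
    (LinearMap.proj (β n) ∘ₗ I).compr₂ (X.isotypicProj c)
  replace hf : ∀ n u v, f (gen n u v) = X.isotypicProj c (I u (β n) v) := hf
  have hact : ∀ a m x, f (act0 X₁ X₂ a m x) = X.Y a m (f x) := by
    intro a m x
    refine LinearMap.congr_fun (F0_hom_ext (f := f ∘ₗ act0 X₁ X₂ a m) (g := X.Y a m ∘ₗ f)
      fun n u v => ?_) x
    obtain ⟨N, hN⟩ := X₁.eventuallyZero_nat a u
    rw [LinearMap.comp_apply, LinearMap.comp_apply, act0_gen_range X₁ X₂ a m n u v hN, map_add,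
      map_sum, hf, hf, ← isotypicProj_Y hint, hI.commutator a u v m _ hN, map_add, map_sum]
    congr 1
    refine Finset.sum_congr rfl fun i _ => ?_
    rw [map_smul, map_smul, hf]
    congr 4
    simp only [hβ]
    push_cast
    ring_nf
  have hdeg : ∀ x, f (degree0 X₁ X₂ x) = (X.L 0 - θ) (f x) := by
    intro x
    refine LinearMap.congr_fun (F0_hom_ext (f := f ∘ₗ degree0 X₁ X₂) (g := (X.L 0 - θ) ∘ₗ f)
      fun n u v => ?_) x
    rw [LinearMap.comp_apply, LinearMap.comp_apply, degree0_gen, hf, LinearMap.sub_apply,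
      Module.End.mem_eigenspace_iff.1 (hiso c (isotypicProj_mem hint c _)), L,
      ← isotypicProj_Y hint, ← L, hI.L_zero_bracket]
    simp only [degOp_apply, gen_sub_left, gen_sub_right, gen_smul_left, gen_smul_right, map_add,
      map_sub, map_smul, hf]
    simp only [hβ]
    module
  -- A generator of J₀ has degree -i - 1, and `f` carries degree to `L(0) - θ`, whose eigenvalues
  -- are natural numbers.
  have hJ0 : J0 X₁ X₂ ≤ LinearMap.ker f := by
    refine sInf_le ⟨fun a k x hx => ?_, fun m n i u hu v hv => ?_⟩
    · rw [LinearMap.mem_ker] at hx ⊢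
      rw [hact, hx, map_zero]
    · have h := hdeg (gen ((m : ℤ) + n + i) u v)
      rw [degree0_of_deg X₁ X₂ hu hv, map_smul] at h
      have h' := Module.End.mem_eigenspace_iff.2 h.symm
      rwa [eigenspace_int_of_neg hnat (by omega), Submodule.mem_bot] at h'
  set f₁ : F1 X₁ X₂ →ₗ[ℂ] W := (J0 X₁ X₂).liftQ f hJ0 with hf₁
  have hf₁gen : ∀ n u v, f₁ (gen1 X₁ X₂ n u v) = X.isotypicProj c (I u (β n) v) := hf
  have hf₁act : ∀ a m x, f₁ (act1 X₁ X₂ a m x) = X.Y a m (f₁ x) := by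
    intro a m x
    obtain ⟨x, rfl⟩ := (J0 X₁ X₂).mkQ_surjective x
    exact hact a m x
  have hJ1 : J1 X₁ X₂ ≤ LinearMap.ker f₁ := by
    refine J1_induction fun a u v l m n => ?_
    have h := congrArg (X.isotypicProj c) (hI.jacobi a u v l m (β n))
    rw [map_zero, map_jacobiCoeff _ (hI.eventuallyZero_p a u v (m + l) (β n))
      (IsIntertwining.eventuallyZero_q I X₂ a u v m (β n + l))
      (IsIntertwining.eventuallyZero_r I X₁ a u v l (m + β n))] at h
    rw [LinearMap.mem_ker, jacobiGen, map_jacobiCoeff f₁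
      (eventuallyZero_jacobiGen_p h₁ h₂ a u v _ _)
      (eventuallyZero_jacobiGen_q a u v _ _) (eventuallyZero_jacobiGen_r a u v _ _), ← h]
    congr 1 <;> funext i
    · rw [hf₁act, hf₁gen, isotypicProj_Y hint]
      congr 4
      simp only [hβ]
      push_cast
      ring_nf
    · rw [hf₁gen]
      congr 3
      simp only [hβ]
      push_cast
      ring_nf
    · rw [hf₁gen]
      congr 3
      simp only [hβ]
      push_cast
      ring_nf
  set f₂ : F2 X₁ X₂ →ₗ[ℂ] W := (J1 X₁ X₂).liftQ f₁ hJ1 with hf₂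
  have hf₂π : ∀ x, f₂ (π₂ X₁ X₂ x) = f x := fun _ => rfl
  -- The image of the radical is a submodule of W lying in nonzero degrees, and complete
  -- reducibility of W leaves only zero.
  have hrad : radical X₁ X₂ ≤ LinearMap.ker f₂ := by
    rw [LinearMap.le_ker_iff_map]
    refine hbot _ ?_ ?_
    · rintro a n _ ⟨x, hx, rfl⟩
      refine ⟨_, radical_isSub h₁ h₂ a n x hx, ?_⟩
      obtain ⟨x, rfl⟩ := π₂_surjective x
      rw [F2Module_π₂, hf₂π, hf₂π, hact]
    · refine (Submodule.map_mono (radical_le h₁ h₂)).trans ?_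
      rw [Submodule.map_iSup]
      refine iSup_le fun k => ?_
      rw [Submodule.map_iSup]
      refine iSup_le fun hk => le_iSup₂_of_le (f := fun (k : ℤ) (_ : k ≠ 0) =>
        (X.L 0 - θ).eigenspace (k : ℂ)) k hk ?_
      rintro _ ⟨x, hx, rfl⟩
      replace hx := Module.End.mem_eigenspace_iff.1 hx
      obtain ⟨x, rfl⟩ := π₂_surjective x
      rw [degree2_π₂] at hx
      rw [Module.End.mem_eigenspace_iff, hf₂π, ← hdeg, ← hf₂π, hx, map_smul, hf₂π]
  refine ⟨(radical X₁ X₂).liftQ f₂ hrad, fun a n x => ?_, hf⟩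
  obtain ⟨x, rfl⟩ := proj_surjective x
  exact hact a n x

include h₁ h₂ in
-- On homogeneous vectors the component has degree h₁ + m + h₂ + n - α - 1 - c for `L(0) - θ`, which
-- must be a natural number if the component is nonzero. Thus `P_c I` involves only the powers of x
-- that F can match.
theorem isotypicProj_eq_zero_of_not_int (hA : A.IsRational) (hX : X.IsNGradable)
    (hI : IsIntertwining X₁ X₂ X I) {c α : ℂ}
    (h : ¬ ∃ n : ℤ, (n : ℂ) = α + c - X₁.lowestWeight - X₂.lowestWeight) (u : W₁) (v : W₂) :
    X.isotypicProj c (I u α v) = 0 := by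
  have hint := isInternal_isotypic hA hX
  obtain ⟨θ, hθ, hnat, hiso, -, -, -⟩ := exists_lowestWeightOp hA hX
  have hu : u ∈ ⨆ n, X₁.deg n := h₁ ▸ Submodule.mem_top
  have hv : v ∈ ⨆ n, X₂.deg n := h₂ ▸ Submodule.mem_top
  induction hu using Submodule.iSup_induction' with
  | zero => simp
  | add x y _ _ hx hy => simp only [map_add, Pi.add_apply, LinearMap.add_apply, hx, hy, add_zero]
  | mem m u hu =>
    induction hv using Submodule.iSup_induction' with
    | zero => simp
    | add x y _ _ hx hy => simp only [map_add, hx, hy, add_zero]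
    | mem n v hv =>
      have hmem : X.isotypicProj c (I u α v) ∈ (X.L 0 - θ).eigenspace
          (X₁.lowestWeight + m + (X₂.lowestWeight + n) - (α + 1) - c) := by
        rw [Module.End.mem_eigenspace_iff, LinearMap.sub_apply,
          Module.End.mem_eigenspace_iff.1 (hiso c (isotypicProj_mem hint c _)), L,
          ← isotypicProj_Y hint, ← L, hI.L_zero_bracket, Module.End.mem_eigenspace_iff.1 hu,
          Module.End.mem_eigenspace_iff.1 hv]
        simp only [map_add, map_sub, map_smul, Pi.smul_apply, LinearMap.smul_apply]
        module
      rw [eigenspace_eq_bot_of_forall_ne hnat, Submodule.mem_bot] at hmem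
      · exact hmem
      · intro k hk
        refine h ⟨(m : ℤ) + n - 1 - k, ?_⟩
        push_cast
        linear_combination hk

theorem canonicalF_universal (hA : A.IsRational) (hX : X.InC0) (hI : IsIntertwining X₁ X₂ X I) :
    ∃! g : TP X₁ X₂ →ₗ[ℂ] W, IsHom (TModule h₁ h₂) X g ∧
      ∀ u α v, I u α v = g (canonicalF X₁ X₂ (TModule h₁ h₂) u α v) := by
  classical
  have hG := TModule_isNGradable h₁ h₂
  have hint := isInternal_isotypic hA hG
  have hfin := finite_isotypic hA hG
  have hintX := isInternal_isotypic hA hX.isNGradable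
  have hfinX := finite_isotypic hA hX.isNGradable
  set s := hfin.toFinset ∪ hfinX.toFinset with hs
  have hsT : ∀ c, (TModule h₁ h₂).isotypic c ≠ ⊥ → c ∈ s := fun c hc => by simp [hs, hc]
  have hsX : ∀ c, X.isotypic c ≠ ⊥ → c ∈ s := fun c hc => by simp [hs, hc]
  choose g hg hggen using exists_componentHom h₁ h₂ hA hX.isNGradable hI
  have hsum : IsHom (TModule h₁ h₂) X (∑ c ∈ s, g c) := fun a n w => by
    simp only [LinearMap.sum_apply, map_sum, hg _ a n w]
  refine ⟨∑ c ∈ s, g c, ⟨hsum, fun u α v => ?_⟩, fun g' hg' => ?_⟩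
  · rw [canonicalF_apply hint hsT, map_sum, ← sum_isotypicProj hintX hsX (I u α v)]
    refine Finset.sum_congr rfl fun c hc => ?_
    by_cases e : ∃ n : ℤ, (n : ℂ) = α + c - X₁.lowestWeight - X₂.lowestWeight
    · obtain ⟨n, hn⟩ := e
      rw [canonicalPart_of_int hn, isotypicProj_hom hint hintX hsum, LinearMap.sum_apply, map_sum,
        Finset.sum_eq_single c, hggen,
        isotypicProj_apply_of_mem hintX (isotypicProj_mem hintX c _),
        show (n : ℂ) - c + X₁.lowestWeight + X₂.lowestWeight = α by linear_combination hn]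
      · intro c' _ hc'
        rw [hggen, isotypicProj_apply_of_ne hintX hc' (isotypicProj_mem hintX c' _)]
      · exact fun h => absurd hc h
    · rw [canonicalPart_of_not e, map_zero,
        isotypicProj_eq_zero_of_not_int h₁ h₂ hA hX.isNGradable hI e]
  -- Homomorphisms commute with isotypic projections, so `I` prescribes the value on each `P_c π(tⁿ
  -- ⊗ u ⊗ v)`; these elements span T.
  · have hkey : ∀ {f : TP X₁ X₂ →ₗ[ℂ] W}, IsHom (TModule h₁ h₂) X f →
        (∀ u α v, I u α v = f (canonicalF X₁ X₂ (TModule h₁ h₂) u α v)) → ∀ c n u v,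
        f ((TModule h₁ h₂).isotypicProj c (proj X₁ X₂ (gen n u v)))
          = X.isotypicProj c (I u (n - c + X₁.lowestWeight + X₂.lowestWeight) v) := by
      intro f hf hfI c n u v
      rw [hfI, ← isotypicProj_hom hint hintX hf, isotypicProj_canonicalF hint hfin,
        canonicalPart_of_int (n := n) (α := n - c + X₁.lowestWeight + X₂.lowestWeight) (by ring)]
    have h2 : ∀ x, g' (proj X₁ X₂ x) = (∑ c ∈ s, g c) (proj X₁ X₂ x) := by
      intro x
      refine LinearMap.congr_fun (F0_hom_ext (f := g' ∘ₗ proj X₁ X₂)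
        (g := (∑ c ∈ s, g c) ∘ₗ proj X₁ X₂) fun n u v => ?_) x
      rw [LinearMap.comp_apply, LinearMap.comp_apply, LinearMap.sum_apply,
        ← sum_isotypicProj hint hsT (proj X₁ X₂ (gen n u v)), map_sum]
      rw [sum_isotypicProj hint hsT]
      exact Finset.sum_congr rfl fun c _ => by rw [hkey hg'.1 hg'.2, hggen]
    refine LinearMap.ext fun x => ?_
    obtain ⟨x, rfl⟩ := proj_surjective x
    exact h2 x

end Universal

end TensorProduct

end

end VOA

theorem theorem3p20 {V W₁ W₂ : Type u} [AddCommGroup V] [Module ℂ V]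
    [AddCommGroup W₁] [Module ℂ W₁] [AddCommGroup W₂] [Module ℂ W₂]
    (A : VOA.VertexOperatorAlgebra V) (hA : A.IsRational)
    (X₁ : VOA.WeakModule A W₁) (X₂ : VOA.WeakModule A W₂)
    (hC₁ : X₁.InC0) (hC₂ : X₂.InC0) (hI₁ : X₁.IsIrreducible) (hI₂ : X₂.IsIrreducible) :
    ∃ Z : VOA.WeakModule A (VOA.TP X₁ X₂),
      (∀ (a : V) (k : ℤ) (x : VOA.F0 W₁ W₂),
        Z.Y a k (VOA.proj X₁ X₂ x) = VOA.proj X₁ X₂ (VOA.act0 X₁ X₂ a k x)) ∧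
      DirectSum.IsInternal Z.isotypic ∧
      {c : ℂ | Z.isotypic c ≠ ⊥}.Finite ∧
      VOA.IsTensorProductC0 X₁ X₂ Z (VOA.canonicalF X₁ X₂ Z) := by
  have h₁ := VOA.WeakModule.iSup_deg hC₁ hI₁
  have h₂ := VOA.WeakModule.iSup_deg hC₂ hI₂
  have hG := VOA.TModule_isNGradable h₁ h₂
  exact ⟨VOA.TModule h₁ h₂, VOA.TModule_proj h₁ h₂, VOA.WeakModule.isInternal_isotypic hA hG,
    VOA.WeakModule.finite_isotypic hA hG, hC₁, hC₂, hG.inC0 hA,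
    VOA.canonicalF_isIntertwining h₁ h₂ hA,
    fun _ _ _ _ hX _ hI => VOA.canonicalF_universal h₁ h₂ hA hX hI⟩
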